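/- **Setting.** Fix $z>0$. Let $\Gamma$ have vertex set $\mathbb Z\times 2\mathbb Z$; two vertices are of the same class if their horizontal coordinates have the same parity. Let $P$ be the transition matrix of the (odd or even) effective walk on $\Gamma$ with monomer weight $z$, symmetrised with respect to the real line: from a vertex off the real line it jumps by $\pm2e_1,\pm2e_2$ with probability $1/4$ each; from a vertex on the real line it jumps by $\pm 2e_2$ with probability $s/2$ each, and with probability $1-s$ it makes a horizontal jump of law $\nu$ along the real line, where $s\in(0,1)$ is any fixed number (the walk reflected to the half-plane is the effective walk of the free boundary dimer model for $s=1/4$ in the odd case and $s=1/(3+2z^2)$ in the even case; the matrix $P$ is symmetric for $s=1/2$). In the even case $\nu(\pm1)=\frac{z^2}{2+2z^2}$ and $\nu(\pm2)=\frac{1}{2+2z^2}$. In the odd case $\nu(k)=\frac13\big(\mathbf 1_{\{|k|=2\}}+q_k\big)$ with $$q_k=\frac{z^2}{2+2z^2}(-1)^{k+1}\big(2\alpha_k-\alpha_{k+1}-\alpha_{k-1}\big),\qquad \alpha_k=\sum_{n\ge0}\big(p_n(0)-p_n(k)\big),$$ where $p_n(k)$ is the probability that the walk on $\mathbb Z$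 started at $0$, with jumps $\pm1$ of probability $\frac{z^2}{2+2z^2}$ each and $\pm2$ of probability $\frac1{2+2z^2}$ each, is at $k$ after $n$ steps. Let $\tilde P=(I+P)/2$ be the lazy walk, $\tilde p_t(x,y)$ its $t$-step transition probabilities, and $$\tilde a(x,o)=\sum_{t\ge 0}\big(\tilde p_t(o,o)-\tilde p_t(x,o)\big),\qquad a=\tfrac12\tilde a,$$ the potential kernels of the lazy and of the nonlazy walk. **Domains.** Let $\alpha>0$. For all large $R$ let $\Lambda_R$ be a set of vertices of $\Gamma$ that contains all vertices of $\ell^1$-norm less than $R$; let $\partial\Lambda_R$ be the set of $x\in\Lambda_R$ such that one of $x\pm2e_1,x\pm2e_2$ is not in $\Lambda_R$, and let $\partial_D\Lambda_R\subset\partial\Lambda_R$. Suppose that for every $x\in\Lambda_R$ the set $\partial_D\Lambda_R$ contains a horizontal or vertical segment $S$ of consecutive vertices of the class of $x$, of length at least $\alpha R$ and at $\ell^1$-distance at most $\alpha^{-1}R$ from $x$, which is not screened by the rest of the boundary: all vertices of that class in the convex hull of $S$ and of the vertices of $\ell^1$-norm less than $\alpha R$ belong to $\Lambda_R$. (The last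 condition is automatic when $\alpha\le1$ and $\Lambda_R$ is a box, or consists, for each class, of all the vertices of that class in a convex set.) Let $\tilde X^{\Lambda_R}$ be a walk in $\Lambda_R$, killed on $\partial_D\Lambda_R$, with transition probabilities $\tilde p(x,y)$ for $x\in\Lambda_R\setminus\partial\Lambda_R$ and $y\in\Lambda_R$ (it is killed if it jumps out of $\Lambda_R$), and with arbitrary transition probabilities within $\Lambda_R$ (possibly with killing) at the vertices of $\partial\Lambda_R\setminus\partial_D\Lambda_R$. Let $\tilde G^{\Lambda_R}(x,o)=\mathbb E_x\big(\sum_{n\ge0}\mathbf 1_{\{\tilde X^{\Lambda_R}_n=o\}}\big)$. **Proposition 3.7.** The series defining $\tilde a(x,o)$ converges absolutely for all vertices $x,o$. For any fixed $x,x'$ of the same class and any fixed $o$, $\tilde G^{\Lambda_R}(x,o)$ and $\tilde G^{\Lambda_R}(x',o)$ are finite for all large $R$, and as $R\to\infty$ $$\tilde G^{\Lambda_R}(x,o)-\tilde G^{\Lambda_R}(x',o)\longrightarrow-\big(\tilde a(x,o)-\tilde a(x',o)\big).$$ The same is true for the nonlazy walk, that is, with $P$ in place of $\tilde P$ in the definition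 of the walk in $\Lambda_R$ and with $a$ in place of $\tilde a$. -/

import Mathlib

open Filter Topology

noncomputable section

/-! ### The auxiliary walk on the integers and the step law along the real line -/

/-- The `n`-step transition probability from `0` to `k` of the walk on `ℤ` with jumps `± 1`, each of
probability `z ^ 2 / (2 + 2 * z ^ 2)`, and `± 2`, each of probability `1 / (2 + 2 * z ^ 2)`. -/
def auxProb (z : ℝ) : ℕ → ℤ → ℝ
  | 0, k => if k = 0 then 1 else 0
  | n + 1, k =>
      z ^ 2 / (2 + 2 * z ^ 2) * (auxProb z n (k - 1) + auxProb z n (k + 1))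
        + 1 / (2 + 2 * z ^ 2) * (auxProb z n (k - 2) + auxProb z n (k + 2))

/-- The potential kernel `α_k` of the auxiliary walk. -/
def auxPotential (z : ℝ) (k : ℤ) : ℝ :=
  ∑' n : ℕ, (auxProb z n 0 - auxProb z n k)

/-- The effective weights `q^∞_{u,v}`, as a function of `k = v - u`. -/
def effWeight (z : ℝ) (k : ℤ) : ℝ :=
  z ^ 2 / (2 + 2 * z ^ 2) * (-1 : ℝ) ^ (k + 1) *
    (2 * auxPotential z k - auxPotential z (k + 1) - auxPotential z (k - 1))

/-- The law of a horizontal step along the real line for the odd effective walk: on the real line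
this walk has weight `1 / 4` for each of the displacements `± 2`, and `effWeight z k / 4` for the
displacement `k`; these weights are normalised here to total mass one. -/
def oddLaw (z : ℝ) (k : ℤ) : ℝ :=
  ((if k = 2 ∨ k = -2 then 1 else 0) + effWeight z k) / 3

/-- The law of a horizontal step along the real line for the even effective walk: the displacements
`± 1` have weight `z ^ 2` each and `± 2` have weight `1` each, normalised to total mass one. -/
def evenLaw (z : ℝ) (k : ℤ) : ℝ :=
  if k = 1 ∨ k = -1 then z ^ 2 / (2 + 2 * z ^ 2)
  else if k = 2 ∨ k = -2 then 1 / (2 + 2 * z ^ 2)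
  else 0

/-! ### The symmetrised graph and the effective walk on it -/

/-- The vertices of the symmetrised graph: the pair `(u, j)` stands for the point `(u, 2 * j)` of
`ℤ × 2ℤ`, see `pos`. The real line is `j = 0`. -/
abbrev Vertex : Type := ℤ × ℤ

/-- The point of the plane that a vertex stands for. -/
def pos (x : Vertex) : ℝ × ℝ := ((x.1 : ℝ), 2 * (x.2 : ℝ))

/-- The `ℓ¹` distance in the plane between two vertices. -/
def l1dist (x y : Vertex) : ℝ :=
  |(pos x).1 - (pos y).1| + |(pos x).2 - (pos y).2|

/-- Two vertices have the same class (colour) if both lie in `(2ℤ) × (2ℤ)`, or both in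
`(2ℤ + 1) × (2ℤ)`. -/
def SameClass (x y : Vertex) : Prop := Even (x.1 - y.1)

/-- Neighbours in the lattice with mesh size two: `y = x ± 2 e₁` or `y = x ± 2 e₂`. -/
def LatticeNbr (x y : Vertex) : Prop :=
  (y.2 = x.2 ∧ (y.1 = x.1 + 2 ∨ y.1 = x.1 - 2)) ∨
    (y.1 = x.1 ∧ (y.2 = x.2 + 1 ∨ y.2 = x.2 - 1))

open Classical in
/-- The (nonlazy) transition matrix `P` of the effective walk on the symmetrised graph. Away from the
real line the walk jumps by `± 2 e₁`, `± 2 e₂` with probability `1 / 4` each. On the real line it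
moves vertically by `± 2 e₂`, with probability `s / 2` each, and otherwise horizontally along the
real line, with displacement distributed according to `ν`. -/
def stepKernel (s : ℝ) (ν : ℤ → ℝ) (x y : Vertex) : ℝ :=
  if x.2 = 0 then
    if y.2 = 0 then (1 - s) * ν (y.1 - x.1)
    else if LatticeNbr x y then s / 2 else 0
  else if LatticeNbr x y then 1 / 4 else 0

/-- The transition matrix `(I + P) / 2` of the lazy walk. -/
def lazyKernel (P : Vertex → Vertex → ℝ) (x y : Vertex) : ℝ :=
  ((if x = y then 1 else 0) + P x y) / 2

/-- The `n`-step transition probabilities of a (sub)stochastic matrix. -/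
def nStep (K : Vertex → Vertex → ℝ) : ℕ → Vertex → Vertex → ℝ
  | 0, x, y => if x = y then 1 else 0
  | n + 1, x, y => ∑' w : Vertex, K x w * nStep K n w y

/-- The unnormalised Green's function: the expected number of visits to `o` starting from `x`. -/
def green (K : Vertex → Vertex → ℝ) (x o : Vertex) : ℝ :=
  ∑' n : ℕ, nStep K n x o

/-- The potential kernel of the lazy walk, normalised to vanish at `x = o`. -/
def lazyPotential (P : Vertex → Vertex → ℝ) (x o : Vertex) : ℝ :=
  ∑' t : ℕ, (nStep (lazyKernel P) t o o - nStep (lazyKernel P) t x o)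

/-- The potential kernel of the nonlazy walk: half of that of the lazy walk, since the latter
makes on average twice as many visits to each vertex. -/
def potential (P : Vertex → Vertex → ℝ) (x o : Vertex) : ℝ :=
  lazyPotential P x o / 2

/-! ### Domains with a macroscopic Dirichlet boundary, and walks in them -/

/-- The inner vertex boundary of a set of vertices. -/
def innerBoundary (Λ : Set Vertex) : Set Vertex :=
  {x | x ∈ Λ ∧ ∃ y, LatticeNbr x y ∧ y ∉ Λ}

/-- The straight lattice segment of `n + 1` consecutive vertices of one class that starts at `y`, in
the horizontal direction if `b` holds and in the vertical direction otherwise. Its length is `2 * n`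
in either case. -/
def latticeSegment (b : Bool) (y : Vertex) (n : ℕ) : Set Vertex :=
  {w | ∃ i : ℕ, i ≤ n ∧
    w = if b then (y.1 + 2 * (i : ℤ), y.2) else (y.1, y.2 + (i : ℤ))}

/-- The assumptions on the domain `Λ` at scale `R` and on its Dirichlet boundary `D`: the domain
contains the ball of radius `R`, and for every vertex `x` of `Λ` the Dirichlet boundary contains a
straight segment of vertices of the class of `x`, of length at least `α R`, at distance at most
`R / α` from `x`, and not screened by the rest of the boundary: the vertices of its class in the
convex hull of the segment and the ball of radius `α R` belong to `Λ`. -/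
structure IsDirichletDomain (α R : ℝ) (Λ D : Set Vertex) : Prop where
  ball_subset : {x | l1dist x 0 < R} ⊆ Λ
  dirichlet_subset : D ⊆ innerBoundary Λ
  macroscopic : ∀ x ∈ Λ, ∃ (b : Bool) (y : Vertex) (n : ℕ),
    SameClass y x ∧
    latticeSegment b y n ⊆ D ∧
    α * R ≤ 2 * (n : ℝ) ∧
    (∃ w ∈ latticeSegment b y n, l1dist x w ≤ R / α) ∧
    ∀ w : Vertex, SameClass w y →
      pos w ∈ convexHull ℝ (pos '' (latticeSegment b y n ∪ {v | l1dist v 0 < α * R})) → w ∈ Λ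

/-- `K` is the matrix of transition probabilities of a walk in `Λ` that is killed on `D`, and which has
the transition probabilities `P x y`, for `y` in `Λ`, at each `x` of `Λ` which is not on the
inner boundary (it is killed if it jumps out of `Λ`). At the vertices of the inner boundary outside
`D` its transition probabilities are arbitrary. -/
structure IsWalkIn (P : Vertex → Vertex → ℝ) (Λ D : Set Vertex) (K : Vertex → Vertex → ℝ) :
    Prop where
  nonneg : ∀ x y, 0 ≤ K x y
  summable : ∀ x, Summable (K x)
  sum_le_one : ∀ x, ∑' y, K x y ≤ 1
  eq_zero_of_notMem : ∀ x y, y ∉ Λ → K x y = 0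
  killed : ∀ x ∈ D, ∀ y, K x y = 0
  interior : ∀ x ∈ Λ, x ∉ innerBoundary Λ → ∀ y ∈ Λ, K x y = P x y

end

/-! Let the walk in the domain run for a time `T` and use the Markov property: the expected number
of visits to `o` before time `T + N` is the number before time `T` plus the mean, over the position
at time `T`, of the number before time `N`. If `T` is well below `R ^ 2`, the walk is unlikely to
have left a box of radius of order `R`. Up to the escape probability times a bound `M` for the
Green's functions, both terms can therefore be computed with the free walk. The difference of the
first terms at `x` and `x'` tends to minus the difference of the potential kernels. The second term
is a power of the free transition operator applied to a function bounded by `M` and supported in the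
box, and a gradient estimate shows that its values at `x` and `x'` are close. With `T` about `R ^ (7
/ 4)` all errors are at most of order `M * R ^ (-1 / 4)` (`abs_truncGreen_sub_le`,
`exists_green_sub_le`). Two inputs remain: heat kernel estimates for the free walk, and a bound `M`
of order `log R`.

Heat kernel. The free walk is reversible and invariant under the horizontal translation by two, but
the real line destroys vertical translation invariance. The lazy operator `S` satisfies `0 ≤ S ≤ 1`
and commutes with the translation `τ`, and its Dirichlet form dominates that of the walk generated
by `τ`. Hence `S` contracts at least as well as a mixture of `1` and `(1 + τ) / 2`, and powers of
the latter spread a vector over its translates with binomial weights, which gains one dimension of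
decay. The other dimension comes from bounding the sum of `g ^ 2` over a horizontal row by energy
and norm (`norm_pow_two_mul_le`, `sum_form_point_le`). This gives the on-diagonal bound `C / n`. For
a difference of two point masses the squared norm decays like `n ^ (-3 / 2)`, which with the
on-diagonal bound makes the series of the potential kernel converge absolutely.

Logarithmic bound. Let `a` be the truncated Green's function of the domain at a pole on the real
line. The escape function `1 - g / a` vanishes at the pole, is at least `1` on the Dirichlet
boundary, and is superharmonic away from the pole. An exponential barrier in a tube leading to an
unscreened Dirichlet segment bounds it below far from the line (`tube_lower_bound`,
`frame_lower_bound`). The tube must avoid the real line, where the jumps are different, so it only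
starts from points in the half-plane where the segment is. The law of the walk started on the line
is symmetric, so a bound for the sum of the values at a point and at its reflection suffices. After
a time of order `R ^ 2` the mean of the escape function is thus bounded below, while
superharmonicity bounds it above by `1 / a` times the free Green's function up to that time, which
is `O(log R)`. Hence `a = O(log R)` (`exists_truncGreen_line_le`), and poles off the line follow by
moving vertically.

Of the horizontal step law only symmetry, total mass one, a finite second moment and positivity at
`1` and `2` matter. In the odd case they follow from an explicit formula, `effWeight` being a
two-sided geometric law (`effWeight_eq`). The nonlazy walk has half the Green's function of its lazy
version. -/

/-! ### The step law along the real line -/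

/-- The characteristic function of one step of the auxiliary walk. -/
noncomputable def auxChar (z θ : ℝ) : ℝ := (z ^ 2 * Real.cos θ + Real.cos (2 * θ)) / (1 + z ^ 2)

lemma continuous_auxChar (z : ℝ) : Continuous (auxChar z) := by
  unfold auxChar
  fun_prop

lemma one_sub_auxChar (z θ : ℝ) :
    1 - auxChar z θ = (1 - Real.cos θ) * (z ^ 2 + 2 + 2 * Real.cos θ) / (1 + z ^ 2) := by
  have : (1 : ℝ) + z ^ 2 ≠ 0 := by positivity
  rw [auxChar, Real.cos_two_mul, eq_div_iff this, sub_mul, div_mul_cancel₀ _ this]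
  ring

lemma one_add_auxChar (z θ : ℝ) :
    1 + auxChar z θ = (z ^ 2 * (1 + Real.cos θ) + 2 * Real.cos θ ^ 2) / (1 + z ^ 2) := by
  have : (1 : ℝ) + z ^ 2 ≠ 0 := by positivity
  rw [auxChar, Real.cos_two_mul, eq_div_iff this, add_mul, div_mul_cancel₀ _ this]
  ring

/-- By the two factorisations above, `1 - auxChar` vanishes to first order in `1 - cos θ`, and `1 +
auxChar` has no zero because `1 + cos θ` and `cos θ` do not vanish together. -/
lemma exists_abs_auxChar_le {z : ℝ} (hz : 0 < z) :
    ∃ c : ℝ, 0 < c ∧ ∀ θ, c * (1 - Real.cos θ) ≤ 1 - |auxChar z θ| := by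
  set m := min (z ^ 2) 1 with hm
  have hm0 : 0 < m := by positivity
  have hm1 : m ≤ z ^ 2 := min_le_left _ _
  have hm2 : m ≤ 1 := min_le_right _ _
  refine ⟨m / 4 / (1 + z ^ 2), by positivity, fun θ => ?_⟩
  have hc1 := Real.cos_le_one θ
  have hc2 := Real.neg_one_le_cos θ
  have h1 : m / 4 / (1 + z ^ 2) * (1 - Real.cos θ) ≤ 1 - auxChar z θ := by
    rw [one_sub_auxChar, div_mul_eq_mul_div]
    gcongr ?_ / _
    nlinarith
  have h2 : m / 4 / (1 + z ^ 2) * (1 - Real.cos θ) ≤ 1 + auxChar z θ := by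
    rw [one_add_auxChar, div_mul_eq_mul_div]
    gcongr ?_ / _
    have h3 : m * (1 + Real.cos θ) ≤ z ^ 2 * (1 + Real.cos θ) := by gcongr; linarith
    have h4 : m * (2 * Real.cos θ ^ 2) ≤ 1 * (2 * Real.cos θ ^ 2) := by gcongr
    have h5 : 0 ≤ 1 + Real.cos θ + 2 * Real.cos θ ^ 2 - (1 - Real.cos θ) / 4 := by
      nlinarith [sq_nonneg (Real.cos θ + 5 / 16)]
    nlinarith [mul_nonneg hm0.le h5]
  rcases abs_cases (auxChar z θ) with ⟨h, _⟩ | ⟨h, _⟩ <;> rw [h] <;> linarith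

lemma integral_cos_int_mul (k : ℤ) :
    ∫ θ in (-Real.pi)..Real.pi, Real.cos (k * θ) = if k = 0 then 2 * Real.pi else 0 := by
  split_ifs with h
  · subst h
    simp
    ring
  · have hk : (k : ℝ) ≠ 0 := by exact_mod_cast h
    rw [intervalIntegral.integral_comp_mul_left (fun x => Real.cos x) hk, integral_cos]
    simp [Real.sin_int_mul_pi]

lemma auxProb_eq_integral (z : ℝ) (n : ℕ) (k : ℤ) :
    auxProb z n k =
      (2 * Real.pi)⁻¹ * ∫ θ in (-Real.pi)..Real.pi, auxChar z θ ^ n * Real.cos (k * θ) := by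
  induction n generalizing k with
  | zero =>
    simp only [pow_zero, one_mul, integral_cos_int_mul, auxProb]
    split_ifs
    · field_simp
    · simp
  | succ n ih =>
    have hint : ∀ l : ℤ, IntervalIntegrable (fun θ => auxChar z θ ^ n * Real.cos (l * θ))
        MeasureTheory.volume (-Real.pi) Real.pi := fun l =>
      (((continuous_auxChar z).pow n).mul (by fun_prop)).intervalIntegrable _ _
    rw [auxProb, ih, ih, ih, ih, ← mul_add, ← mul_add,
      ← intervalIntegral.integral_add (hint _) (hint _),
      ← intervalIntegral.integral_add (hint _) (hint _), mul_left_comm,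
      mul_left_comm _ (2 * Real.pi)⁻¹, ← mul_add,
      ← intervalIntegral.integral_const_mul, ← intervalIntegral.integral_const_mul,
      ← intervalIntegral.integral_add (((hint _).add (hint _)).const_mul _)
        (((hint _).add (hint _)).const_mul _)]
    congr 1
    refine intervalIntegral.integral_congr fun θ _ => ?_
    have e1 : Real.cos (((k - 1 : ℤ) : ℝ) * θ) + Real.cos (((k + 1 : ℤ) : ℝ) * θ) =
        2 * Real.cos θ * Real.cos (k * θ) := by
      push_cast
      rw [sub_mul, add_mul, one_mul, Real.cos_sub, Real.cos_add]
      ring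
    have e2 : Real.cos (((k - 2 : ℤ) : ℝ) * θ) + Real.cos (((k + 2 : ℤ) : ℝ) * θ) =
        2 * Real.cos (2 * θ) * Real.cos (k * θ) := by
      push_cast
      rw [sub_mul, add_mul, Real.cos_sub, Real.cos_add]
      ring
    simp only [← mul_add, e1, e2]
    have : (1 : ℝ) + z ^ 2 ≠ 0 := by positivity
    rw [pow_succ (auxChar z θ), auxChar, show (2 : ℝ) + 2 * z ^ 2 = 2 * (1 + z ^ 2) by ring]
    field_simp

/-- The weight `w` vanishes where `|auxChar| = 1`, and to the same order as `1 - |auxChar|`, so the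
geometric series is dominated by a bounded function. -/
lemma hasSum_integral_auxChar {z : ℝ} (hz : 0 < z) {w : ℝ → ℝ} (hw : Continuous w) {C : ℝ}
    (hC : ∀ θ, |w θ| ≤ C * (1 - Real.cos θ)) :
    HasSum (fun n : ℕ => ∫ θ in (-Real.pi)..Real.pi, auxChar z θ ^ n * w θ)
      (∫ θ in (-Real.pi)..Real.pi, w θ / (1 - auxChar z θ)) := by
  obtain ⟨c, hc, hcφ⟩ := exists_abs_auxChar_le hz
  have hφ := continuous_auxChar z
  have hw0 : ∀ θ, Real.cos θ = 1 → w θ = 0 := fun θ h => by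
    have := hC θ
    rw [h, sub_self, mul_zero] at this
    exact abs_nonpos_iff.1 this
  have hlt : ∀ θ, Real.cos θ ≠ 1 → |auxChar z θ| < 1 := fun θ h => by
    have h1 : 0 < c * (1 - Real.cos θ) :=
      mul_pos hc (sub_pos.2 (lt_of_le_of_ne (Real.cos_le_one θ) h))
    linarith [hcφ θ]
  have hsum : ∀ θ, HasSum (fun n : ℕ => |auxChar z θ| ^ n * |w θ|)
      (|w θ| / (1 - |auxChar z θ|)) := fun θ => by
    by_cases h : Real.cos θ = 1
    · simp [hw0 θ h]
    · rw [div_eq_inv_mul]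
      exact (hasSum_geometric_of_lt_one (abs_nonneg _) (hlt θ h)).mul_right _
  have hC0 : 0 ≤ C := by
    have := (abs_nonneg _).trans (hC Real.pi)
    rw [Real.cos_pi] at this
    linarith
  refine intervalIntegral.hasSum_integral_of_dominated_convergence
    (fun n θ => |auxChar z θ| ^ n * |w θ|) (fun n => ?_) (fun n => ?_) ?_ ?_ ?_
  · exact ((hφ.pow n).mul hw).aestronglyMeasurable
  · exact Eventually.of_forall fun θ _ => by simp
  · exact Eventually.of_forall fun θ _ => (hsum θ).summable
  · simp only [(hsum _).tsum_eq]
    have hmeas : Measurable fun θ => |w θ| / (1 - |auxChar z θ|) :=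
      hw.abs.measurable.div (continuous_const.sub hφ.abs).measurable
    refine (intervalIntegrable_const (c := C / c)).mono_fun hmeas.aestronglyMeasurable
      (Eventually.of_forall fun θ => ?_)
    have hpos : 0 ≤ 1 - |auxChar z θ| :=
      (mul_nonneg hc.le (sub_nonneg.2 (Real.cos_le_one θ))).trans (hcφ θ)
    change ‖|w θ| / (1 - |auxChar z θ|)‖ ≤ ‖C / c‖
    rw [Real.norm_of_nonneg (by positivity), Real.norm_of_nonneg (by positivity)]
    by_cases h : Real.cos θ = 1
    · rw [hw0 θ h]; simp; positivity
    · rw [div_le_div_iff₀ (by linarith [hlt θ h]) hc]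
      calc |w θ| * c ≤ C * (1 - Real.cos θ) * c := by gcongr; exact hC θ
        _ = C * (c * (1 - Real.cos θ)) := by ring
        _ ≤ C * (1 - |auxChar z θ|) := by gcongr; exact hcφ θ
  · refine Eventually.of_forall fun θ _ => ?_
    by_cases h : Real.cos θ = 1
    · simp [hw0 θ h]
    · rw [div_eq_inv_mul]
      exact (hasSum_geometric_of_abs_lt_one (hlt θ h)).mul_right _

/-- `2 * (1 - cos θ)` is the squared chord from `1` to `exp (iθ)`; this is `|u + v|² ≤ 2 |u|² + 2
|v|²` for chords. -/
lemma one_sub_cos_add_le (a b : ℝ) :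
    1 - Real.cos (a + b) ≤ 2 * (1 - Real.cos a) + 2 * (1 - Real.cos b) := by
  rw [Real.cos_add]
  nlinarith [Real.sin_sq_add_cos_sq a, Real.sin_sq_add_cos_sq b,
    sq_nonneg (Real.sin a - Real.sin b), Real.cos_le_one a, Real.cos_le_one b,
    Real.neg_one_le_cos a, Real.neg_one_le_cos b,
    mul_nonneg (sub_nonneg.2 (Real.cos_le_one a)) (sub_nonneg.2 (Real.cos_le_one b))]

lemma exists_one_sub_cos_mul_le (k : ℤ) :
    ∃ C : ℝ, ∀ θ, |1 - Real.cos (k * θ)| ≤ C * (1 - Real.cos θ) := by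
  have hnat : ∀ n : ℕ, ∃ C : ℝ, ∀ θ, 1 - Real.cos (n * θ) ≤ C * (1 - Real.cos θ) := by
    intro n
    induction n with
    | zero => exact ⟨0, fun θ => by simp⟩
    | succ n ih =>
      obtain ⟨C, hC⟩ := ih
      refine ⟨2 * C + 2, fun θ => ?_⟩
      have := one_sub_cos_add_le (n * θ) θ
      push_cast
      rw [add_mul, one_mul]
      linarith [hC θ]
  obtain ⟨C, hC⟩ := hnat k.natAbs
  refine ⟨C, fun θ => ?_⟩
  rw [abs_of_nonneg (sub_nonneg.2 (Real.cos_le_one _))]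
  have e : Real.cos (k * θ) = Real.cos ((k.natAbs : ℝ) * θ) := by
    rcases Int.natAbs_eq k with h | h
    · nth_rewrite 1 [h]; simp
    · nth_rewrite 1 [h]; rw [Int.cast_neg, neg_mul, Real.cos_neg, Int.cast_natCast]
  rw [e]
  exact hC θ

lemma hasSum_auxPotential {z : ℝ} (hz : 0 < z) (k : ℤ) :
    HasSum (fun n : ℕ => auxProb z n 0 - auxProb z n k) (auxPotential z k) := by
  obtain ⟨C, hC⟩ := exists_one_sub_cos_mul_le k
  have h := (hasSum_integral_auxChar hz (w := fun θ => 1 - Real.cos (k * θ))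
    (by fun_prop) hC).mul_left (2 * Real.pi)⁻¹
  refine Summable.hasSum (h.summable.congr fun n => ?_)
  have hint : ∀ l : ℤ, IntervalIntegrable (fun θ => auxChar z θ ^ n * Real.cos (l * θ))
      MeasureTheory.volume (-Real.pi) Real.pi := fun l =>
    (((continuous_auxChar z).pow n).mul (by fun_prop)).intervalIntegrable _ _
  rw [auxProb_eq_integral, auxProb_eq_integral, ← mul_sub,
    ← intervalIntegral.integral_sub (hint 0) (hint k)]
  congr 1
  exact intervalIntegral.integral_congr fun θ _ => by simp [mul_sub]

/-! ### Explicit form of the effective weights. -/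

/-- The Fourier coefficients of `θ ↦ 1 / (z ^ 2 + 2 + 2 cos θ)`. -/
noncomputable def poissonCoeff (z : ℝ) (k : ℤ) : ℝ :=
  ∫ θ in (-Real.pi)..Real.pi, Real.cos (k * θ) / (z ^ 2 + 2 + 2 * Real.cos θ)

lemma sq_le_poisson_denom (z θ : ℝ) : z ^ 2 ≤ z ^ 2 + 2 + 2 * Real.cos θ := by
  linarith [Real.neg_one_le_cos θ]

/-- Taking second differences in `k` puts a factor `1 - cos θ` into the Fourier integrand, which
cancels the zero of `1 - auxChar` and leaves the smooth denominator `z ^ 2 + 2 + 2 cos θ`. -/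
lemma auxPotential_second_diff {z : ℝ} (hz : 0 < z) (k : ℤ) :
    2 * auxPotential z k - auxPotential z (k + 1) - auxPotential z (k - 1) =
      -((1 + z ^ 2) / Real.pi * poissonCoeff z k) := by
  have h1 := (((hasSum_auxPotential hz k).mul_left 2).sub (hasSum_auxPotential hz (k + 1))).sub
    (hasSum_auxPotential hz (k - 1))
  have h2 := (hasSum_integral_auxChar hz
    (w := fun θ => -(2 * Real.cos (k * θ) * (1 - Real.cos θ))) (by fun_prop) (C := 2)
    (fun θ => by
      rw [abs_neg, abs_mul, abs_mul, abs_of_nonneg (sub_nonneg.2 (Real.cos_le_one θ)), abs_two]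
      have := Real.abs_cos_le_one (k * θ)
      gcongr
      · exact sub_nonneg.2 (Real.cos_le_one θ)
      · linarith)).mul_left (2 * Real.pi)⁻¹
  have h3 : ∀ n : ℕ, 2 * (auxProb z n 0 - auxProb z n k) - (auxProb z n 0 - auxProb z n (k + 1))
      - (auxProb z n 0 - auxProb z n (k - 1)) = (2 * Real.pi)⁻¹ *
        ∫ θ in (-Real.pi)..Real.pi,
          auxChar z θ ^ n * -(2 * Real.cos (k * θ) * (1 - Real.cos θ)) := by
    intro n
    have hint : ∀ l : ℤ, IntervalIntegrable (fun θ => auxChar z θ ^ n * Real.cos (l * θ))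
        MeasureTheory.volume (-Real.pi) Real.pi := fun l =>
      (((continuous_auxChar z).pow n).mul (by fun_prop)).intervalIntegrable _ _
    have e : ∀ a b c d : ℝ, 2 * (a - b) - (a - c) - (a - d) = c + d - 2 * b :=
      fun a b c d => by ring
    rw [e, auxProb_eq_integral, auxProb_eq_integral, auxProb_eq_integral, ← mul_add,
      mul_left_comm 2, ← mul_sub, ← intervalIntegral.integral_const_mul,
      ← intervalIntegral.integral_add (hint _) (hint _),
      ← intervalIntegral.integral_sub ((hint _).add (hint _)) ((hint _).const_mul _)]
    congr 1
    refine intervalIntegral.integral_congr fun θ _ => ?_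
    push_cast
    simp only [sub_mul, add_mul, one_mul, Real.cos_sub, Real.cos_add]
    ring
  rw [(h1.congr_fun fun n => (h3 n).symm).unique h2, poissonCoeff]
  have h4 : ∫ θ in (-Real.pi)..Real.pi,
      -(2 * Real.cos (k * θ) * (1 - Real.cos θ)) / (1 - auxChar z θ) =
      ∫ θ in (-Real.pi)..Real.pi,
        (-(2 * (1 + z ^ 2))) * (Real.cos (k * θ) / (z ^ 2 + 2 + 2 * Real.cos θ)) := by
    refine intervalIntegral.integral_congr_ae ?_
    filter_upwards [MeasureTheory.Measure.ae_ne MeasureTheory.volume (0 : ℝ)] with θ h0 hθ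
    rw [Set.uIoc_of_le (by linarith [Real.pi_pos])] at hθ
    have h5 : 1 - Real.cos θ ≠ 0 := fun h => h0 <|
      (Real.cos_eq_one_iff_of_lt_of_lt (by linarith [hθ.1, Real.pi_pos])
        (by linarith [hθ.2, Real.pi_pos])).1 (by linarith)
    have h6 : z ^ 2 + 2 + 2 * Real.cos θ ≠ 0 :=
      ((by positivity : 0 < z ^ 2).trans_le (sq_le_poisson_denom z θ)).ne'
    have h7 : (1 : ℝ) + z ^ 2 ≠ 0 := by positivity
    rw [one_sub_auxChar]
    field_simp
  rw [h4, intervalIntegral.integral_const_mul]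
  have := Real.pi_pos.ne'
  field_simp

lemma poissonCoeff_neg (z : ℝ) (k : ℤ) : poissonCoeff z (-k) = poissonCoeff z k := by
  simp [poissonCoeff]

lemma abs_poissonCoeff_le {z : ℝ} (hz : 0 < z) (k : ℤ) :
    |poissonCoeff z k| ≤ 1 / z ^ 2 * |Real.pi - -Real.pi| := by
  rw [poissonCoeff, ← Real.norm_eq_abs]
  refine intervalIntegral.norm_integral_le_of_norm_le_const fun θ _ => ?_
  have h1 : 0 < z ^ 2 := by positivity
  have h2 := sq_le_poisson_denom z θ
  rw [norm_div, Real.norm_of_nonneg (h1.le.trans h2)]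
  exact div_le_div₀ zero_le_one (Real.abs_cos_le_one _) h1 h2

lemma poissonCoeff_recurrence {z : ℝ} (hz : 0 < z) (k : ℤ) :
    poissonCoeff z (k + 1) + poissonCoeff z (k - 1) + (z ^ 2 + 2) * poissonCoeff z k =
      if k = 0 then 2 * Real.pi else 0 := by
  have h0 : ∀ θ, z ^ 2 + 2 + 2 * Real.cos θ ≠ 0 := fun θ =>
    ((by positivity : 0 < z ^ 2).trans_le (sq_le_poisson_denom z θ)).ne'
  have hint : ∀ l : ℤ, IntervalIntegrable
      (fun θ => Real.cos (l * θ) / (z ^ 2 + 2 + 2 * Real.cos θ))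
      MeasureTheory.volume (-Real.pi) Real.pi := fun l =>
    ((by fun_prop : Continuous fun θ : ℝ => Real.cos (l * θ)).div
      (by fun_prop) h0).intervalIntegrable _ _
  rw [← integral_cos_int_mul, poissonCoeff, poissonCoeff, poissonCoeff,
    ← intervalIntegral.integral_const_mul, ← intervalIntegral.integral_add (hint _) (hint _),
    ← intervalIntegral.integral_add ((hint _).add (hint _)) ((hint _).const_mul _)]
  refine intervalIntegral.integral_congr fun θ _ => ?_
  have := h0 θ
  push_cast
  simp only [sub_mul _ _ θ, add_mul _ _ θ, one_mul, Real.cos_sub, Real.cos_add]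
  rw [← add_div, ← mul_div_assoc, ← add_div, div_eq_iff this]
  ring

/-- The decay rate of `effWeight`: the root in `(0, 1)` of `x + 1 / x = z ^ 2 + 2`. -/
lemma exists_decay_rate {z : ℝ} (hz : 0 < z) :
    ∃ r : ℝ, 0 < r ∧ r < 1 ∧ r ^ 2 + 1 = (z ^ 2 + 2) * r := by
  have hz2 : 0 < z ^ 2 := by positivity
  set q := √((z ^ 2 + 2) ^ 2 - 4) with hq
  have h1 : q ^ 2 = (z ^ 2 + 2) ^ 2 - 4 := Real.sq_sqrt (by nlinarith)
  have h2 : q < z ^ 2 + 2 := Real.sqrt_lt' (by positivity) |>.2 (by linarith)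
  have h3 : z ^ 2 < q := Real.lt_sqrt (by positivity) |>.2 (by nlinarith)
  exact ⟨(z ^ 2 + 2 - q) / 2, by linarith, by linarith, by nlinarith⟩

/-- The recurrence has the two modes `(-r) ^ n` and `(-1 / r) ^ n`. The combination `e` removes the
first; what is left grows like `r ^ (-n)` unless it is zero, and the coefficients are bounded. -/
lemma poissonCoeff_nat {z r : ℝ} (hz : 0 < z) (hr0 : 0 < r) (hr1 : r < 1)
    (hr : r ^ 2 + 1 = (z ^ 2 + 2) * r) (n : ℕ) :
    poissonCoeff z n = (-r) ^ n * poissonCoeff z 0 := by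
  set e : ℕ → ℝ := fun n => poissonCoeff z (n + 1 : ℕ) + r * poissonCoeff z n with he
  have hrec : ∀ n, e n = -r * e (n + 1) := by
    intro n
    have h := poissonCoeff_recurrence hz ((n + 1 : ℕ) : ℤ)
    rw [if_neg (by positivity)] at h
    have e1 : ((n + 1 : ℕ) : ℤ) + 1 = ((n + 1 + 1 : ℕ) : ℤ) := by push_cast; ring
    have e2 : ((n + 1 : ℕ) : ℤ) - 1 = (n : ℤ) := by push_cast; ring
    rw [e1, e2] at h
    simp only [he]
    linear_combination r * h + hr * poissonCoeff z (n + 1 : ℕ)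
  have hpow : ∀ n m, e n = (-r) ^ m * e (n + m) := by
    intro n m
    induction m with
    | zero => simp
    | succ m ih => rw [ih, hrec (n + m), pow_succ, mul_assoc, add_assoc]
  have hzero : ∀ n, e n = 0 := by
    intro n
    set A := 1 / z ^ 2 * |Real.pi - -Real.pi| with hA
    have hb : ∀ m, |e m| ≤ 2 * A := fun m => by
      have h1 := abs_poissonCoeff_le hz ((m + 1 : ℕ) : ℤ)
      have h2 := abs_poissonCoeff_le hz (m : ℤ)
      calc |e m| ≤ |poissonCoeff z (m + 1 : ℕ)| + |r * poissonCoeff z m| := abs_add_le _ _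
        _ ≤ A + 1 * A := by
          rw [abs_mul, abs_of_pos hr0]
          gcongr
        _ = 2 * A := by ring
    have h3 : ∀ m : ℕ, |e n| ≤ r ^ m * (2 * A) := fun m => by
      rw [hpow n m, abs_mul, abs_pow, abs_neg, abs_of_pos hr0]
      gcongr
      exact hb _
    have h4 : Tendsto (fun m : ℕ => r ^ m * (2 * A)) atTop (𝓝 (0 * (2 * A))) :=
      (tendsto_pow_atTop_nhds_zero_of_lt_one hr0.le hr1).mul_const _
    rw [zero_mul] at h4
    exact abs_nonpos_iff.1 (ge_of_tendsto' h4 h3)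
  induction n with
  | zero => simp
  | succ n ih =>
    have := hzero n
    simp only [he] at this
    rw [pow_succ]
    linear_combination this - r * ih

/-- The sign `(-1) ^ (k + 1)` in the weights cancels the alternation of `(-r) ^ |k|` together with
the minus sign of the second difference. The recurrence at `k = 0` fixes the constant. Positivity,
unit mass and finite moments can be read off. -/
lemma effWeight_eq {z r : ℝ} (hz : 0 < z) (hr0 : 0 < r) (hr1 : r < 1)
    (hr : r ^ 2 + 1 = (z ^ 2 + 2) * r) (k : ℤ) :
    effWeight z k = (1 - r) / (1 + r) * r ^ k.natAbs := by
  have h0 : poissonCoeff z 0 * (1 - r ^ 2) = 2 * Real.pi * r := by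
    have h := poissonCoeff_recurrence hz 0
    have h1 := poissonCoeff_nat hz hr0 hr1 hr 1
    rw [zero_sub, poissonCoeff_neg, zero_add, if_pos rfl] at h
    rw [Nat.cast_one, pow_one] at h1
    linear_combination r * h - 2 * r * h1 + hr * poissonCoeff z 0
  have h1 : poissonCoeff z k = (-1) ^ k.natAbs * r ^ k.natAbs * poissonCoeff z 0 := by
    rw [← mul_pow, neg_one_mul, ← poissonCoeff_nat hz hr0 hr1 hr]
    rcases Int.natAbs_eq k with h | h
    · rw [← h]
    · rw [← poissonCoeff_neg, ← neg_eq_iff_eq_neg.2 h]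
  have h2 : (-1 : ℝ) ^ (k + 1) = -(-1) ^ k.natAbs := by
    rw [zpow_add₀ (by norm_num), zpow_one, mul_neg_one]
    congr 1
    rcases Int.natAbs_eq k with h | h
    · nth_rewrite 1 [h]; rw [zpow_natCast]
    · nth_rewrite 1 [h]; rw [zpow_neg, zpow_natCast, ← inv_pow]; norm_num
  have h3 : ((-1 : ℝ) ^ k.natAbs) * (-1) ^ k.natAbs = 1 := by
    rw [← mul_pow]; norm_num
  have hr2 : 1 - r ^ 2 ≠ 0 := by nlinarith
  have hpi := Real.pi_pos.ne'
  have hz2 : z ^ 2 * r = (1 - r) ^ 2 := by linear_combination -hr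
  have hz3 : (1 : ℝ) + z ^ 2 ≠ 0 := by positivity
  rw [effWeight, auxPotential_second_diff hz, h1, h2]
  have h4 : poissonCoeff z 0 = 2 * Real.pi * r / (1 - r ^ 2) := by
    rw [eq_div_iff hr2, h0]
  have h5 : z ^ 2 / (2 + 2 * z ^ 2) * -(-1) ^ k.natAbs *
      -((1 + z ^ 2) / Real.pi * ((-1) ^ k.natAbs * r ^ k.natAbs * poissonCoeff z 0)) =
      (((-1 : ℝ) ^ k.natAbs) * (-1) ^ k.natAbs) *
      (z ^ 2 * ((1 + z ^ 2) / (2 + 2 * z ^ 2)) / Real.pi * poissonCoeff z 0 * r ^ k.natAbs) := by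
    ring
  rw [h5, h3, one_mul]
  congr 1
  have h6 : (1 + z ^ 2) / (2 + 2 * z ^ 2) = 1 / 2 := by
    rw [div_eq_div_iff (by positivity) (by norm_num)]; ring
  have h7 : (1 : ℝ) + r ≠ 0 := by positivity
  have h8 : 1 - r ^ 2 = (1 - r) * (1 + r) := by ring
  have h9 : 1 - r ≠ 0 := by linarith
  rw [h4, h6, h8]
  field_simp
  linear_combination hz2

/-! ### What is needed of the step laws, and its verification. -/

/-- The properties of the step law along the real line that are used. -/
structure IsStepLaw (ν : ℤ → ℝ) : Prop where
  nonneg : ∀ k, 0 ≤ ν k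
  neg : ∀ k, ν (-k) = ν k
  hasSum : HasSum ν 1
  summable_sq : Summable fun k : ℤ => (k : ℝ) ^ 2 * ν k
  one_pos : 0 < ν 1
  two_pos : 0 < ν 2

lemma isStepLaw_evenLaw {z : ℝ} (hz : 0 < z) : IsStepLaw (evenLaw z) where
  nonneg k := by unfold evenLaw; split_ifs <;> positivity
  neg k := by
    unfold evenLaw
    simp only [neg_eq_iff_eq_neg, neg_neg, or_comm]
  hasSum := by
    have h : HasSum (evenLaw z) (∑ k ∈ {1, -1, 2, -2}, evenLaw z k) :=
      hasSum_sum_of_ne_finset_zero fun k hk => by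
        simp only [Finset.mem_insert, Finset.mem_singleton, not_or] at hk
        simp [evenLaw, hk]
    convert h using 1
    simp [evenLaw]
    have : (1 : ℝ) + z ^ 2 ≠ 0 := by positivity
    field_simp
    ring
  summable_sq := by
    refine summable_of_ne_finset_zero (s := {1, -1, 2, -2}) (fun k hk => ?_)
    simp only [Finset.mem_insert, Finset.mem_singleton, not_or] at hk
    simp [evenLaw, hk]
  one_pos := by simp [evenLaw]; positivity
  two_pos := by simp [evenLaw]; positivity

lemma isStepLaw_oddLaw {z : ℝ} (hz : 0 < z) : IsStepLaw (oddLaw z) := by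
  obtain ⟨r, hr0, hr1, hr⟩ := exists_decay_rate hz
  have hq := effWeight_eq hz hr0 hr1 hr
  have h1r : 0 < 1 - r := by linarith
  have hq0 : ∀ k, 0 < effWeight z k := fun k => by rw [hq]; positivity
  have hgeo := hasSum_geometric_of_lt_one hr0.le hr1
  have hnat : ∀ n : ℕ, effWeight z n = (1 - r) / (1 + r) * r ^ n := fun n => by
    rw [hq, Int.natAbs_natCast]
  have hneg : ∀ n : ℕ, effWeight z (-(n + 1)) = (1 - r) / (1 + r) * (r * r ^ n) := fun n => by
    rw [hq, Int.natAbs_neg, ← pow_succ', show ((n : ℤ) + 1).natAbs = n + 1 by omega]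
  have hsum : HasSum (effWeight z) 1 := by
    have h := HasSum.of_nat_of_neg_add_one (f := effWeight z)
      ((hgeo.mul_left ((1 - r) / (1 + r))).congr_fun hnat)
      (((hgeo.mul_left r).mul_left ((1 - r) / (1 + r))).congr_fun hneg)
    convert h using 1
    have : (1 : ℝ) + r ≠ 0 := by positivity
    field_simp
  have hpair : HasSum (fun k : ℤ => if k = 2 ∨ k = -2 then (1 : ℝ) else 0) 2 := by
    have h : HasSum (fun k : ℤ => if k = 2 ∨ k = -2 then (1 : ℝ) else 0)
        (∑ k ∈ {2, -2}, if k = 2 ∨ k = -2 then (1 : ℝ) else 0) :=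
      hasSum_sum_of_ne_finset_zero fun k hk => by
        simp only [Finset.mem_insert, Finset.mem_singleton, not_or] at hk
        simp [hk]
    convert h using 1
    rw [Finset.sum_pair (by norm_num)]
    norm_num
  have hpow : Summable fun n : ℕ => (n : ℝ) ^ 2 * r ^ n :=
    summable_pow_mul_geometric_of_norm_lt_one 2 (by rwa [Real.norm_of_nonneg hr0.le])
  have hsq : Summable fun k : ℤ => (k : ℝ) ^ 2 * effWeight z k := by
    refine Summable.of_nat_of_neg_add_one ?_ ?_
    · refine (hpow.mul_left ((1 - r) / (1 + r))).congr fun n => ?_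
      rw [hnat]; push_cast; ring
    · refine (((summable_nat_add_iff 1).2 hpow).mul_left ((1 - r) / (1 + r))).congr fun n => ?_
      rw [hneg]; push_cast; ring
  refine ⟨fun k => ?_, fun k => ?_, ?_, ?_, ?_, ?_⟩
  · have := hq0 k
    unfold oddLaw
    split_ifs <;> positivity
  · unfold oddLaw
    rw [hq, hq, Int.natAbs_neg]
    simp only [neg_eq_iff_eq_neg, neg_neg, or_comm]
  · have h := (hpair.add hsum).div_const 3
    norm_num at h
    exact h
  · have h : Summable fun k : ℤ => (k : ℝ) ^ 2 * (if k = 2 ∨ k = -2 then (1 : ℝ) else 0) :=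
      summable_of_ne_finset_zero (s := {2, -2}) fun k hk => by
        simp only [Finset.mem_insert, Finset.mem_singleton, not_or] at hk
        simp [hk]
    refine ((h.add hsq).mul_right (1 / 3)).congr fun k => ?_
    unfold oddLaw
    ring
  · have := hq0 1
    simp [oddLaw]
    positivity
  · have := hq0 2
    simp [oddLaw]
    positivity

/-! ### Decay of powers of a lazy operator that commutes with a shift -/

/-- `S` is symmetric for the form `B`, and `0 ≤ S ≤ 1` in the sense of forms. -/
structure IsLazyFor {W : Type*} [AddCommGroup W] [Module ℝ W] (B : W →ₗ[ℝ] W →ₗ[ℝ] ℝ)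
    (S : W →ₗ[ℝ] W) : Prop where
  symm : ∀ f g, B f g = B g f
  nonneg : ∀ f, 0 ≤ B f f
  selfAdjoint : ∀ f g, B (S f) g = B f (S g)
  op_nonneg : ∀ f, 0 ≤ B (S f) f
  op_le_one : ∀ f, B (S f) f ≤ B f f

namespace IsLazyFor

variable {W : Type*} [AddCommGroup W] [Module ℝ W] {B : W →ₗ[ℝ] W →ₗ[ℝ] ℝ} {S : W →ₗ[ℝ] W}

/-- This is `S² ≤ S`, without a square root of `S`: add `S (1 - S)² ≥ 0` and `S³ ≤ S²`. -/
lemma norm_apply_le (h : IsLazyFor B S) (f : W) : B (S f) (S f) ≤ B (S f) f := by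
  have h1 := h.op_nonneg (f - S f)
  have h2 := h.op_le_one (S f)
  simp only [map_sub, LinearMap.sub_apply] at h1
  have h3 := h.selfAdjoint (S f) f
  linarith

/-- This is `S² (1 - S) ≤ 1 - S`, the sum of `S (1 - S)² ≥ 0` and `(1 - S)² ≥ 0`. -/
lemma energy_apply_le (h : IsLazyFor B S) (f : W) :
    B (S f) (S f) - B (S (S f)) (S f) ≤ B f f - B (S f) f := by
  have h1 := h.op_nonneg (f - S f)
  have h2 := h.nonneg (f - S f)
  simp only [map_sub, LinearMap.sub_apply] at h1 h2
  have h3 := h.selfAdjoint (S f) f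
  have h4 := h.symm f (S f)
  linarith

lemma energy_pow_antitone (h : IsLazyFor B S) (f : W) :
    Antitone fun n : ℕ => B ((S ^ n) f) ((S ^ n) f) - B (S ((S ^ n) f)) ((S ^ n) f) := by
  refine antitone_nat_of_succ_le fun n => ?_
  simp only [pow_succ', Module.End.mul_apply]
  exact h.energy_apply_le _

lemma norm_pow_antitone (h : IsLazyFor B S) (f : W) :
    Antitone fun n : ℕ => B ((S ^ n) f) ((S ^ n) f) := by
  refine antitone_nat_of_succ_le fun n => ?_
  simp only [pow_succ', Module.End.mul_apply]
  exact (h.norm_apply_le _).trans (h.op_le_one _)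

/-- The energy of `S ^ i f` is at most the drop of the squared norm from `i` to `i + 1`, so the
energies add up to at most `B f f`; as they decrease, the last of `m + 1` of them is at most the
average. -/
lemma energy_pow_le (h : IsLazyFor B S) (f : W) (m : ℕ) :
    B ((S ^ m) f) ((S ^ m) f) - B (S ((S ^ m) f)) ((S ^ m) f) ≤ B f f / (m + 1) := by
  have key : ∀ n : ℕ, ∑ i ∈ Finset.range n,
      (B ((S ^ i) f) ((S ^ i) f) - B (S ((S ^ i) f)) ((S ^ i) f))
        ≤ B f f - B ((S ^ n) f) ((S ^ n) f) := by
    intro n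
    induction n with
    | zero => simp
    | succ n ih =>
      rw [Finset.sum_range_succ]
      have := h.norm_apply_le ((S ^ n) f)
      simp only [pow_succ', Module.End.mul_apply]
      linarith
  have h1 := key (m + 1)
  have h2 := h.nonneg ((S ^ (m + 1)) f)
  have h3 : ((m + 1 : ℕ) : ℝ) * (B ((S ^ m) f) ((S ^ m) f) - B (S ((S ^ m) f)) ((S ^ m) f)) ≤
      ∑ i ∈ Finset.range (m + 1),
        (B ((S ^ i) f) ((S ^ i) f) - B (S ((S ^ i) f)) ((S ^ i) f)) := by
    have := Finset.card_nsmul_le_sum (Finset.range (m + 1))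
      (fun i => B ((S ^ i) f) ((S ^ i) f) - B (S ((S ^ i) f)) ((S ^ i) f)) _
      (fun i hi => h.energy_pow_antitone f (Finset.mem_range_succ_iff.1 hi))
    simpa using this
  rw [le_div_iff₀ (by positivity)]
  push_cast at h3
  linarith

lemma pow_selfAdjoint (h : IsLazyFor B S) (n : ℕ) (f g : W) :
    B ((S ^ n) f) g = B f ((S ^ n) g) := by
  induction n generalizing f g with
  | zero => simp
  | succ n ih =>
    rw [pow_succ, Module.End.mul_apply, ih, h.selfAdjoint, ← Module.End.mul_apply, ← pow_succ',
      ← pow_succ]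

end IsLazyFor

/-! ### Binomial sums. -/

/-- The sum is the central binomial coefficient over `4 ^ k`, the return probability of simple
random walk at time `2 k`. The induction is run on the squared inequality `(n + 1) * centralBinom n
^ 2 ≤ 16 ^ n`. -/
lemma sum_choose_div_two_pow_sq_le (k : ℕ) :
    ∑ i ∈ Finset.range (k + 1), ((k.choose i : ℝ) / 2 ^ k) ^ 2 ≤ 1 / √(k + 1) := by
  have h1 : ∑ i ∈ Finset.range (k + 1), ((k.choose i : ℝ) / 2 ^ k) ^ 2
      = (k.centralBinom : ℝ) / 4 ^ k := by
    have : (∑ i ∈ Finset.range (k + 1), ((k.choose i : ℝ)) ^ 2) = k.centralBinom := by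
      rw [Nat.centralBinom, ← Nat.sum_range_choose_sq]
      push_cast; rfl
    rw [← this, Finset.sum_div]
    refine Finset.sum_congr rfl fun i _ => ?_
    rw [div_pow, ← pow_mul, mul_comm k 2, pow_mul]; norm_num
  have h2 : ∀ n : ℕ, ((n : ℝ) + 1) * (n.centralBinom : ℝ) ^ 2 ≤ 16 ^ n := by
    intro n
    induction n with
    | zero => simp
    | succ n ih =>
      have e : ((n : ℝ) + 1) * ((n + 1).centralBinom : ℝ) = 2 * (2 * n + 1) * n.centralBinom := by
        exact_mod_cast Nat.succ_mul_centralBinom_succ n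
      have hn : (0 : ℝ) < n + 1 := by positivity
      have e2 : ((n + 1).centralBinom : ℝ) = 2 * (2 * n + 1) * n.centralBinom / (n + 1) := by
        rw [eq_div_iff hn.ne', ← e]; ring
      rw [e2, pow_succ (16 : ℝ)]
      push_cast
      rw [div_pow, ← mul_div_assoc, div_le_iff₀ (by positivity)]
      have e3 : ((n : ℝ) + 1 + 1) * (2 * n + 1) ^ 2 ≤ 4 * (n + 1) ^ 3 := by
        have : (0 : ℝ) ≤ n := by positivity
        nlinarith
      calc ((n : ℝ) + 1 + 1) * (2 * (2 * n + 1) * n.centralBinom) ^ 2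
          = 4 * (((n : ℝ) + 1 + 1) * (2 * n + 1) ^ 2) * (n.centralBinom : ℝ) ^ 2 := by ring
        _ ≤ 4 * (4 * (n + 1) ^ 3) * (n.centralBinom : ℝ) ^ 2 := by gcongr
        _ = 16 * (n + 1) ^ 2 * (((n : ℝ) + 1) * (n.centralBinom : ℝ) ^ 2) := by ring
        _ ≤ 16 * (n + 1) ^ 2 * 16 ^ n := by gcongr
        _ = 16 ^ n * 16 * ((n : ℝ) + 1) ^ 2 := by ring
  rw [h1, div_le_div_iff₀ (by positivity) (by positivity), one_mul]
  refine abs_le_of_sq_le_sq' ?_ (by positivity) |>.2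
  rw [mul_pow, Real.sq_sqrt (by positivity), ← pow_mul, mul_comm k 2, pow_mul]
  have := h2 k
  norm_num
  linarith

/-- Since `(n choose k) / (k + 1) = (n + 1 choose k + 1) / (n + 1)`, the sum is, up to `1 / (c (n +
1))`, the probability that a binomial variable is positive. -/
lemma sum_binomial_div_le {c : ℝ} (hc0 : 0 < c) (hc1 : c ≤ 1) (n : ℕ) :
    ∑ k ∈ Finset.range (n + 1), (n.choose k : ℝ) * (1 - c) ^ (n - k) * c ^ k * (1 / (k + 1))
      ≤ 1 / (c * (n + 1)) := by
  have h0 : (0 : ℝ) ≤ 1 - c := by linarith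
  have h1 : ∀ k ∈ Finset.range (n + 1),
      (n.choose k : ℝ) * (1 - c) ^ (n - k) * c ^ k * (1 / (k + 1)) =
        (1 / (c * (n + 1))) *
          (c ^ (k + 1) * (1 - c) ^ (n + 1 - (k + 1)) * ((n + 1).choose (k + 1) : ℝ)) := by
    intro k hk
    have e : ((n : ℝ) + 1) * n.choose k = (n + 1).choose (k + 1) * (k + 1) := by
      exact_mod_cast Nat.add_one_mul_choose_eq n k
    have hk : (0 : ℝ) < k + 1 := by positivity
    have hn : (0 : ℝ) < n + 1 := by positivity
    have e2 : (n.choose k : ℝ) = (n + 1).choose (k + 1) * (k + 1) / (n + 1) := by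
      rw [eq_div_iff hn.ne', ← e]; ring
    rw [e2, Nat.add_sub_add_right]
    field_simp
    ring
  rw [Finset.sum_congr rfl h1, ← Finset.mul_sum]
  have h2 := add_pow c (1 - c) (n + 1)
  rw [Finset.sum_range_succ'] at h2
  have h3 : ∑ k ∈ Finset.range (n + 1),
      (c ^ (k + 1) * (1 - c) ^ (n + 1 - (k + 1)) * ((n + 1).choose (k + 1) : ℝ)) ≤ 1 := by
    have : 0 ≤ c ^ 0 * (1 - c) ^ (n + 1 - 0) * ((n + 1).choose 0 : ℝ) := by positivity
    have h4 : (c + (1 - c)) ^ (n + 1) = 1 := by simp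
    linarith
  exact mul_le_of_le_one_right (by positivity) h3

/-- Cauchy–Schwarz for the binomial law reduces the mean of the square root to the preceding bound.
-/
lemma sum_binomial_div_sqrt_le {c : ℝ} (hc0 : 0 < c) (hc1 : c ≤ 1) (n : ℕ) :
    ∑ k ∈ Finset.range (n + 1), (n.choose k : ℝ) * (1 - c) ^ (n - k) * c ^ k * (1 / √(k + 1))
      ≤ 1 / √(c * (n + 1)) := by
  have h0 : (0 : ℝ) ≤ 1 - c := by linarith
  have hp : ∀ k, 0 ≤ (n.choose k : ℝ) * (1 - c) ^ (n - k) * c ^ k := fun k => by positivity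
  have hs : ∑ k ∈ Finset.range (n + 1), (n.choose k : ℝ) * (1 - c) ^ (n - k) * c ^ k = 1 := by
    have h2 := add_pow c (1 - c) n
    rw [add_sub_cancel, one_pow] at h2
    refine Eq.trans ?_ h2.symm
    exact Finset.sum_congr rfl fun k _ => by ring
  have h1 := Finset.sum_mul_sq_le_sq_mul_sq (Finset.range (n + 1))
    (fun k => √((n.choose k : ℝ) * (1 - c) ^ (n - k) * c ^ k))
    (fun k => √((n.choose k : ℝ) * (1 - c) ^ (n - k) * c ^ k) * (1 / √(k + 1)))
  have e1 : ∀ k : ℕ, √((n.choose k : ℝ) * (1 - c) ^ (n - k) * c ^ k) *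
      (√((n.choose k : ℝ) * (1 - c) ^ (n - k) * c ^ k) * (1 / √(k + 1)))
      = (n.choose k : ℝ) * (1 - c) ^ (n - k) * c ^ k * (1 / √(k + 1)) := by
    intro k
    rw [← mul_assoc, Real.mul_self_sqrt (hp k)]
  have e2 : ∀ k : ℕ, (√((n.choose k : ℝ) * (1 - c) ^ (n - k) * c ^ k) * (1 / √(k + 1))) ^ 2
      = (n.choose k : ℝ) * (1 - c) ^ (n - k) * c ^ k * (1 / (k + 1)) := by
    intro k
    rw [mul_pow, Real.sq_sqrt (hp k), div_pow, Real.sq_sqrt (by positivity), one_pow]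
  simp only [e1, e2, Real.sq_sqrt (hp _), hs, one_mul] at h1
  refine abs_le_of_sq_le_sq' ?_ (by positivity) |>.2
  rw [div_pow, Real.sq_sqrt (by positivity), one_pow]
  exact h1.trans (sum_binomial_div_le hc0 hc1 n)

namespace IsLazyFor

variable {W : Type*} [AddCommGroup W] [Module ℝ W] {B : W →ₗ[ℝ] W →ₗ[ℝ] ℝ} {S : W →ₗ[ℝ] W}

/-- Iteration of `‖S h‖² ≤ (1 - c) ‖h‖² + c ‖M h‖²`. -/
lemma norm_pow_le_sum {M : W →ₗ[ℝ] W} {c : ℝ} (hc0 : 0 < c) (hc1 : c ≤ 1)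
    (hM : Commute S M)
    (hS : ∀ f, B (S f) (S f) ≤ (1 - c) * B f f + c * B (M f) (M f)) (n : ℕ) (f : W) :
    B ((S ^ n) f) ((S ^ n) f) ≤ ∑ k ∈ Finset.range (n + 1),
      (n.choose k : ℝ) * (1 - c) ^ (n - k) * c ^ k * B ((M ^ k) f) ((M ^ k) f) := by
  have h0 : (0 : ℝ) ≤ 1 - c := by linarith
  induction n generalizing f with
  | zero => simp
  | succ n ih =>
    set v : ℕ → ℝ := fun k => B ((M ^ k) f) ((M ^ k) f) with hv
    have h1 : B ((S ^ (n + 1)) f) ((S ^ (n + 1)) f) ≤ ∑ k ∈ Finset.range (n + 1),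
        (n.choose k : ℝ) * (1 - c) ^ (n - k) * c ^ k * ((1 - c) * v k + c * v (k + 1)) := by
      rw [pow_succ, Module.End.mul_apply]
      refine (ih (S f)).trans (Finset.sum_le_sum fun k _ => ?_)
      gcongr
      have e : (M ^ k) (S f) = S ((M ^ k) f) := by
        rw [← Module.End.mul_apply, ← (hM.pow_right k).eq, Module.End.mul_apply]
      have e2 : (M ^ (k + 1)) f = M ((M ^ k) f) := by rw [pow_succ', Module.End.mul_apply]
      simp only [hv, e, e2]
      exact hS _
    refine h1.trans (le_of_eq ?_)
    have h2 : ∀ k ∈ Finset.range (n + 1), (n.choose k : ℝ) * (1 - c) ^ (n - k) * c ^ k *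
        ((1 - c) * v k + c * v (k + 1)) =
        (n.choose k : ℝ) * (1 - c) ^ (n + 1 - k) * c ^ k * v k +
        (n.choose k : ℝ) * (1 - c) ^ (n - k) * c ^ (k + 1) * v (k + 1) := by
      intro k hk
      rw [Nat.sub_add_comm (Finset.mem_range_succ_iff.1 hk)]
      ring
    rw [Finset.sum_congr rfl h2, Finset.sum_add_distrib]
    have h3 : ∑ k ∈ Finset.range (n + 1), (n.choose k : ℝ) * (1 - c) ^ (n + 1 - k) * c ^ k * v k
        = ∑ k ∈ Finset.range (n + 1),
          (n.choose (k + 1) : ℝ) * (1 - c) ^ (n - k) * c ^ (k + 1) * v (k + 1)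
          + (1 - c) ^ (n + 1) * v 0 := by
      have := Finset.sum_range_succ'
        (fun k => (n.choose k : ℝ) * (1 - c) ^ (n + 1 - k) * c ^ k * v k) (n + 1)
      rw [Finset.sum_range_succ] at this
      simp only [Nat.choose_succ_self, Nat.cast_zero, zero_mul, add_zero, Nat.choose_zero_right,
        Nat.cast_one, one_mul, pow_zero, mul_one, Nat.sub_zero, Nat.add_sub_add_right] at this
      exact this
    change _ = ∑ k ∈ Finset.range (n + 1 + 1),
      ((n + 1).choose k : ℝ) * (1 - c) ^ (n + 1 - k) * c ^ k * v k
    rw [h3, Finset.sum_range_succ' _ (n + 1)]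
    simp only [Nat.choose_zero_right, Nat.cast_one, one_mul, pow_zero, mul_one, Nat.sub_zero,
      Nat.add_sub_add_right, Nat.choose_succ_succ' n, Nat.cast_add, add_mul,
      Finset.sum_add_distrib]
    ring

/-- Decay of `S ^ (2 * m)` on a vector whose shifts are controlled by the energy and the norm. -/
theorem norm_pow_two_mul_le (h : IsLazyFor B S) {τ : W →ₗ[ℝ] W} {c : ℝ} (hc0 : 0 < c)
    (hc1 : c ≤ 1) (hτ : Commute S τ) (hτB : ∀ f, B (τ f) (τ f) = B f f)
    (hE : ∀ f, c * (B (f - τ f) (f - τ f) / 4) ≤ B f f - B (S f) f)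
    {a b : ℝ} {f : W} (ha : 0 ≤ a) (hb : 0 ≤ b)
    (hf : ∀ (k : ℕ) (g : W), ∑ i ∈ Finset.range (k + 1), (B ((τ ^ i) f) g) ^ 2 ≤
      a * (B g g - B (S g) g) + b * B g g) (m : ℕ) :
    B ((S ^ (2 * m)) f) ((S ^ (2 * m)) f) ≤ (a / (m + 1) + b) / √(c * (m + 1)) := by
  set M : W →ₗ[ℝ] W := (1 / 2 : ℝ) • (1 + τ) with hMdef
  have hM : Commute S M := (Commute.add_right (Commute.one_right S) hτ).smul_right _
  have hMf : ∀ f, M f = (1 / 2 : ℝ) • (f + τ f) := fun f => by simp [hMdef]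
  -- As `τ` preserves the form, the parallelogram identity gives `‖M f‖² = ‖f‖² - ‖f - τ f‖² / 4`;
  -- combine `S² ≤ S` with the energy bound `hE`.
  have hS : ∀ f, B (S f) (S f) ≤ (1 - c) * B f f + c * B (M f) (M f) := by
    intro f
    have h1 := h.norm_apply_le f
    have h2 := hE f
    have h3 := hτB f
    have h4 := h.symm f (τ f)
    rw [hMf]
    simp only [map_sub, map_add, map_smul, LinearMap.sub_apply, LinearMap.add_apply,
      LinearMap.smul_apply, smul_eq_mul, h3, h4] at h2 ⊢
    nlinarith
  have hMk : ∀ k : ℕ, (M ^ k) f =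
      ∑ i ∈ Finset.range (k + 1), ((k.choose i : ℝ) / 2 ^ k) • (τ ^ i) f := by
    intro k
    rw [hMdef, smul_pow, add_comm, (Commute.one_right τ).add_pow]
    simp only [one_pow, mul_one, LinearMap.smul_apply, LinearMap.sum_apply, Finset.smul_sum]
    refine Finset.sum_congr rfl fun i _ => ?_
    rw [← Nat.cast_comm, ← nsmul_eq_mul, LinearMap.smul_apply, ← Nat.cast_smul_eq_nsmul ℝ,
      smul_smul]
    congr 1
    rw [one_div, inv_pow]
    ring
  have hN : ∀ k : ℕ, B ((S ^ m) ((M ^ k) f)) ((S ^ m) ((M ^ k) f)) ≤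
      (a / (m + 1) + b) * (1 / √(k + 1)) := by
    intro k
    set F := (M ^ k) f with hF
    set N := B ((S ^ m) F) ((S ^ m) F) with hNdef
    have hN0 : 0 ≤ N := h.nonneg _
    set G := (S ^ m) ((S ^ m) F) with hG
    have h1 : N = ∑ i ∈ Finset.range (k + 1), ((k.choose i : ℝ) / 2 ^ k) * B ((τ ^ i) f) G := by
      rw [hNdef, h.pow_selfAdjoint]
      change B F G = _
      clear_value G
      rw [hF, hMk]
      simp [LinearMap.sum_apply]
    -- Cauchy–Schwarz separates the binomial weights, whose squares give `1 / √(k + 1)`, from the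
    -- pairings of the translates with `G`. By `energy_pow_le`, the energy of `G` is at most `N / (m
    -- + 1)`.
    have h2 : N ^ 2 ≤ (1 / √(k + 1)) * ((a / (m + 1) + b) * N) := by
      rw [h1]
      refine (Finset.sum_mul_sq_le_sq_mul_sq _ _ _).trans ?_
      rw [← h1]
      refine mul_le_mul (sum_choose_div_two_pow_sq_le k) ((hf k G).trans ?_)
        (Finset.sum_nonneg fun _ _ => sq_nonneg _) (by positivity)
      have h3 := h.energy_pow_le ((S ^ m) F) m
      have h4 : B G G ≤ N := h.norm_pow_antitone ((S ^ m) F) (Nat.zero_le m)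
      calc a * (B G G - B (S G) G) + b * B G G ≤ a * (N / (m + 1)) + b * N := by gcongr
        _ = (a / (m + 1) + b) * N := by ring
    rcases hN0.eq_or_lt with h0 | h0
    · rw [← h0]; positivity
    · have : N * N ≤ ((a / (m + 1) + b) * (1 / √(k + 1))) * N := by nlinarith
      exact le_of_mul_le_mul_right this h0
  -- The first `m` powers supply the bound `hN`; the other `m` are traded for a binomial mixture of
  -- powers of `M`.
  rw [two_mul, pow_add, Module.End.mul_apply]
  refine (norm_pow_le_sum hc0 hc1 hM hS m ((S ^ m) f)).trans ?_
  have hc : (0 : ℝ) ≤ 1 - c := by linarith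
  calc _ ≤ ∑ k ∈ Finset.range (m + 1), (m.choose k : ℝ) * (1 - c) ^ (m - k) * c ^ k *
        ((a / (m + 1) + b) * (1 / √(k + 1))) := by
        refine Finset.sum_le_sum fun k _ => ?_
        gcongr
        have e : (M ^ k) ((S ^ m) f) = (S ^ m) ((M ^ k) f) := by
          rw [← Module.End.mul_apply, ← (hM.pow_pow m k).eq, Module.End.mul_apply]
        rw [e]
        exact hN k
    _ = (a / (m + 1) + b) * ∑ k ∈ Finset.range (m + 1),
        (m.choose k : ℝ) * (1 - c) ^ (m - k) * c ^ k * (1 / √(k + 1)) := by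
        rw [Finset.mul_sum]
        exact Finset.sum_congr rfl fun k _ => by ring
    _ ≤ (a / (m + 1) + b) * (1 / √(c * (m + 1))) := by
        gcongr
        exact sum_binomial_div_sqrt_le hc0 hc1 m
    _ = _ := by ring

end IsLazyFor

/-! ### Reversible kernels acting on summable functions -/

/-- The action of a kernel on functions. -/
noncomputable def kerApply {V : Type*} (K : V → V → ℝ) (f : V → ℝ) (x : V) : ℝ :=
  ∑' y, K x y * f y

/-- A stochastic kernel that is reversible with respect to `π`. -/
structure IsReversible {V : Type*} (π : V → ℝ) (Q : V → V → ℝ) : Prop where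
  half_le : ∀ x, 1 / 2 ≤ π x
  bdd : ∃ M, ∀ x, π x ≤ M
  nonneg : ∀ x y, 0 ≤ Q x y
  hasSum : ∀ x, HasSum (Q x) 1
  symm : ∀ x y, π x * Q x y = π y * Q y x

/-- The space of summable functions. -/
def summableFun (V : Type*) : Submodule ℝ (V → ℝ) where
  carrier := {f | Summable f}
  add_mem' hf hg := hf.add hg
  zero_mem' := summable_zero
  smul_mem' c _ hf := hf.mul_left c

lemma exists_bound_of_summableFun {V : Type*} (f : summableFun V) : ∃ M, ∀ x, |f.1 x| ≤ M := by
  refine ⟨∑' x, |f.1 x|, fun x => ?_⟩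
  have h : Summable fun x => |f.1 x| := f.2.abs
  exact h.le_tsum x fun _ _ => abs_nonneg _

lemma summable_mul_summableFun {V : Type*} (f : summableFun V) {g : V → ℝ} {M : ℝ}
    (hg : ∀ x, |g x| ≤ M) : Summable fun x => g x * f.1 x := by
  have h : Summable fun x => |f.1 x| := f.2.abs
  refine Summable.of_norm_bounded (h.mul_left M) fun x => ?_
  rw [Real.norm_eq_abs, abs_mul]
  exact mul_le_mul_of_nonneg_right (hg x) (abs_nonneg _)

namespace IsReversible

variable {V : Type*} {π : V → ℝ} {Q : V → V → ℝ}

lemma pi_pos (h : IsReversible π Q) (x : V) : 0 < π x :=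
  lt_of_lt_of_le (by norm_num) (h.half_le x)

lemma exists_abs_mul_bound (h : IsReversible π Q) (f : summableFun V) :
    ∃ M, ∀ x, |π x * f.1 x| ≤ M := by
  obtain ⟨M, hM⟩ := h.bdd
  obtain ⟨N, hN⟩ := exists_bound_of_summableFun f
  refine ⟨M * N, fun x => ?_⟩
  rw [abs_mul, abs_of_pos (h.pi_pos x)]
  exact mul_le_mul (hM x) (hN x) (abs_nonneg _) ((h.pi_pos x).le.trans (hM x))

lemma summable_form (h : IsReversible π Q) (f g : summableFun V) :
    Summable fun x => π x * f.1 x * g.1 x := by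
  obtain ⟨M, hM⟩ := h.exists_abs_mul_bound f
  exact summable_mul_summableFun g hM

lemma summable_pair_fst (h : IsReversible π Q) (g : summableFun V) :
    Summable fun p : V × V => π p.1 * Q p.1 p.2 * |g.1 p.1| := by
  have hs : ∀ x, HasSum (fun y => π x * Q x y * |g.1 x|) (π x * |g.1 x|) := fun x => by
    simpa using ((h.hasSum x).mul_left (π x)).mul_right |g.1 x|
  refine (summable_prod_of_nonneg fun p => ?_).2 ⟨fun x => (hs x).summable, ?_⟩
  · exact mul_nonneg (mul_nonneg (h.pi_pos _).le (h.nonneg _ _)) (abs_nonneg _)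
  · simp only [(hs _).tsum_eq]
    obtain ⟨M, hM⟩ := h.bdd
    have hg : Summable fun x => |g.1 x| := g.2.abs
    refine Summable.of_nonneg_of_le (fun x => mul_nonneg (h.pi_pos x).le (abs_nonneg _))
      (fun x => mul_le_mul_of_nonneg_right (hM x) (abs_nonneg _)) (hg.mul_left M)

lemma summable_pair_snd (h : IsReversible π Q) (g : summableFun V) :
    Summable fun p : V × V => π p.1 * Q p.1 p.2 * |g.1 p.2| := by
  have := (Equiv.prodComm V V).summable_iff.2 (h.summable_pair_fst g)
  refine this.congr fun p => ?_
  simp [h.symm p.1 p.2]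

/-- The edge weights `π Q` are symmetric with bounded marginals, so a summable factor in either
variable is enough for convergence over pairs. -/
lemma summable_pair_of_bound (h : IsReversible π Q) (g : summableFun V) {M : ℝ}
    {F : V × V → ℝ} (hF : ∀ p, |F p| ≤ M * |g.1 p.1| ∨ |F p| ≤ M * |g.1 p.2|) :
    Summable fun p : V × V => π p.1 * Q p.1 p.2 * F p := by
  refine Summable.of_norm_bounded
    (((h.summable_pair_fst g).mul_left |M|).add ((h.summable_pair_snd g).mul_left |M|))
    fun p => ?_
  have h0 : 0 ≤ π p.1 * Q p.1 p.2 := mul_nonneg (h.pi_pos _).le (h.nonneg _ _)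
  rw [Real.norm_eq_abs, abs_mul, abs_of_nonneg h0]
  have h1 : |F p| ≤ |M| * |g.1 p.1| + |M| * |g.1 p.2| := by
    have := le_abs_self M
    rcases hF p with h | h
    · refine h.trans (le_add_of_le_of_nonneg ?_ (by positivity)); gcongr
    · refine h.trans (le_add_of_nonneg_of_le (by positivity) ?_); gcongr
  calc _ ≤ π p.1 * Q p.1 p.2 * (|M| * |g.1 p.1| + |M| * |g.1 p.2|) := by gcongr
    _ = _ := by ring

lemma summable_kerApply (h : IsReversible π Q) (g : summableFun V) :
    Summable (kerApply Q g.1) := by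
  have h1 : Summable fun p : V × V => π p.1 * Q p.1 p.2 * g.1 p.2 :=
    h.summable_pair_of_bound g (M := 1) fun p => Or.inr (by simp)
  have h2 : Summable fun p : V × V => Q p.1 p.2 * g.1 p.2 := by
    refine Summable.of_norm_bounded (h1.abs.mul_left 2) fun p => ?_
    rw [Real.norm_eq_abs, mul_assoc, abs_mul (π p.1), ← mul_assoc, abs_of_pos (h.pi_pos _)]
    have := h.half_le p.1
    exact le_mul_of_one_le_left (abs_nonneg _) (by linarith)
  exact h2.prod

lemma summable_row (h : IsReversible π Q) (g : summableFun V) (x : V) :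
    Summable fun y => Q x y * g.1 y := by
  have h1 : Summable fun p : V × V => π p.1 * Q p.1 p.2 * g.1 p.2 :=
    h.summable_pair_of_bound g (M := 1) fun p => Or.inr (by simp)
  have h2 := (h1.prod_factor x).mul_left (π x)⁻¹
  refine h2.congr fun y => ?_
  have := (h.pi_pos x).ne'
  field_simp

/-- The bilinear form `⟨f, g⟩ = ∑ π f g`. -/
noncomputable def form (h : IsReversible π Q) :
    summableFun V →ₗ[ℝ] summableFun V →ₗ[ℝ] ℝ :=
  LinearMap.mk₂ ℝ (fun f g => ∑' x, π x * f.1 x * g.1 x)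
    (fun f f' g => by
      rw [← (h.summable_form f g).tsum_add (h.summable_form f' g)]
      exact tsum_congr fun x => by simp only [Submodule.coe_add, Pi.add_apply]; ring)
    (fun c f g => by
      rw [smul_eq_mul, ← tsum_mul_left]
      exact tsum_congr fun x => by
        simp only [Submodule.coe_smul, Pi.smul_apply, smul_eq_mul]; ring)
    (fun f g g' => by
      rw [← (h.summable_form f g).tsum_add (h.summable_form f g')]
      exact tsum_congr fun x => by simp only [Submodule.coe_add, Pi.add_apply]; ring)
    (fun c f g => by
      rw [smul_eq_mul, ← tsum_mul_left]
      exact tsum_congr fun x => by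
        simp only [Submodule.coe_smul, Pi.smul_apply, smul_eq_mul]; ring)

lemma form_apply (h : IsReversible π Q) (f g : summableFun V) :
    h.form f g = ∑' x, π x * f.1 x * g.1 x := rfl

lemma form_comm (h : IsReversible π Q) (f g : summableFun V) : h.form f g = h.form g f := by
  rw [form_apply, form_apply]
  exact tsum_congr fun x => by ring

lemma form_self_nonneg (h : IsReversible π Q) (f : summableFun V) : 0 ≤ h.form f f := by
  rw [form_apply]
  refine tsum_nonneg fun x => ?_
  rw [mul_assoc]
  exact mul_nonneg (h.pi_pos x).le (mul_self_nonneg _)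

lemma form_sq_le (h : IsReversible π Q) (f g : summableFun V) :
    (h.form f g) ^ 2 ≤ h.form f f * h.form g g :=
  LinearMap.BilinForm.apply_sq_le_of_symm h.form h.form_self_nonneg ⟨h.form_comm⟩ f g

/-- The kernel as a linear map on summable functions. -/
noncomputable def op (h : IsReversible π Q) : summableFun V →ₗ[ℝ] summableFun V where
  toFun f := ⟨kerApply Q f.1, h.summable_kerApply f⟩
  map_add' f g := by
    ext x
    change ∑' y, Q x y * (f.1 y + g.1 y) = kerApply Q f.1 x + kerApply Q g.1 x
    rw [kerApply, kerApply, ← (h.summable_row f x).tsum_add (h.summable_row g x)]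
    exact tsum_congr fun y => by ring
  map_smul' c f := by
    ext x
    change ∑' y, Q x y * (c * f.1 y) = c * kerApply Q f.1 x
    rw [kerApply, ← tsum_mul_left]
    exact tsum_congr fun y => by ring

lemma op_apply (h : IsReversible π Q) (f : summableFun V) (x : V) :
    (h.op f).1 x = kerApply Q f.1 x := rfl

lemma summable_pair_mul (h : IsReversible π Q) (f g : summableFun V) :
    Summable fun p : V × V => π p.1 * Q p.1 p.2 * (f.1 p.1 * g.1 p.2) := by
  obtain ⟨M, hM⟩ := exists_bound_of_summableFun f
  refine h.summable_pair_of_bound g (M := M) fun p => Or.inr ?_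
  rw [abs_mul]
  exact mul_le_mul_of_nonneg_right (hM _) (abs_nonneg _)

lemma form_op (h : IsReversible π Q) (f g : summableFun V) :
    h.form f (h.op g) = ∑' p : V × V, π p.1 * Q p.1 p.2 * (f.1 p.1 * g.1 p.2) := by
  rw [(h.summable_pair_mul f g).tsum_prod, form_apply]
  refine tsum_congr fun x => ?_
  rw [op_apply, kerApply, ← tsum_mul_left]
  exact tsum_congr fun y => by ring

lemma form_op_comm (h : IsReversible π Q) (f g : summableFun V) :
    h.form (h.op f) g = h.form f (h.op g) := by
  rw [h.form_comm, h.form_op, h.form_op, ← (Equiv.prodComm V V).tsum_eq]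
  refine tsum_congr fun p => ?_
  simp only [Equiv.prodComm_apply, Prod.fst_swap, Prod.snd_swap]
  rw [h.symm]
  ring

lemma hasSum_pair_sq_fst (h : IsReversible π Q) (f : summableFun V) :
    HasSum (fun p : V × V => π p.1 * Q p.1 p.2 * f.1 p.1 ^ 2) (h.form f f) := by
  obtain ⟨M, hM⟩ := exists_bound_of_summableFun f
  have hs : Summable fun p : V × V => π p.1 * Q p.1 p.2 * f.1 p.1 ^ 2 := by
    refine h.summable_pair_of_bound f (M := M) fun p => Or.inl ?_
    rw [sq, abs_mul]
    exact mul_le_mul_of_nonneg_right (hM _) (abs_nonneg _)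
  convert hs.hasSum using 1
  rw [hs.tsum_prod, form_apply]
  refine tsum_congr fun x => ?_
  simp only []
  rw [tsum_mul_right, tsum_mul_left, (h.hasSum x).tsum_eq]
  ring

lemma hasSum_pair_sq_snd (h : IsReversible π Q) (f : summableFun V) :
    HasSum (fun p : V × V => π p.1 * Q p.1 p.2 * f.1 p.2 ^ 2) (h.form f f) := by
  have := (Equiv.prodComm V V).hasSum_iff.2 (h.hasSum_pair_sq_fst f)
  convert this using 2 with p
  simp [h.symm p.1 p.2]

/-- The Dirichlet form as a sum over edges. -/
lemma hasSum_dirichlet (h : IsReversible π Q) (f : summableFun V) :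
    HasSum (fun p : V × V => π p.1 * Q p.1 p.2 * (f.1 p.1 - f.1 p.2) ^ 2)
      (2 * (h.form f f - h.form (h.op f) f)) := by
  have h1 := (h.summable_pair_mul f f).hasSum
  rw [← h.form_op] at h1
  have h2 := ((h.hasSum_pair_sq_fst f).add (h.hasSum_pair_sq_snd f)).sub (h1.mul_left 2)
  rw [h.form_op_comm]
  rw [mul_sub, two_mul]
  exact h2.congr_fun fun p => by ring

/-- Expand the sum of `(f x + f y) ^ 2` over edges, the counterpart of the Dirichlet form. This
gives `Q ≥ -1`, hence the positivity of the lazy operator. -/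
lemma form_op_ge (h : IsReversible π Q) (f : summableFun V) :
    -h.form f f ≤ h.form (h.op f) f := by
  have h1 := (h.summable_pair_mul f f).hasSum
  rw [← h.form_op] at h1
  have h2 := ((h.hasSum_pair_sq_fst f).add (h.hasSum_pair_sq_snd f)).add (h1.mul_left 2)
  have h3 := h2.nonneg fun p => by
    have h0 : 0 ≤ π p.1 * Q p.1 p.2 := mul_nonneg (h.pi_pos _).le (h.nonneg _ _)
    have : π p.1 * Q p.1 p.2 * f.1 p.1 ^ 2 + π p.1 * Q p.1 p.2 * f.1 p.2 ^ 2 +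
      2 * (π p.1 * Q p.1 p.2 * (f.1 p.1 * f.1 p.2)) =
      π p.1 * Q p.1 p.2 * (f.1 p.1 + f.1 p.2) ^ 2 := by ring
    rw [this]
    positivity
  rw [h.form_op_comm]
  linarith

/-- The lazy version of the kernel as a linear map. -/
noncomputable def lazyOp (h : IsReversible π Q) : summableFun V →ₗ[ℝ] summableFun V :=
  (1 / 2 : ℝ) • (1 + h.op)

lemma lazyOp_apply (h : IsReversible π Q) (f : summableFun V) :
    h.lazyOp f = (1 / 2 : ℝ) • (f + h.op f) := by simp [lazyOp]

lemma energy_eq (h : IsReversible π Q) (f : summableFun V) :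
    h.form f f - h.form (h.lazyOp f) f = (h.form f f - h.form (h.op f) f) / 2 := by
  rw [lazyOp_apply]
  simp only [map_smul, map_add, LinearMap.smul_apply, LinearMap.add_apply, smul_eq_mul]
  ring

lemma isLazyFor (h : IsReversible π Q) : IsLazyFor h.form h.lazyOp where
  symm := h.form_comm
  nonneg := h.form_self_nonneg
  selfAdjoint f g := by
    simp only [lazyOp_apply, map_smul, map_add, LinearMap.smul_apply, LinearMap.add_apply,
      smul_eq_mul, h.form_op_comm]
  op_nonneg f := by
    have := h.form_op_ge f
    rw [lazyOp_apply]
    simp only [map_smul, map_add, LinearMap.smul_apply, LinearMap.add_apply, smul_eq_mul]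
    linarith
  op_le_one f := by
    have h1 := h.energy_eq f
    have h2 := (h.hasSum_dirichlet f).nonneg fun p =>
      mul_nonneg (mul_nonneg (h.pi_pos _).le (h.nonneg _ _)) (sq_nonneg _)
    linarith

/-- Energy controls any family of distinct edges. -/
lemma sum_edges_le_energy (h : IsReversible π Q) (f : summableFun V) {ι : Type*}
    {e : ι → V × V} (he : Function.Injective e) (s : Finset ι) :
    ∑ i ∈ s, π (e i).1 * Q (e i).1 (e i).2 * (f.1 (e i).1 - f.1 (e i).2) ^ 2 ≤
      4 * (h.form f f - h.form (h.lazyOp f) f) := by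
  have h1 := h.hasSum_dirichlet f
  have h2 := sum_le_hasSum (s.map ⟨e, he⟩) (fun p _ =>
      mul_nonneg (mul_nonneg (h.pi_pos _).le (h.nonneg _ _)) (sq_nonneg _)) h1
  rw [Finset.sum_map] at h2
  have h3 := h.energy_eq f
  simp only [Function.Embedding.coeFn_mk] at h2
  linarith

lemma sum_sq_le_form (h : IsReversible π Q) (f : summableFun V) {ι : Type*}
    {e : ι → V} (he : Function.Injective e) (s : Finset ι) :
    ∑ i ∈ s, f.1 (e i) ^ 2 ≤ 2 * h.form f f := by
  have h1 := (h.summable_form f f).hasSum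
  have h2 := sum_le_hasSum (s.map ⟨e, he⟩) (fun x _ => by
      rw [mul_assoc]; exact mul_nonneg (h.pi_pos _).le (mul_self_nonneg _)) h1
  rw [Finset.sum_map] at h2
  rw [form_apply]
  refine le_trans ?_ (mul_le_mul_of_nonneg_left h2 zero_le_two)
  rw [Finset.mul_sum]
  refine Finset.sum_le_sum fun i _ => ?_
  have := h.half_le (e i)
  simp only [Function.Embedding.coeFn_mk]
  nlinarith [sq_nonneg (f.1 (e i))]

open Classical in
/-- The normalised point mass, which represents the evaluation at a point. -/
noncomputable def point (_ : IsReversible π Q) (x : V) : summableFun V :=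
  ⟨fun y => if y = x then (π x)⁻¹ else 0, summable_of_ne_finset_zero (s := {x}) fun y hy => by
    rw [if_neg (by simpa using hy)]⟩

/-- Evaluation becomes a pairing, so powers of the operator can be moved from the function to the
point mass. -/
lemma form_point (h : IsReversible π Q) (x : V) (f : summableFun V) :
    h.form (h.point x) f = f.1 x := by
  rw [form_apply, tsum_eq_single x fun y hy => by simp [point, hy]]
  simp [point, (h.pi_pos x).ne']

end IsReversible

/-! ### The effective walk -/

/-- The reversible measure of the effective walk. -/
noncomputable def revMeasure (s : ℝ) (x : Vertex) : ℝ := if x.2 = 0 then 1 / (2 * s) else 1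

lemma LatticeNbr.symm {x y : Vertex} (h : LatticeNbr x y) : LatticeNbr y x := by
  unfold LatticeNbr at *; omega

lemma latticeNbr_comm {x y : Vertex} : LatticeNbr x y ↔ LatticeNbr y x :=
  ⟨LatticeNbr.symm, LatticeNbr.symm⟩

lemma latticeNbr_iff (x y : Vertex) : LatticeNbr x y ↔
    y = (x.1 + 2, x.2) ∨ y = (x.1 - 2, x.2) ∨ y = (x.1, x.2 + 1) ∨ y = (x.1, x.2 - 1) := by
  unfold LatticeNbr
  simp only [Prod.ext_iff]
  omega

lemma hasSum_stepKernel_off (s : ℝ) (ν : ℤ → ℝ) {x : Vertex} (hx : x.2 ≠ 0) (f : Vertex → ℝ) :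
    HasSum (fun y => stepKernel s ν x y * f y)
      (1 / 4 * (f (x.1 + 2, x.2) + f (x.1 - 2, x.2) + f (x.1, x.2 + 1) + f (x.1, x.2 - 1))) := by
  have h : HasSum (fun y => stepKernel s ν x y * f y)
      (∑ y ∈ {(x.1 + 2, x.2), (x.1 - 2, x.2), (x.1, x.2 + 1), (x.1, x.2 - 1)},
        stepKernel s ν x y * f y) := by
    refine hasSum_sum_of_ne_finset_zero fun y hy => ?_
    have : ¬ LatticeNbr x y := by
      rw [latticeNbr_iff]
      simpa only [Finset.mem_insert, Finset.mem_singleton] using hy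
    simp [stepKernel, hx, this]
  convert h using 1
  have h1 : ∀ y, y = (x.1 + 2, x.2) ∨ y = (x.1 - 2, x.2) ∨ y = (x.1, x.2 + 1) ∨
      y = (x.1, x.2 - 1) → stepKernel s ν x y = 1 / 4 := fun y hy => by
    rw [stepKernel, if_neg hx, if_pos ((latticeNbr_iff x y).2 hy)]
  rw [Finset.sum_insert, Finset.sum_insert, Finset.sum_insert, Finset.sum_singleton,
    h1 _ (by simp), h1 _ (by simp), h1 _ (by simp), h1 _ (by simp)]
  · ring
  · simp only [Finset.mem_singleton, Prod.mk.injEq]; omega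
  · simp only [Finset.mem_insert, Finset.mem_singleton, Prod.mk.injEq]; omega
  · simp only [Finset.mem_insert, Finset.mem_singleton, Prod.mk.injEq]; omega

lemma hasSum_stepKernel_line (s : ℝ) (ν : ℤ → ℝ) {x : Vertex} (hx : x.2 = 0) {f : Vertex → ℝ}
    {a : ℝ} (ha : HasSum (fun k => ν k * f (x.1 + k, 0)) a) :
    HasSum (fun y => stepKernel s ν x y * f y)
      ((1 - s) * a + s / 2 * (f (x.1, 1) + f (x.1, -1))) := by
  have h1 : HasSum (fun y : Vertex => if y.2 = 0 then (1 - s) * (ν (y.1 - x.1) * f y) else 0)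
      ((1 - s) * a) := by
    have hinj : Function.Injective (fun k : ℤ => ((x.1 + k, 0) : Vertex)) := fun k l h => by
      simpa using h
    refine (hinj.hasSum_iff fun y hy => ?_).1 ?_
    · rw [if_neg]
      exact fun h => hy ⟨y.1 - x.1, by simp [Prod.ext_iff, h]⟩
    · refine (ha.mul_left (1 - s)).congr_fun fun k => ?_
      simp
  have h2 : HasSum (fun y : Vertex => if y.2 = 0 then 0 else stepKernel s ν x y * f y)
      (∑ y ∈ {(x.1, 1), (x.1, -1)}, if y.2 = 0 then 0 else stepKernel s ν x y * f y) := by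
    refine hasSum_sum_of_ne_finset_zero fun y hy => ?_
    split_ifs with h
    · rfl
    · have : ¬ LatticeNbr x y := by
        rw [latticeNbr_iff]
        simp only [Finset.mem_insert, Finset.mem_singleton, Prod.ext_iff] at hy ⊢
        omega
      simp [stepKernel, hx, h, this]
  have h3 := h1.add h2
  convert h3 using 1
  · ext y
    split_ifs with h
    · simp only [stepKernel, hx, h, if_true]; ring
    · ring
  · have e1 : stepKernel s ν x (x.1, 1) = s / 2 := by
      simp [stepKernel, hx, latticeNbr_iff]
    have e2 : stepKernel s ν x (x.1, -1) = s / 2 := by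
      simp [stepKernel, hx, latticeNbr_iff]
    rw [Finset.sum_pair (by simp), if_neg (by simp), if_neg (by simp), e1, e2]
    ring

lemma hasSum_stepKernel {s : ℝ} {ν : ℤ → ℝ} (hν : HasSum ν 1) (x : Vertex) :
    HasSum (stepKernel s ν x) 1 := by
  by_cases hx : x.2 = 0
  · have h := hasSum_stepKernel_line s ν hx (f := fun _ => 1) (by simpa using hν)
    simp only [mul_one] at h
    convert h using 1
    ring
  · have h := hasSum_stepKernel_off s ν hx (fun _ => 1)
    simp only [mul_one] at h
    convert h using 1
    norm_num

lemma stepKernel_nonneg {s : ℝ} (hs0 : 0 < s) (hs1 : s < 1) {ν : ℤ → ℝ} (hν : ∀ k, 0 ≤ ν k)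
    (x y : Vertex) : 0 ≤ stepKernel s ν x y := by
  have h1 : 0 ≤ 1 - s := by linarith
  have := hν (y.1 - x.1)
  unfold stepKernel
  split_ifs <;> positivity

lemma isReversible_stepKernel {s : ℝ} (hs0 : 0 < s) (hs1 : s < 1) {ν : ℤ → ℝ}
    (hν : IsStepLaw ν) : IsReversible (revMeasure s) (stepKernel s ν) where
  half_le x := by
    unfold revMeasure
    split_ifs
    · rw [div_le_div_iff₀ (by norm_num) (by positivity)]; linarith
    · norm_num
  bdd := ⟨1 / (2 * s) + 1, fun x => by
    have : 0 < 1 / (2 * s) := by positivity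
    unfold revMeasure
    split_ifs <;> linarith⟩
  nonneg := stepKernel_nonneg hs0 hs1 hν.nonneg
  hasSum := hasSum_stepKernel hν.hasSum
  symm x y := by
    have h1 : ν (y.1 - x.1) = ν (x.1 - y.1) := by rw [← hν.neg, neg_sub]
    -- The mass `1 / (2 s)` on the line gives its vertical edges the same conductance `1 / 4` as the
    -- edges elsewhere.
    have h2 : 1 / (2 * s) * (s / 2) = 1 / 4 := by field_simp; norm_num
    unfold revMeasure stepKernel
    rw [h1, latticeNbr_comm]
    split_ifs <;> simp only [mul_zero, one_mul, h2]

lemma stepKernel_shift (s : ℝ) (ν : ℤ → ℝ) (k : ℤ) (x y : Vertex) :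
    stepKernel s ν (x.1 + k, x.2) (y.1 + k, y.2) = stepKernel s ν x y := by
  have h : LatticeNbr (x.1 + k, x.2) (y.1 + k, y.2) ↔ LatticeNbr x y := by
    unfold LatticeNbr; omega
  by_cases hl : LatticeNbr x y
  · simp [stepKernel, hl, h.2 hl]
  · simp [stepKernel, hl, mt h.1 hl]

/-- The horizontal translation by two. -/
def shiftEquiv : Vertex ≃ Vertex where
  toFun x := (x.1 + 2, x.2)
  invFun x := (x.1 - 2, x.2)
  left_inv x := by simp
  right_inv x := by simp

/-- The action of the horizontal translation by two on summable functions. -/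
def shiftOp : summableFun Vertex →ₗ[ℝ] summableFun Vertex where
  toFun f := ⟨fun x => f.1 (shiftEquiv x), shiftEquiv.summable_iff.2 f.2⟩
  map_add' _ _ := rfl
  map_smul' _ _ := rfl

lemma shiftOp_apply (f : summableFun Vertex) (x : Vertex) :
    (shiftOp f).1 x = f.1 (x.1 + 2, x.2) := rfl

section

variable {s : ℝ} {ν : ℤ → ℝ}

lemma shiftOp_form (h : IsReversible (revMeasure s) (stepKernel s ν))
    (f g : summableFun Vertex) : h.form (shiftOp f) (shiftOp g) = h.form f g := by
  rw [h.form_apply, h.form_apply,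
    ← shiftEquiv.tsum_eq fun x => revMeasure s x * f.1 x * g.1 x]
  rfl

lemma commute_lazyOp_shiftOp (h : IsReversible (revMeasure s) (stepKernel s ν)) :
    Commute h.lazyOp shiftOp := by
  have h1 : Commute h.op shiftOp := by
    refine LinearMap.ext fun f => Subtype.ext (funext fun x => ?_)
    change kerApply (stepKernel s ν) (shiftOp f).1 x =
      kerApply (stepKernel s ν) f.1 (shiftEquiv x)
    rw [kerApply, kerApply,
      ← shiftEquiv.tsum_eq fun y => stepKernel s ν (shiftEquiv x) y * f.1 y]
    refine tsum_congr fun y => ?_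
    rw [← stepKernel_shift s ν 2 x y]
    rfl
  exact ((Commute.one_left _).add_left h1).smul_left _

lemma form_shiftOp_pow_point (h : IsReversible (revMeasure s) (stepKernel s ν)) (i : ℕ)
    (x : Vertex) (g : summableFun Vertex) :
    h.form ((shiftOp ^ i) (h.point x)) g = g.1 (x.1 - 2 * i, x.2) := by
  induction i generalizing x g with
  | zero => simp [h.form_point]
  | succ i ih =>
    have e : shiftOp (h.point x) = h.point (x.1 - 2, x.2) := by
      refine Subtype.ext (funext fun y => ?_)
      have h1 : (y.1 + 2, y.2) = x ↔ y = (x.1 - 2, x.2) := by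
        simp only [Prod.ext_iff]; omega
      by_cases hy : y = (x.1 - 2, x.2)
      · simp [shiftOp_apply, IsReversible.point, hy, revMeasure]
      · simp [shiftOp_apply, IsReversible.point, hy, h1]
    rw [pow_succ, Module.End.mul_apply, e, ih]
    have e2 : x.1 - 2 - 2 * (i : ℤ) = x.1 - 2 * ((i + 1 : ℕ) : ℤ) := by push_cast; ring
    simp only [e2]

/-! ### Energy estimates along translates. -/

/-- The lower bound on the horizontal conductances. -/
lemma exists_energy_ge_shift (hs1 : s < 1) (hν : IsStepLaw ν)
    (h : IsReversible (revMeasure s) (stepKernel s ν)) :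
    ∃ c : ℝ, 0 < c ∧ c ≤ 1 ∧ ∀ f : summableFun Vertex,
      c * (h.form (f - shiftOp f) (f - shiftOp f) / 4) ≤
        h.form f f - h.form (h.lazyOp f) f := by
  have hc : 0 < (1 - s) * ν 2 := mul_pos (by linarith) hν.two_pos
  refine ⟨min (1 / 4) ((1 - s) * ν 2), lt_min (by norm_num) hc,
    (min_le_left _ _).trans (by norm_num), fun f => ?_⟩
  set c := min (1 / 4) ((1 - s) * ν 2) with hcdef
  -- Horizontal steps by two are available everywhere: with probability `1 / 4` off the line and `(1
  -- - s) * ν 2` on it.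
  have hQ : ∀ x : Vertex, c ≤ stepKernel s ν x (shiftEquiv x) := by
    intro x
    by_cases hx : x.2 = 0
    · refine (min_le_right _ _).trans (le_of_eq ?_)
      simp [stepKernel, shiftEquiv, hx]
    · refine (min_le_left _ _).trans (le_of_eq ?_)
      simp [stepKernel, shiftEquiv, hx, latticeNbr_iff]
  have h1 : c * h.form (f - shiftOp f) (f - shiftOp f) ≤
      4 * (h.form f f - h.form (h.lazyOp f) f) := by
    rw [h.form_apply, ← tsum_mul_left]
    refine Real.tsum_le_of_sum_le (fun x => ?_) fun t => ?_
    · have := (h.pi_pos x).le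
      have hc0 : 0 ≤ c := (lt_min (by norm_num) hc).le
      rw [mul_assoc (revMeasure s x)]
      exact mul_nonneg hc0 (mul_nonneg this (mul_self_nonneg _))
    · refine le_trans (Finset.sum_le_sum fun x _ => ?_)
        (h.sum_edges_le_energy f (e := fun x => (x, shiftEquiv x))
          (fun x y hxy => (Prod.ext_iff.1 hxy).1) t)
      have h2 := mul_le_mul_of_nonneg_left (hQ x) (h.pi_pos x).le
      change c * (revMeasure s x * (f.1 x - f.1 (shiftEquiv x)) *
        (f.1 x - f.1 (shiftEquiv x))) ≤ _
      nlinarith [sq_nonneg (f.1 x - f.1 (shiftEquiv x))]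
  linarith

lemma injective_shift_left (x : Vertex) :
    Function.Injective fun i : ℕ => ((x.1 - 2 * (i : ℤ), x.2) : Vertex) := fun i j hij => by
  simpa using hij

/-- The differences along the translates of an edge are controlled by the energy. -/
lemma sum_form_edge_le (h : IsReversible (revMeasure s) (stepKernel s ν)) {x y : Vertex}
    (hxy : 0 < stepKernel s ν x y) (k : ℕ) (g : summableFun Vertex) :
    ∑ i ∈ Finset.range (k + 1),
      (h.form ((shiftOp ^ i) (h.point x - h.point y)) g) ^ 2 ≤
      4 / (revMeasure s x * stepKernel s ν x y) *
        (h.form g g - h.form (h.lazyOp g) g) + 0 * h.form g g := by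
  have hc : 0 < revMeasure s x * stepKernel s ν x y := mul_pos (h.pi_pos x) hxy
  have h1 := h.sum_edges_le_energy g
    (e := fun i : ℕ => (((x.1 - 2 * (i : ℤ), x.2) : Vertex), ((y.1 - 2 * (i : ℤ), y.2) : Vertex)))
    (fun i j hij => injective_shift_left x (Prod.ext_iff.1 hij).1) (Finset.range (k + 1))
  have h2 : ∀ i : ℕ, stepKernel s ν (x.1 - 2 * (i : ℤ), x.2) (y.1 - 2 * (i : ℤ), y.2) =
      stepKernel s ν x y := fun i => by
    have := stepKernel_shift s ν (-(2 * (i : ℤ))) x y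
    simpa only [← sub_eq_add_neg] using this
  have h3 : ∀ i : ℕ, revMeasure s (x.1 - 2 * (i : ℤ), x.2) = revMeasure s x := fun i => rfl
  simp only [h2, h3, ← Finset.mul_sum] at h1
  simp only [map_sub, LinearMap.sub_apply, form_shiftOp_pow_point]
  rw [zero_mul, add_zero, div_mul_eq_mul_div, le_div_iff₀ hc]
  linarith

lemma revMeasure_mul_stepKernel_up (hs0 : 0 < s) (x : Vertex) :
    revMeasure s x * stepKernel s ν x (x.1, x.2 + 1) = 1 / 4 := by
  have hn : LatticeNbr x (x.1, x.2 + 1) := by simp [latticeNbr_iff]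
  by_cases hx : x.2 = 0
  · have h1 : x.2 + 1 ≠ 0 := by omega
    rw [revMeasure, stepKernel, if_pos hx, if_pos hx, if_neg h1, if_pos hn]
    field_simp
    norm_num
  · simp [revMeasure, stepKernel, hx, hn]

/-- A one dimensional inequality of Agmon type on the translates of a vertical line. -/
lemma sum_form_point_le (hs0 : 0 < s) (h : IsReversible (revMeasure s) (stepKernel s ν))
    (x : Vertex) {l : ℕ} (hl : 0 < l) (k : ℕ) (g : summableFun Vertex) :
    ∑ i ∈ Finset.range (k + 1), (h.form ((shiftOp ^ i) (h.point x)) g) ^ 2 ≤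
      32 * l * (h.form g g - h.form (h.lazyOp g) g) + 4 / l * h.form g g := by
  simp only [form_shiftOp_pow_point]
  set v : ℕ → ℕ → ℝ := fun i m => g.1 (x.1 - 2 * (i : ℤ), x.2 + (m : ℤ)) with hv
  have hl0 : (0 : ℝ) < l := by exact_mod_cast hl
  have hinj : Function.Injective fun p : ℕ × ℕ =>
      ((x.1 - 2 * (p.1 : ℤ), x.2 + (p.2 : ℤ)) : Vertex) := by
    rintro ⟨i, m⟩ ⟨i', m'⟩ hp
    simp only [Prod.mk.injEq] at hp ⊢
    omega
  have h1 : ∑ i ∈ Finset.range (k + 1), ∑ m ∈ Finset.range l, (v i m - v i (m + 1)) ^ 2 ≤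
      16 * (h.form g g - h.form (h.lazyOp g) g) := by
    have := h.sum_edges_le_energy g
      (e := fun p : ℕ × ℕ => (((x.1 - 2 * (p.1 : ℤ), x.2 + (p.2 : ℤ)) : Vertex),
        ((x.1 - 2 * (p.1 : ℤ), x.2 + (p.2 : ℤ) + 1) : Vertex)))
      (fun p q hpq => hinj (Prod.ext_iff.1 hpq).1) (Finset.range (k + 1) ×ˢ Finset.range l)
    rw [Finset.sum_product] at this
    have e : ∀ i m : ℕ, revMeasure s (x.1 - 2 * (i : ℤ), x.2 + (m : ℤ)) *
        stepKernel s ν (x.1 - 2 * (i : ℤ), x.2 + (m : ℤ))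
          (x.1 - 2 * (i : ℤ), x.2 + (m : ℤ) + 1) = 1 / 4 := fun i m =>
      revMeasure_mul_stepKernel_up hs0 _
    simp only [e, ← Finset.mul_sum] at this
    have e2 : ∀ i m, v i (m + 1) = g.1 (x.1 - 2 * (i : ℤ), x.2 + (m : ℤ) + 1) := fun i m => by
      simp only [hv]; push_cast; rw [add_assoc]
    simp only [e2]
    linarith
  have h2 : ∑ i ∈ Finset.range (k + 1), ∑ m ∈ Finset.range l, v i m ^ 2 ≤
      2 * h.form g g := by
    have := h.sum_sq_le_form g hinj (Finset.range (k + 1) ×ˢ Finset.range l)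
    rwa [Finset.sum_product] at this
  -- In each column, compare the bottom value with the one at height `m` by telescoping, then sum
  -- over the `l` heights `m`. A large `l` reduces the contribution of the norm at the cost of more
  -- energy.
  have h3 : ∀ i, (l : ℝ) * v i 0 ^ 2 ≤
      2 * (l * (l * ∑ m ∈ Finset.range l, (v i m - v i (m + 1)) ^ 2)) +
        2 * ∑ m ∈ Finset.range l, v i m ^ 2 := by
    intro i
    have h4 : ∀ m ∈ Finset.range l, v i 0 ^ 2 ≤
        2 * (l * ∑ m ∈ Finset.range l, (v i m - v i (m + 1)) ^ 2) + 2 * v i m ^ 2 := by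
      intro m hm
      have h5 : v i 0 - v i m = ∑ j ∈ Finset.range m, (v i j - v i (j + 1)) :=
        (Finset.sum_range_sub' _ _).symm
      have h6 : (v i 0 - v i m) ^ 2 ≤ l * ∑ m ∈ Finset.range l, (v i m - v i (m + 1)) ^ 2 := by
        have hml : m ≤ l := (Finset.mem_range.1 hm).le
        rw [h5]
        refine (sq_sum_le_card_mul_sum_sq).trans ?_
        rw [Finset.card_range]
        gcongr
      nlinarith [sq_nonneg (v i 0 - 2 * v i m)]
    have h7 := Finset.sum_le_sum h4
    rw [Finset.sum_const, Finset.card_range, nsmul_eq_mul, Finset.sum_add_distrib,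
      Finset.sum_const, Finset.card_range, nsmul_eq_mul, ← Finset.mul_sum] at h7
    linarith
  have h8 := Finset.sum_le_sum fun i (_ : i ∈ Finset.range (k + 1)) => h3 i
  simp only [← Finset.mul_sum, Finset.sum_add_distrib] at h8
  have h9 : ∀ i : ℕ, g.1 (x.1 - 2 * (i : ℤ), x.2) = v i 0 := fun i => by simp [hv]
  simp only [h9]
  have h10 : (l : ℝ) * ∑ i ∈ Finset.range (k + 1), v i 0 ^ 2 ≤
      l * (32 * l * (h.form g g - h.form (h.lazyOp g) g) + 4 / l * h.form g g) := by
    have e : l * (32 * l * (h.form g g - h.form (h.lazyOp g) g) + 4 / l * h.form g g) =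
        2 * (l * (l * (16 * (h.form g g - h.form (h.lazyOp g) g)))) + 2 * (2 * h.form g g) := by
      field_simp
      ring
    rw [e]
    refine h8.trans ?_
    gcongr
  exact le_of_mul_le_mul_left h10 hl0

/-! ### Heat kernel and gradient decay. -/

/-- On-diagonal decay of the heat kernel. -/
lemma exists_norm_pow_point_le (hs0 : 0 < s) (hs1 : s < 1) (hν : IsStepLaw ν)
    (h : IsReversible (revMeasure s) (stepKernel s ν)) :
    ∃ C : ℝ, 0 < C ∧ ∀ (n : ℕ) (x : Vertex),
      h.form ((h.lazyOp ^ n) (h.point x)) ((h.lazyOp ^ n) (h.point x)) ≤ C / (n + 1) := by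
  obtain ⟨c, hc0, hc1, hc⟩ := exists_energy_ge_shift hs1 hν h
  refine ⟨136 / √c, by positivity, fun n x => ?_⟩
  set m := n / 2 with hm
  have hmono := h.isLazyFor.norm_pow_antitone (h.point x) (show 2 * m ≤ n by omega)
  refine hmono.trans ?_
  -- The choice of order `√m` balances `32 l / (m + 1)` against `4 / l`. Both are then of order `1 /
  -- √m`, and the further factor `1 / √m` of the abstract bound gives `1 / m`.
  set l := Nat.sqrt m + 1 with hl
  have hl0 : 0 < l := Nat.succ_pos _
  set q := √((m : ℝ) + 1) with hq
  have hq1 : 1 ≤ q := Real.one_le_sqrt.2 (by linarith [(Nat.cast_nonneg m : (0 : ℝ) ≤ m)])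
  have hq2 : q ^ 2 = m + 1 := Real.sq_sqrt (by positivity)
  have hl1 : q ≤ l := by
    refine Real.sqrt_le_iff.2 ⟨by positivity, ?_⟩
    have := Nat.succ_le_succ_sqrt m
    have h2 : m + 1 ≤ l ^ 2 := by rw [sq]; exact this
    exact_mod_cast h2
  have hl2 : (l : ℝ) ≤ 2 * q := by
    have h2 : (Nat.sqrt m : ℝ) ≤ q := by
      refine Real.le_sqrt_of_sq_le ?_
      have : Nat.sqrt m ^ 2 ≤ m + 1 := (Nat.sqrt_le' m).trans (Nat.le_succ m)
      exact_mod_cast this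
    rw [hl]; push_cast; linarith
  have h1 := h.isLazyFor.norm_pow_two_mul_le hc0 hc1 (commute_lazyOp_shiftOp h)
    (fun f => shiftOp_form h f f) hc (a := 32 * l) (b := 4 / l) (by positivity) (by positivity)
    (sum_form_point_le hs0 h x hl0) m
  refine h1.trans ?_
  have hn : ((n : ℝ) + 1) ≤ 2 * q ^ 2 := by
    rw [hq2]
    have : n + 1 ≤ 2 * (m + 1) := by omega
    exact_mod_cast this
  rw [Real.sqrt_mul hc0.le, ← hq, ← hq2]
  have hq0 : 0 < q := by linarith
  have hcs : 0 < √c := Real.sqrt_pos.2 hc0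
  calc (32 * l / q ^ 2 + 4 / l) / (√c * q)
      ≤ (32 * (2 * q) / q ^ 2 + 4 / q) / (√c * q) := by gcongr
    _ = 136 / √c / (2 * q ^ 2) := by field_simp; ring
    _ ≤ 136 / √c / (n + 1) := by gcongr

/-- Pairing the translates of this vector with `g` gives differences of `g` along distinct edges,
controlled by the energy alone. So the abstract bound applies with `b = 0`, and the energy
contributes a full factor `1 / n`. -/
lemma exists_norm_pow_edge_le (hs1 : s < 1) (hν : IsStepLaw ν)
    (h : IsReversible (revMeasure s) (stepKernel s ν)) {x y : Vertex}
    (hxy : 0 < stepKernel s ν x y) :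
    ∃ C : ℝ, ∀ n : ℕ, h.form ((h.lazyOp ^ n) (h.point x - h.point y))
      ((h.lazyOp ^ n) (h.point x - h.point y)) ≤ C / ((n + 1) * √(n + 1)) := by
  obtain ⟨c, hc0, hc1, hc⟩ := exists_energy_ge_shift hs1 hν h
  set a := 4 / (revMeasure s x * stepKernel s ν x y) with ha
  have ha0 : 0 ≤ a := by have := h.pi_pos x; positivity
  refine ⟨4 * a / √c, fun n => ?_⟩
  set m := n / 2 with hm
  refine (h.isLazyFor.norm_pow_antitone (h.point x - h.point y)
    (show 2 * m ≤ n by omega)).trans ?_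
  refine (h.isLazyFor.norm_pow_two_mul_le hc0 hc1 (commute_lazyOp_shiftOp h)
    (fun f => shiftOp_form h f f) hc (a := a) (b := 0) ha0 le_rfl
    (sum_form_edge_le h hxy) m).trans ?_
  have hn : ((n : ℝ) + 1) ≤ 2 * (m + 1) := by
    have : n + 1 ≤ 2 * (m + 1) := by omega
    exact_mod_cast this
  have hcs : 0 < √c := Real.sqrt_pos.2 hc0
  have hn2 : √((n : ℝ) + 1) ≤ 2 * √(m + 1) := by
    refine Real.sqrt_le_iff.2 ⟨by positivity, ?_⟩
    rw [mul_pow, Real.sq_sqrt (by positivity)]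
    linarith [(Nat.cast_nonneg m : (0 : ℝ) ≤ m)]
  rw [add_zero, Real.sqrt_mul hc0.le]
  calc a / (m + 1) / (√c * √(m + 1)) = 4 * a / √c / ((2 * (m + 1)) * (2 * √(m + 1))) := by
        field_simp; ring
    _ ≤ _ := by gcongr

/-- Decay of the gradient of the heat kernel, for any two vertices. -/
lemma exists_norm_pow_sub_le (hs0 : 0 < s) (hs1 : s < 1) (hν : IsStepLaw ν)
    (h : IsReversible (revMeasure s) (stepKernel s ν)) (x y : Vertex) :
    ∃ C : ℝ, ∀ n : ℕ, h.form ((h.lazyOp ^ n) (h.point x - h.point y))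
      ((h.lazyOp ^ n) (h.point x - h.point y)) ≤ C / ((n + 1) * √(n + 1)) := by
  set R : Vertex → Vertex → Prop := fun x y => ∃ C : ℝ, ∀ n : ℕ,
    h.form ((h.lazyOp ^ n) (h.point x - h.point y))
      ((h.lazyOp ^ n) (h.point x - h.point y)) ≤ C / ((n + 1) * √(n + 1)) with hR
  -- The squared norm of a sum is at most twice the sum of the squared norms, so the decay rate
  -- passes along paths.
  have htrans : ∀ {x y z}, R x y → R y z → R x z := by
    rintro x y z ⟨C, hC⟩ ⟨C', hC'⟩
    refine ⟨2 * (C + C'), fun n => ?_⟩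
    have e : h.point x - h.point z = (h.point x - h.point y) + (h.point y - h.point z) := by abel
    set u := (h.lazyOp ^ n) (h.point x - h.point y) with hu
    set w := (h.lazyOp ^ n) (h.point y - h.point z) with hw
    have h1 := h.form_self_nonneg (u - w)
    have h2 : h.form u u ≤ _ := hC n
    have h3 : h.form w w ≤ _ := hC' n
    rw [e, map_add]
    change h.form (u + w) (u + w) ≤ _
    clear_value u w
    simp only [map_add, map_sub, LinearMap.add_apply, LinearMap.sub_apply] at h1 ⊢
    rw [mul_div_assoc, add_div]
    linarith
  have hsymm : ∀ {x y}, R x y → R y x := by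
    rintro x y ⟨C, hC⟩
    refine ⟨C, fun n => ?_⟩
    have e : h.point y - h.point x = -(h.point x - h.point y) := by abel
    rw [e, map_neg, map_neg, map_neg, LinearMap.neg_apply, neg_neg]
    exact hC n
  have hrefl : ∀ x, R x x := fun x => ⟨0, fun n => by simp⟩
  have hup : ∀ x : Vertex, R x (x.1, x.2 + 1) := fun x => by
    refine exists_norm_pow_edge_le hs1 hν h ?_
    have := revMeasure_mul_stepKernel_up (ν := ν) hs0 x
    have h2 := h.pi_pos x
    by_contra hcon
    nlinarith
  have hvert : ∀ (u : ℤ) (j : ℤ), R (u, j) (u, 0) := by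
    intro u j
    induction j using Int.induction_on with
    | zero => exact hrefl _
    | succ i ih => exact htrans (hsymm (hup (u, i))) ih
    | pred i ih =>
      refine htrans ?_ ih
      have := hup (u, -(i : ℤ) - 1)
      simpa using this
  -- The two classes communicate only through odd steps along the line; this is where `ν 1 > 0` is
  -- needed.
  have hright : ∀ u : ℤ, R (u, 0) (u + 1, 0) := fun u => by
    refine exists_norm_pow_edge_le hs1 hν h ?_
    simp only [stepKernel, if_true]
    rw [add_sub_cancel_left]
    exact mul_pos (by linarith) hν.one_pos
  have hhor : ∀ u : ℤ, R (u, 0) (0, 0) := by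
    intro u
    induction u using Int.induction_on with
    | zero => exact hrefl _
    | succ i ih => exact htrans (hsymm (hright i)) ih
    | pred i ih =>
      refine htrans ?_ ih
      have := hright (-(i : ℤ) - 1)
      simpa using this
  exact htrans (htrans (hvert x.1 x.2) (hhor x.1))
    (hsymm (htrans (hvert y.1 y.2) (hhor y.1)))

lemma lazyOp_pow_apply (h : IsReversible (revMeasure s) (stepKernel s ν)) (n : ℕ)
    (g : summableFun Vertex) :
    ((h.lazyOp ^ n) g).1 = (kerApply (lazyKernel (stepKernel s ν)))^[n] g.1 := by
  induction n with
  | zero => simp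
  | succ n ih =>
    rw [pow_succ', Module.End.mul_apply, Function.iterate_succ_apply', ← ih]
    set f := (h.lazyOp ^ n) g
    funext x
    rw [h.lazyOp_apply]
    change (1 / 2 : ℝ) * (f.1 x + kerApply _ f.1 x) = _
    have h1 : HasSum (fun y => (if x = y then 1 else 0) * f.1 y) (f.1 x) := by
      convert hasSum_ite_eq x (f.1 x) using 2 with y
      by_cases hy : x = y
      · simp [hy]
      · simp [hy, Ne.symm hy]
    have h2 := ((h1.add (h.summable_row f x).hasSum).div_const 2).tsum_eq
    rw [kerApply, kerApply, one_div_mul_eq_div, ← h2]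
    refine tsum_congr fun y => ?_
    rw [lazyKernel]
    ring

lemma nStep_eq_iterate (K : Vertex → Vertex → ℝ) (n : ℕ) (o x : Vertex) :
    nStep K n x o = (kerApply K)^[n] (fun y => if y = o then 1 else 0) x := by
  induction n generalizing x with
  | zero => rfl
  | succ n ih =>
    rw [Function.iterate_succ_apply', nStep, kerApply]
    exact tsum_congr fun y => by rw [ih]

lemma nStep_lazy_eq (h : IsReversible (revMeasure s) (stepKernel s ν)) (n : ℕ) (o x : Vertex) :
    nStep (lazyKernel (stepKernel s ν)) n x o =
      revMeasure s o * h.form (h.point x) ((h.lazyOp ^ n) (h.point o)) := by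
  have e : (fun y => if y = o then (1 : ℝ) else 0) = (revMeasure s o • h.point o).1 := by
    funext y
    change _ = revMeasure s o * (h.point o).1 y
    by_cases hy : y = o
    · simp [hy, IsReversible.point, (h.pi_pos o).ne']
    · simp [hy, IsReversible.point]
  rw [nStep_eq_iterate, e, ← lazyOp_pow_apply h, ← h.form_point, map_smul, map_smul, smul_eq_mul]

/-- The uniform heat kernel bound. -/
theorem exists_nStep_lazy_le (hs0 : 0 < s) (hs1 : s < 1) (hν : IsStepLaw ν) :
    ∃ C : ℝ, 0 < C ∧ ∀ (n : ℕ) (x y : Vertex),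
      nStep (lazyKernel (stepKernel s ν)) n x y ≤ C / (n + 1) := by
  have h := isReversible_stepKernel hs0 hs1 hν
  obtain ⟨C, hC0, hC⟩ := exists_norm_pow_point_le hs0 hs1 hν h
  obtain ⟨M, hM⟩ := h.bdd
  have hM0 : 0 < M := (h.pi_pos 0).trans_le (hM 0)
  refine ⟨2 * M * C, by positivity, fun n x y => ?_⟩
  rw [nStep_lazy_eq h]
  set a := n / 2 with ha
  set b := n - n / 2 with hb
  have hab : n = a + b := by omega
  -- Give half of the time to each point mass; Cauchy–Schwarz then reduces everything to the
  -- on-diagonal bound.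
  have h1 : h.form (h.point x) ((h.lazyOp ^ n) (h.point y)) =
      h.form ((h.lazyOp ^ a) (h.point x)) ((h.lazyOp ^ b) (h.point y)) := by
    rw [h.isLazyFor.pow_selfAdjoint, hab, pow_add, Module.End.mul_apply]
  have ha2 : ((n : ℝ) + 1) / 2 ≤ a + 1 := by
    have : n + 1 ≤ 2 * (a + 1) := by omega
    have : ((n : ℝ) + 1) ≤ 2 * (a + 1) := by exact_mod_cast this
    linarith
  have hb2 : ((n : ℝ) + 1) / 2 ≤ b + 1 := by
    have : n + 1 ≤ 2 * (b + 1) := by omega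
    have : ((n : ℝ) + 1) ≤ 2 * (b + 1) := by exact_mod_cast this
    linarith
  have hA : h.form ((h.lazyOp ^ a) (h.point x)) ((h.lazyOp ^ a) (h.point x)) ≤
      C / (((n : ℝ) + 1) / 2) := (hC a x).trans (by gcongr)
  have hB : h.form ((h.lazyOp ^ b) (h.point y)) ((h.lazyOp ^ b) (h.point y)) ≤
      C / (((n : ℝ) + 1) / 2) := (hC b y).trans (by gcongr)
  have h2 := h.form_sq_le ((h.lazyOp ^ a) (h.point x)) ((h.lazyOp ^ b) (h.point y))
  have h3 : h.form ((h.lazyOp ^ a) (h.point x)) ((h.lazyOp ^ b) (h.point y)) ≤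
      C / (((n : ℝ) + 1) / 2) := by
    refine (abs_le_of_sq_le_sq' (h2.trans ?_) (by positivity)).2
    rw [sq]
    exact mul_le_mul hA hB (h.form_self_nonneg _) (by positivity)
  rw [h1]
  have h4 : 0 ≤ C / (((n : ℝ) + 1) / 2) := by positivity
  calc _ ≤ revMeasure s y * (C / (((n : ℝ) + 1) / 2)) := by
        gcongr; exact (h.pi_pos y).le
    _ ≤ M * (C / (((n : ℝ) + 1) / 2)) := by gcongr; exact hM y
    _ = _ := by field_simp

/-- The gradient bound for the lazy semigroup. -/
theorem exists_iterate_sub_sq_le (hs0 : 0 < s) (hs1 : s < 1) (hν : IsStepLaw ν)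
    (h : IsReversible (revMeasure s) (stepKernel s ν)) (x y : Vertex) :
    ∃ C : ℝ, 0 ≤ C ∧ ∀ (n : ℕ) (g : summableFun Vertex),
      (((h.lazyOp ^ n) g).1 x - ((h.lazyOp ^ n) g).1 y) ^ 2 ≤
        C / ((n + 1) * √(n + 1)) * h.form g g := by
  obtain ⟨C, hC⟩ := exists_norm_pow_sub_le hs0 hs1 hν h x y
  have hC0 : 0 ≤ C := by
    have := (h.form_self_nonneg _).trans (hC 0)
    simpa using this
  refine ⟨C, hC0, fun n g => ?_⟩
  have e : ((h.lazyOp ^ n) g).1 x - ((h.lazyOp ^ n) g).1 y =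
      h.form ((h.lazyOp ^ n) (h.point x - h.point y)) g := by
    rw [h.isLazyFor.pow_selfAdjoint, map_sub, LinearMap.sub_apply, h.form_point, h.form_point]
  rw [e]
  exact (h.form_sq_le _ _).trans (mul_le_mul_of_nonneg_right (hC n) (h.form_self_nonneg g))

/-- The series that defines the potential kernel converges. -/
theorem summable_lazyPotential (hs0 : 0 < s) (hs1 : s < 1) (hν : IsStepLaw ν) (x o : Vertex) :
    Summable fun t : ℕ => nStep (lazyKernel (stepKernel s ν)) t o o -
      nStep (lazyKernel (stepKernel s ν)) t x o := by
  have h := isReversible_stepKernel hs0 hs1 hν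
  obtain ⟨C, hC0, hC⟩ := exists_norm_pow_point_le hs0 hs1 hν h
  obtain ⟨D, hD0, hD⟩ := exists_iterate_sub_sq_le hs0 hs1 hν h o x
  set m := revMeasure s o
  have hm : 0 < m := h.pi_pos o
  -- Split the time in halves: the gradient bound gives `t ^ (-3 / 2)` and the squared norm of the
  -- remaining half `t ^ (-1)`. The square of the term is of order `t ^ (-5 / 2)`, whence the
  -- summable exponent `5 / 4`.
  have hbound : ∀ t : ℕ, ‖nStep (lazyKernel (stepKernel s ν)) t o o -
      nStep (lazyKernel (stepKernel s ν)) t x o‖ ≤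
      m * √(D * C * 8) * (((t + 1 : ℕ) : ℝ) ^ (5 / 4 : ℝ))⁻¹ := by
    intro t
    set a := t / 2 with ha
    set b := t - t / 2 with hb
    have hab : t = a + b := by omega
    rw [nStep_lazy_eq h, nStep_lazy_eq h, ← mul_sub, norm_mul, Real.norm_of_nonneg hm.le,
      h.form_point, h.form_point, mul_assoc]
    refine mul_le_mul_of_nonneg_left ?_ hm.le
    have h1 := hD a ((h.lazyOp ^ b) (h.point o))
    rw [← Module.End.mul_apply, ← pow_add, ← hab] at h1
    have h2 := hC b o
    have ha2 : ((t : ℝ) + 1) / 2 ≤ a + 1 := by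
      have : t + 1 ≤ 2 * (a + 1) := by omega
      have : ((t : ℝ) + 1) ≤ 2 * (a + 1) := by exact_mod_cast this
      linarith
    have hb2 : ((t : ℝ) + 1) / 2 ≤ b + 1 := by
      have : t + 1 ≤ 2 * (b + 1) := by omega
      have : ((t : ℝ) + 1) ≤ 2 * (b + 1) := by exact_mod_cast this
      linarith
    have ha3 : √((t : ℝ) + 1) / 2 ≤ √(a + 1) := by
      refine Real.le_sqrt_of_sq_le ?_
      rw [div_pow, Real.sq_sqrt (by positivity)]
      linarith [(Nat.cast_nonneg t : (0 : ℝ) ≤ t)]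
    refine abs_le_of_sq_le_sq (h1.trans ?_) (by positivity)
    rw [mul_pow, Real.sq_sqrt (by positivity), inv_pow]
    have e : (((t + 1 : ℕ) : ℝ) ^ (5 / 4 : ℝ)) ^ 2 = (t + 1) ^ 2 * √(t + 1) := by
      rw [← Real.rpow_natCast, ← Real.rpow_mul (by positivity), Real.sqrt_eq_rpow,
        ← Real.rpow_natCast ((t : ℝ) + 1), ← Real.rpow_add (by positivity)]
      norm_num
    rw [e]
    calc D / ((a + 1) * √(a + 1)) * _ ≤
        D / (((t : ℝ) + 1) / 2 * (√(t + 1) / 2)) * (C / (((t : ℝ) + 1) / 2)) := by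
          refine mul_le_mul (by gcongr) (h2.trans (by gcongr)) (h.form_self_nonneg _)
            (by positivity)
      _ = D * C * 8 * ((t + 1) ^ 2 * √(t + 1))⁻¹ := by field_simp; norm_num
  refine Summable.of_norm_bounded (Summable.mul_left _ ?_) hbound
  exact (summable_nat_add_iff 1).2 (Real.summable_nat_rpow_inv.2 (by norm_num))

end

/-! ### Substochastic kernels -/

/-- Bounded functions. -/
def IsBddFun {V : Type*} (f : V → ℝ) : Prop := ∃ M, ∀ x, |f x| ≤ M

namespace IsBddFun

variable {V : Type*} {f g : V → ℝ}

lemma const (c : ℝ) : IsBddFun (fun _ : V => c) := ⟨|c|, fun _ => le_rfl⟩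

lemma add (hf : IsBddFun f) (hg : IsBddFun g) : IsBddFun fun x => f x + g x := by
  obtain ⟨M, hM⟩ := hf
  obtain ⟨N, hN⟩ := hg
  exact ⟨M + N, fun x => (abs_add_le _ _).trans (add_le_add (hM x) (hN x))⟩

lemma const_mul (c : ℝ) (hf : IsBddFun f) : IsBddFun fun x => c * f x := by
  obtain ⟨M, hM⟩ := hf
  exact ⟨|c| * M, fun x => by rw [abs_mul]; gcongr; exact hM x⟩

lemma sub (hf : IsBddFun f) (hg : IsBddFun g) : IsBddFun fun x => f x - g x := by
  simpa [sub_eq_add_neg] using hf.add (hg.const_mul (-1))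

lemma of_nonneg_of_le {M : ℝ} (h0 : ∀ x, 0 ≤ f x) (h1 : ∀ x, f x ≤ M) : IsBddFun f :=
  ⟨M, fun x => by rw [abs_of_nonneg (h0 x)]; exact h1 x⟩

lemma sum {ι : Type*} (s : Finset ι) {F : ι → V → ℝ} (h : ∀ i ∈ s, IsBddFun (F i)) :
    IsBddFun fun x => ∑ i ∈ s, F i x := by
  classical
  induction s using Finset.induction_on with
  | empty => simpa using const (V := V) 0
  | insert i s hi ih =>
    simp only [Finset.sum_insert hi]
    exact (h i (by simp)).add (ih fun j hj => h j (by simp [hj]))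

end IsBddFun

/-- The rows of the kernel are nonnegative, with total mass at most one. -/
structure IsSubstochastic {V : Type*} (K : V → V → ℝ) : Prop where
  nonneg : ∀ x y, 0 ≤ K x y
  summable : ∀ x, Summable (K x)
  sum_le_one : ∀ x, ∑' y, K x y ≤ 1

namespace IsSubstochastic

variable {V : Type*} {K L : V → V → ℝ} {f g : V → ℝ}

lemma summable_mul (hK : IsSubstochastic K) (hf : IsBddFun f) (x : V) :
    Summable fun y => K x y * f y := by
  obtain ⟨M, hM⟩ := hf
  refine Summable.of_norm_bounded ((hK.summable x).mul_right M) fun y => ?_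
  rw [Real.norm_eq_abs, abs_mul, abs_of_nonneg (hK.nonneg x y)]
  exact mul_le_mul_of_nonneg_left (hM y) (hK.nonneg x y)

lemma kerApply_mono_of_le (hK : IsSubstochastic K) (hL : IsSubstochastic L)
    (hf : IsBddFun f) (hg : IsBddFun g) {x : V} (h : ∀ y, K x y * f y ≤ L x y * g y) :
    kerApply K f x ≤ kerApply L g x :=
  (hK.summable_mul hf x).tsum_le_tsum h (hL.summable_mul hg x)

lemma kerApply_mono (hK : IsSubstochastic K) (hf : IsBddFun f) (hg : IsBddFun g)
    (h : ∀ y, f y ≤ g y) (x : V) : kerApply K f x ≤ kerApply K g x :=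
  hK.kerApply_mono_of_le hK hf hg fun y => mul_le_mul_of_nonneg_left (h y) (hK.nonneg x y)

lemma kerApply_add (hK : IsSubstochastic K) (hf : IsBddFun f) (hg : IsBddFun g) (x : V) :
    kerApply K (fun y => f y + g y) x = kerApply K f x + kerApply K g x := by
  rw [kerApply, kerApply, kerApply, ← (hK.summable_mul hf x).tsum_add (hK.summable_mul hg x)]
  exact tsum_congr fun y => by ring

lemma kerApply_const_mul (K : V → V → ℝ) (c : ℝ) (f : V → ℝ) (x : V) :
    kerApply K (fun y => c * f y) x = c * kerApply K f x := by
  rw [kerApply, kerApply, ← tsum_mul_left]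
  exact tsum_congr fun y => by ring

lemma kerApply_sub (hK : IsSubstochastic K) (hf : IsBddFun f) (hg : IsBddFun g) (x : V) :
    kerApply K (fun y => f y - g y) x = kerApply K f x - kerApply K g x := by
  rw [kerApply, kerApply, kerApply, ← (hK.summable_mul hf x).tsum_sub (hK.summable_mul hg x)]
  exact tsum_congr fun y => by ring

lemma kerApply_nonneg (hK : IsSubstochastic K) (h : ∀ y, 0 ≤ f y) (x : V) :
    0 ≤ kerApply K f x :=
  tsum_nonneg fun y => mul_nonneg (hK.nonneg x y) (h y)

lemma kerApply_le (hK : IsSubstochastic K) (hf : IsBddFun f) {M : ℝ} (hM : 0 ≤ M)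
    (h : ∀ y, f y ≤ M) (x : V) : kerApply K f x ≤ M := by
  refine (hK.kerApply_mono hf (IsBddFun.const M) h x).trans ?_
  rw [kerApply, tsum_mul_right]
  exact mul_le_of_le_one_left hM (hK.sum_le_one x)

lemma isBddFun_kerApply (hK : IsSubstochastic K) (hf : IsBddFun f) :
    IsBddFun (kerApply K f) := by
  obtain ⟨M, hM⟩ := hf
  by_cases hV : Nonempty V
  · have hM0 : 0 ≤ M := (abs_nonneg _).trans (hM hV.some)
    refine ⟨M, fun x => abs_le.2 ⟨?_, ?_⟩⟩
    · have h1 := hK.kerApply_le (IsBddFun.const_mul (-1) ⟨M, hM⟩) hM0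
        (fun y => by linarith [(abs_le.1 (hM y)).1]) x
      rw [kerApply_const_mul] at h1
      linarith
    · exact hK.kerApply_le ⟨M, hM⟩ hM0 (fun y => (abs_le.1 (hM y)).2) x
  · exact ⟨0, fun x => (hV ⟨x⟩).elim⟩

lemma isBddFun_iterate (hK : IsSubstochastic K) (hf : IsBddFun f) (n : ℕ) :
    IsBddFun ((kerApply K)^[n] f) := by
  induction n with
  | zero => exact hf
  | succ n ih => rw [Function.iterate_succ_apply']; exact hK.isBddFun_kerApply ih

lemma iterate_nonneg (hK : IsSubstochastic K) (h : ∀ y, 0 ≤ f y) (n : ℕ) (x : V) :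
    0 ≤ (kerApply K)^[n] f x := by
  induction n generalizing x with
  | zero => exact h x
  | succ n ih => rw [Function.iterate_succ_apply']; exact hK.kerApply_nonneg ih x

lemma iterate_mono (hK : IsSubstochastic K) (hf : IsBddFun f) (hg : IsBddFun g)
    (h : ∀ y, f y ≤ g y) (n : ℕ) (x : V) : (kerApply K)^[n] f x ≤ (kerApply K)^[n] g x := by
  induction n generalizing x with
  | zero => exact h x
  | succ n ih =>
    rw [Function.iterate_succ_apply', Function.iterate_succ_apply']
    exact hK.kerApply_mono (hK.isBddFun_iterate hf n) (hK.isBddFun_iterate hg n) ih x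

lemma iterate_add (hK : IsSubstochastic K) (hf : IsBddFun f) (hg : IsBddFun g) (n : ℕ) (x : V) :
    (kerApply K)^[n] (fun y => f y + g y) x =
      (kerApply K)^[n] f x + (kerApply K)^[n] g x := by
  induction n generalizing x with
  | zero => rfl
  | succ n ih =>
    simp only [Function.iterate_succ_apply']
    rw [← hK.kerApply_add (hK.isBddFun_iterate hf n) (hK.isBddFun_iterate hg n)]
    exact congrArg (fun F => kerApply K F x) (funext ih)

lemma iterate_const_mul (K : V → V → ℝ) (c : ℝ) (f : V → ℝ) (n : ℕ) (x : V) :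
    (kerApply K)^[n] (fun y => c * f y) x = c * (kerApply K)^[n] f x := by
  induction n generalizing x with
  | zero => rfl
  | succ n ih =>
    simp only [Function.iterate_succ_apply']
    rw [← kerApply_const_mul]
    exact congrArg (fun F => kerApply K F x) (funext ih)

lemma iterate_sub (hK : IsSubstochastic K) (hf : IsBddFun f) (hg : IsBddFun g) (n : ℕ) (x : V) :
    (kerApply K)^[n] (fun y => f y - g y) x =
      (kerApply K)^[n] f x - (kerApply K)^[n] g x := by
  have h := hK.iterate_add (hf.sub hg) hg n x
  simp only [sub_add_cancel] at h
  rw [h, add_sub_cancel_right]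

lemma iterate_one_le (hK : IsSubstochastic K) (n : ℕ) (x : V) :
    (kerApply K)^[n] (fun _ => 1) x ≤ 1 := by
  induction n generalizing x with
  | zero => exact le_rfl
  | succ n ih =>
    rw [Function.iterate_succ_apply']
    exact hK.kerApply_le (hK.isBddFun_iterate (IsBddFun.const 1) n) zero_le_one ih x

lemma iterate_sum (hK : IsSubstochastic K) {ι : Type*} (s : Finset ι) {F : ι → V → ℝ}
    (h : ∀ i ∈ s, IsBddFun (F i)) (n : ℕ) (x : V) :
    (kerApply K)^[n] (fun y => ∑ i ∈ s, F i y) x = ∑ i ∈ s, (kerApply K)^[n] (F i) x := by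
  classical
  induction s using Finset.induction_on with
  | empty =>
    have := iterate_const_mul K 0 (fun _ => (0 : ℝ)) n x
    simpa using this
  | insert i s hi ih =>
    simp only [Finset.sum_insert hi]
    rw [hK.iterate_add (h i (by simp)) (IsBddFun.sum s fun j hj => h j (by simp [hj])),
      ih fun j hj => h j (by simp [hj])]

/-- Monotonicity in the kernel. -/
lemma iterate_le_of_kernel_le (hK : IsSubstochastic K) (hL : IsSubstochastic L)
    (hLK : ∀ x y, L x y ≤ K x y) (hf : IsBddFun f) (h0 : ∀ y, 0 ≤ f y) (n : ℕ) (x : V) :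
    (kerApply L)^[n] f x ≤ (kerApply K)^[n] f x := by
  induction n generalizing x with
  | zero => exact le_rfl
  | succ n ih =>
    rw [Function.iterate_succ_apply', Function.iterate_succ_apply']
    exact hL.kerApply_mono_of_le hK (hL.isBddFun_iterate hf n) (hK.isBddFun_iterate hf n)
      fun y => mul_le_mul (hLK x y) (ih y) (hL.iterate_nonneg h0 n y) (hK.nonneg x y)

/-- The cost of replacing a kernel by a smaller one is controlled by the lost mass. -/
lemma iterate_le_add_lost_mass (hK : IsSubstochastic K) (hL : IsSubstochastic L)
    (hLK : ∀ x y, L x y ≤ K x y) (hf : IsBddFun f) {M : ℝ} (hM : 0 ≤ M)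
    (h1 : ∀ y, f y ≤ M) (n : ℕ) (x : V) :
    (kerApply K)^[n] f x ≤
      (kerApply L)^[n] f x + M * (1 - (kerApply L)^[n] (fun _ => 1) x) := by
  have hb : IsBddFun fun _ : V => M * 1 := IsBddFun.const _
  -- Monotonicity is applied to the nonnegative function `M - f`; the constant part produces the
  -- lost mass.
  have h2 := iterate_le_of_kernel_le hK hL hLK (hb.sub hf) (fun y => by
    simp only [mul_one]; linarith [h1 y]) n x
  rw [hK.iterate_sub hb hf, hL.iterate_sub hb hf, iterate_const_mul, iterate_const_mul] at h2
  have h3 := mul_le_mul_of_nonneg_left (hK.iterate_one_le n x) hM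
  linarith

end IsSubstochastic

/-! ### Truncated Green's functions -/

/-- The expected number of visits to `o` before time `n`. -/
noncomputable def truncGreen (K : Vertex → Vertex → ℝ) (n : ℕ) (o x : Vertex) : ℝ :=
  ∑ i ∈ Finset.range n, nStep K i x o

/-- The indicator function of a vertex. -/
noncomputable def indic (o : Vertex) (x : Vertex) : ℝ := if x = o then 1 else 0

lemma indic_nonneg (o x : Vertex) : 0 ≤ indic o x := by unfold indic; split_ifs <;> norm_num

lemma indic_le_one (o x : Vertex) : indic o x ≤ 1 := by unfold indic; split_ifs <;> norm_num

lemma isBddFun_indic (o : Vertex) : IsBddFun (indic o) :=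
  IsBddFun.of_nonneg_of_le (indic_nonneg o) (indic_le_one o)

lemma nStep_eq_iterate_indic (K : Vertex → Vertex → ℝ) (n : ℕ) (o : Vertex) :
    (fun x => nStep K n x o) = (kerApply K)^[n] (indic o) :=
  funext fun x => nStep_eq_iterate K n o x

namespace IsSubstochastic

variable {K L : Vertex → Vertex → ℝ}

lemma nStep_nonneg (hK : IsSubstochastic K) (n : ℕ) (x o : Vertex) : 0 ≤ nStep K n x o := by
  rw [nStep_eq_iterate]
  exact hK.iterate_nonneg (indic_nonneg o) n x

lemma isBddFun_nStep (hK : IsSubstochastic K) (n : ℕ) (o : Vertex) :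
    IsBddFun fun x => nStep K n x o := by
  rw [nStep_eq_iterate_indic]
  exact hK.isBddFun_iterate (isBddFun_indic o) n

lemma isBddFun_truncGreen (hK : IsSubstochastic K) (n : ℕ) (o : Vertex) :
    IsBddFun (truncGreen K n o) :=
  IsBddFun.sum _ fun i _ => hK.isBddFun_nStep i o

lemma truncGreen_nonneg (hK : IsSubstochastic K) (n : ℕ) (o x : Vertex) :
    0 ≤ truncGreen K n o x := Finset.sum_nonneg fun i _ => hK.nStep_nonneg i x o

lemma truncGreen_mono (hK : IsSubstochastic K) (o x : Vertex) :
    Monotone fun n => truncGreen K n o x := fun _ _ h =>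
  Finset.sum_le_sum_of_subset_of_nonneg (Finset.range_mono h)
    fun i _ _ => hK.nStep_nonneg i x o

lemma iterate_truncGreen (hK : IsSubstochastic K) (m n : ℕ) (o x : Vertex) :
    (kerApply K)^[m] (truncGreen K n o) x = ∑ i ∈ Finset.range n, nStep K (m + i) x o := by
  have h := hK.iterate_sum (Finset.range n) (F := fun i x => nStep K i x o)
    (fun i _ => hK.isBddFun_nStep i o) m x
  refine h.trans (Finset.sum_congr rfl fun i _ => ?_)
  rw [nStep_eq_iterate_indic, nStep_eq_iterate, ← Function.iterate_add_apply]
  rfl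

lemma truncGreen_succ (hK : IsSubstochastic K) (n : ℕ) (o x : Vertex) :
    truncGreen K (n + 1) o x = indic o x + kerApply K (truncGreen K n o) x := by
  have h := hK.iterate_truncGreen 1 n o x
  rw [Function.iterate_one] at h
  rw [h, truncGreen, Finset.sum_range_succ', add_comm]
  congr 1
  exact Finset.sum_congr rfl fun i _ => by rw [add_comm]

/-- The Markov property at time `m`, on which the final comparison rests. -/
lemma truncGreen_add (hK : IsSubstochastic K) (m n : ℕ) (o x : Vertex) :
    truncGreen K (m + n) o x =
      truncGreen K m o x + (kerApply K)^[m] (truncGreen K n o) x := by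
  rw [hK.iterate_truncGreen, truncGreen, Finset.sum_range_add]
  rfl

/-- The Green's function is maximal on the diagonal. -/
lemma truncGreen_le_self (hK : IsSubstochastic K) (n : ℕ) (o x : Vertex) :
    truncGreen K n o x ≤ truncGreen K n o o := by
  induction n generalizing x with
  | zero => simp [truncGreen]
  | succ n ih =>
    by_cases hx : x = o
    · rw [hx]
    · rw [hK.truncGreen_succ, indic, if_neg hx, zero_add]
      exact (hK.kerApply_le (hK.isBddFun_truncGreen n o) (hK.truncGreen_nonneg n o o) ih x).trans
        (hK.truncGreen_mono o o (Nat.le_succ n))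

lemma truncGreen_le_of_kernel_le (hK : IsSubstochastic K) (hL : IsSubstochastic L)
    (hLK : ∀ x y, L x y ≤ K x y) (n : ℕ) (o x : Vertex) :
    truncGreen L n o x ≤ truncGreen K n o x := by
  refine Finset.sum_le_sum fun i _ => ?_
  rw [nStep_eq_iterate, nStep_eq_iterate]
  exact iterate_le_of_kernel_le hK hL hLK (isBddFun_indic o) (indic_nonneg o) i x

/-- Comparison of the Green's functions up to a fixed time, by the lost mass. -/
lemma truncGreen_le_add_lost_mass (hK : IsSubstochastic K) (hL : IsSubstochastic L)
    (hLK : ∀ x y, L x y ≤ K x y) (n : ℕ) (o x : Vertex) {M : ℝ} (hM : 0 ≤ M)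
    (h1 : ∀ y, truncGreen K n o y ≤ M) :
    truncGreen K n o x ≤
      truncGreen L n o x + M * (1 - (kerApply L)^[n] (fun _ => 1) x) := by
  induction n generalizing x with
  | zero => simp [truncGreen]
  | succ n ih =>
    have hGM : ∀ y, truncGreen K n o y ≤ M := fun y =>
      (hK.truncGreen_mono o y (Nat.le_succ n)).trans (h1 y)
    have hLG := hL.isBddFun_truncGreen n o
    have hLI : IsBddFun ((kerApply L)^[n] (fun _ => 1)) :=
      hL.isBddFun_iterate (IsBddFun.const 1) n
    have e1 := hK.iterate_le_add_lost_mass hL hLK (hK.isBddFun_truncGreen n o) hM hGM 1 x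
    have e2 := hL.kerApply_mono (hK.isBddFun_truncGreen n o)
      (hLG.add (((IsBddFun.const 1).sub hLI).const_mul M)) (fun y => ih y hGM) x
    rw [hL.kerApply_add hLG (((IsBddFun.const 1).sub hLI).const_mul M), kerApply_const_mul,
      hL.kerApply_sub (IsBddFun.const 1) hLI] at e2
    rw [hK.truncGreen_succ, hL.truncGreen_succ, Function.iterate_succ_apply']
    simp only [Function.iterate_one] at e1
    linarith

end IsSubstochastic

/-! ### The walk killed on leaving a box -/

/-- The box of radius `r`. -/
noncomputable def box (r : ℕ) : Finset Vertex :=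
  Finset.Icc (-(r : ℤ)) r ×ˢ Finset.Icc (-(r : ℤ)) r

lemma mem_box {r : ℕ} {x : Vertex} : x ∈ box r ↔ |x.1| ≤ r ∧ |x.2| ≤ r := by
  simp [box, Finset.mem_product, abs_le]

/-- The kernel killed on leaving the box. -/
noncomputable def boxKernel (r : ℕ) (K : Vertex → Vertex → ℝ) (x y : Vertex) : ℝ :=
  if x ∈ box r ∧ y ∈ box r then K x y else 0

lemma boxKernel_le {r : ℕ} {K : Vertex → Vertex → ℝ} (hK : ∀ x y, 0 ≤ K x y) (x y : Vertex) :
    boxKernel r K x y ≤ K x y := by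
  unfold boxKernel
  split_ifs
  · exact le_rfl
  · exact hK x y

lemma IsSubstochastic.boxKernel {K : Vertex → Vertex → ℝ} (hK : IsSubstochastic K) (r : ℕ) :
    IsSubstochastic (boxKernel r K) := by
  have h0 : ∀ x y, 0 ≤ _root_.boxKernel r K x y := fun x y => by
    unfold _root_.boxKernel
    split_ifs
    · exact hK.nonneg x y
    · exact le_rfl
  have h1 : ∀ x, Summable (_root_.boxKernel r K x) := fun x =>
    Summable.of_nonneg_of_le (h0 x) (boxKernel_le hK.nonneg x) (hK.summable x)
  exact ⟨h0, h1, fun x => ((h1 x).tsum_le_tsum (boxKernel_le hK.nonneg x) (hK.summable x)).trans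
    (hK.sum_le_one x)⟩

lemma hasSum_lazyKernel {P : Vertex → Vertex → ℝ} {x : Vertex} {f : Vertex → ℝ} {a : ℝ}
    (h : HasSum (fun y => P x y * f y) a) :
    HasSum (fun y => lazyKernel P x y * f y) ((f x + a) / 2) := by
  have h1 : HasSum (fun y => (if x = y then 1 else 0) * f y) (f x) := by
    convert hasSum_ite_eq x (f x) using 2 with y
    by_cases hy : x = y
    · simp [hy]
    · simp [hy, Ne.symm hy]
  exact ((h1.add h).div_const 2).congr_fun fun y => by rw [lazyKernel]; ring

lemma lazyKernel_nonneg {P : Vertex → Vertex → ℝ} (h : ∀ x y, 0 ≤ P x y) (x y : Vertex) :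
    0 ≤ lazyKernel P x y := by
  have := h x y
  unfold lazyKernel
  split_ifs <;> linarith

section

variable {s : ℝ} {ν : ℤ → ℝ}

lemma hasSum_lazy_row (hν : IsStepLaw ν) (x : Vertex) :
    HasSum (lazyKernel (stepKernel s ν) x) 1 := by
  have h := hasSum_lazyKernel (f := fun _ => 1) (P := stepKernel s ν) (x := x) (a := 1)
    (by simpa using hasSum_stepKernel hν.hasSum x)
  simpa using h

lemma isSubstochastic_lazy (hs0 : 0 < s) (hs1 : s < 1) (hν : IsStepLaw ν) :
    IsSubstochastic (lazyKernel (stepKernel s ν)) where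
  nonneg := lazyKernel_nonneg (stepKernel_nonneg hs0 hs1 hν.nonneg)
  summable x := (hasSum_lazy_row hν x).summable
  sum_le_one x := (hasSum_lazy_row hν x).tsum_eq.le

/-! ### Exit from a box and occupation of small sets. -/

/-- The squared Euclidean norm in lattice coordinates. -/
noncomputable def sqNorm (x : Vertex) : ℝ := (x.1 : ℝ) ^ 2 + (x.2 : ℝ) ^ 2

lemma sqNorm_nonneg (x : Vertex) : 0 ≤ sqNorm x := by unfold sqNorm; positivity

/-- All steps have mean zero, on the line because `ν` is even, so one step adds only the variance to
the mean of the squared norm. The steps on the line need not be bounded; a second moment suffices.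
-/
lemma exists_hasSum_sqNorm (hs0 : 0 < s) (hs1 : s < 1) (hν : IsStepLaw ν) :
    ∃ C : ℝ, 0 < C ∧ ∀ x, ∃ a ≤ sqNorm x + C,
      HasSum (fun y => lazyKernel (stepKernel s ν) x y * sqNorm y) a := by
  set v := ∑' k : ℤ, (k : ℝ) ^ 2 * ν k with hv
  have hv0 : 0 ≤ v := tsum_nonneg fun k => mul_nonneg (sq_nonneg _) (hν.nonneg k)
  have hmean : HasSum (fun k : ℤ => (k : ℝ) * ν k) 0 := by
    have hsum : Summable fun k : ℤ => (k : ℝ) * ν k := by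
      refine Summable.of_norm_bounded hν.summable_sq fun k => ?_
      rw [norm_mul, Real.norm_of_nonneg (hν.nonneg k)]
      refine mul_le_mul_of_nonneg_right ?_ (hν.nonneg k)
      rw [Real.norm_eq_abs, ← sq_abs, ← Int.cast_abs]
      exact_mod_cast Int.le_self_sq |k|
    have h1 := hsum.hasSum
    have h2 : HasSum (fun k : ℤ => (k : ℝ) * ν k) (-∑' k : ℤ, (k : ℝ) * ν k) := by
      have := ((Equiv.neg ℤ).hasSum_iff.2 h1).neg
      refine this.congr_fun fun k => ?_
      simp [hν.neg]
    have h3 := h1.unique h2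
    rw [show ∑' k : ℤ, (k : ℝ) * ν k = 0 by linarith] at h1
    exact h1
  refine ⟨v + 3, by positivity, fun x => ?_⟩
  by_cases hx : x.2 = 0
  · have h1 : HasSum (fun k : ℤ => ν k * sqNorm (x.1 + k, 0)) ((x.1 : ℝ) ^ 2 + v) := by
      have := ((hν.hasSum.mul_left ((x.1 : ℝ) ^ 2)).add (hmean.mul_left (2 * (x.1 : ℝ)))).add
        hν.summable_sq.hasSum
      rw [mul_one, mul_zero, add_zero] at this
      refine this.congr_fun fun k => ?_
      simp only [sqNorm]
      push_cast
      ring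
    refine ⟨_, ?_, hasSum_lazyKernel (hasSum_stepKernel_line s ν hx h1)⟩
    simp only [sqNorm, hx]
    push_cast
    nlinarith
  · refine ⟨_, ?_, hasSum_lazyKernel (hasSum_stepKernel_off s ν hx sqNorm)⟩
    simp only [sqNorm]
    push_cast
    nlinarith

/-- The exit probability from a box. -/
lemma exists_lost_mass_le (hs0 : 0 < s) (hs1 : s < 1) (hν : IsStepLaw ν) :
    ∃ C : ℝ, 0 < C ∧ ∀ (r n : ℕ) (x : Vertex),
      1 - (kerApply (boxKernel r (lazyKernel (stepKernel s ν))))^[n] (fun _ => 1) x ≤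
        (sqNorm x + C * n) / ((r : ℝ) + 1) ^ 2 := by
  obtain ⟨C, hC0, hC⟩ := exists_hasSum_sqNorm hs0 hs1 hν
  refine ⟨C, hC0, fun r n => ?_⟩
  have hP := isSubstochastic_lazy hs0 hs1 hν
  have hB := hP.boxKernel r
  have hr : (0 : ℝ) < ((r : ℝ) + 1) ^ 2 := by positivity
  have hout : ∀ (n : ℕ) (x : Vertex), x ∉ box r →
      1 - (sqNorm x + C * n) / ((r : ℝ) + 1) ^ 2 ≤ 0 := by
    intro n x hx
    rw [sub_nonpos, le_div_iff₀ hr, one_mul]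
    have h1 : ((r : ℝ) + 1) ^ 2 ≤ sqNorm x := by
      rw [mem_box, not_and_or, not_le, not_le] at hx
      unfold sqNorm
      rcases hx with h | h
      · have : ((r : ℝ) + 1) ≤ |(x.1 : ℝ)| := by exact_mod_cast h
        nlinarith [sq_abs (x.1 : ℝ), sq_nonneg (x.2 : ℝ)]
      · have : ((r : ℝ) + 1) ≤ |(x.2 : ℝ)| := by exact_mod_cast h
        nlinarith [sq_abs (x.2 : ℝ), sq_nonneg (x.1 : ℝ)]
    have : 0 ≤ C * n := by positivity
    linarith
  -- This lower bound for the survival probability is stable under one step. It is nonpositive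
  -- outside the box, so killing there, even after a long jump, costs nothing.
  suffices h : ∀ x, 1 - (sqNorm x + C * n) / ((r : ℝ) + 1) ^ 2 ≤
      (kerApply (boxKernel r (lazyKernel (stepKernel s ν))))^[n] (fun _ => 1) x by
    intro x
    linarith [h x]
  induction n with
  | zero =>
    intro x
    have := sqNorm_nonneg x
    simp
    positivity
  | succ n ih =>
    intro x
    by_cases hx : x ∈ box r
    · rw [Function.iterate_succ_apply', kerApply]
      obtain ⟨a, ha, hs⟩ := hC x
      have h1 := ((hasSum_lazy_row hν x (s := s)).mul_right
        (1 - C * n / ((r : ℝ) + 1) ^ 2)).sub (hs.mul_right (1 / ((r : ℝ) + 1) ^ 2))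
      have h2 := hasSum_le (fun y => ?_) h1
        (hB.summable_mul (hB.isBddFun_iterate (IsBddFun.const 1) n) x).hasSum
      · refine le_trans ?_ h2
        have : a * (1 / ((r : ℝ) + 1) ^ 2) ≤ (sqNorm x + C) * (1 / ((r : ℝ) + 1) ^ 2) := by
          gcongr
        push_cast
        have e : (sqNorm x + C * (n + 1)) / ((r : ℝ) + 1) ^ 2 =
          (sqNorm x + C) * (1 / ((r : ℝ) + 1) ^ 2) + C * n / ((r : ℝ) + 1) ^ 2 := by ring
        rw [e]
        linarith
      · have e : lazyKernel (stepKernel s ν) x y * (1 - C * n / ((r : ℝ) + 1) ^ 2) -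
            lazyKernel (stepKernel s ν) x y * sqNorm y * (1 / ((r : ℝ) + 1) ^ 2) =
            lazyKernel (stepKernel s ν) x y *
              (1 - (sqNorm y + C * n) / ((r : ℝ) + 1) ^ 2) := by ring
        rw [e]
        by_cases hy : y ∈ box r
        · rw [boxKernel, if_pos ⟨hx, hy⟩]
          exact mul_le_mul_of_nonneg_left (ih y) (hP.nonneg x y)
        · rw [boxKernel, if_neg fun h => hy h.2, zero_mul]
          exact mul_nonpos_of_nonneg_of_nonpos (hP.nonneg x y) (hout n y hy)
    · exact (hout _ x hx).trans (hB.iterate_nonneg (fun _ => zero_le_one) _ x)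

/-- Summing `C / (i + 1)` over the times `i` gives a harmonic sum. -/
lemma exists_truncGreen_lazy_le (hs0 : 0 < s) (hs1 : s < 1) (hν : IsStepLaw ν) :
    ∃ C : ℝ, 0 < C ∧ ∀ (n : ℕ) (o x : Vertex),
      truncGreen (lazyKernel (stepKernel s ν)) n o x ≤ C * (1 + Real.log n) := by
  obtain ⟨C, hC0, hC⟩ := exists_nStep_lazy_le hs0 hs1 hν
  refine ⟨C, hC0, fun n o x => ?_⟩
  refine (Finset.sum_le_sum fun i _ => hC i x o).trans ?_
  simp only [div_eq_mul_inv, ← Finset.mul_sum]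
  refine mul_le_mul_of_nonneg_left ?_ hC0.le
  have h := harmonic_le_one_add_log n
  simpa [harmonic] using h

/-- The probability to be in a finite set. -/
lemma exists_iterate_indicator_le (hs0 : 0 < s) (hs1 : s < 1) (hν : IsStepLaw ν) :
    ∃ C : ℝ, 0 < C ∧ ∀ (n : ℕ) (t : Finset Vertex) (x : Vertex),
      (kerApply (lazyKernel (stepKernel s ν)))^[n] (fun y => ∑ w ∈ t, indic w y) x ≤
        t.card * (C / (n + 1)) := by
  obtain ⟨C, hC0, hC⟩ := exists_nStep_lazy_le hs0 hs1 hν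
  refine ⟨C, hC0, fun n t x => ?_⟩
  rw [(isSubstochastic_lazy hs0 hs1 hν).iterate_sum t (F := indic)
    (fun w _ => isBddFun_indic w)]
  refine (Finset.sum_le_card_nsmul _ _ (C / (n + 1)) fun w _ => ?_).trans (by rw [nsmul_eq_mul])
  have := hC n x w
  rwa [nStep_eq_iterate] at this

/-! ### Reflection symmetry of the walk in the box. -/

/-- The reflection in the real line. -/
def reflect (x : Vertex) : Vertex := (x.1, -x.2)

lemma reflect_reflect (x : Vertex) : reflect (reflect x) = x := by simp [reflect]

lemma stepKernel_reflect (x y : Vertex) :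
    stepKernel s ν (reflect x) (reflect y) = stepKernel s ν x y := by
  have h : LatticeNbr (reflect x) (reflect y) ↔ LatticeNbr x y := by
    unfold LatticeNbr reflect; dsimp only; omega
  by_cases hl : LatticeNbr x y
  · simp only [stepKernel, hl, h.2 hl]
    simp [reflect]
  · simp only [stepKernel, hl, mt h.1 hl]
    simp [reflect]

lemma boxKernel_lazy_reflect (r : ℕ) (x y : Vertex) :
    boxKernel r (lazyKernel (stepKernel s ν)) (reflect x) (reflect y) =
      boxKernel r (lazyKernel (stepKernel s ν)) x y := by
  have h1 : ∀ x, reflect x ∈ box r ↔ x ∈ box r := fun x => by simp [mem_box, reflect]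
  have h2 : reflect x = reflect y ↔ x = y := by
    simp [reflect, Prod.ext_iff]
  simp only [boxKernel, h1, lazyKernel, h2, stepKernel_reflect]

lemma iterate_boxKernel_reflect (r n : ℕ) (f : Vertex → ℝ) (x : Vertex) :
    (kerApply (boxKernel r (lazyKernel (stepKernel s ν))))^[n] (fun y => f (reflect y)) x =
      (kerApply (boxKernel r (lazyKernel (stepKernel s ν))))^[n] f (reflect x) := by
  induction n generalizing x with
  | zero => rfl
  | succ n ih =>
    rw [Function.iterate_succ_apply', Function.iterate_succ_apply', kerApply, kerApply,
      ← (Equiv.mk reflect reflect reflect_reflect reflect_reflect).tsum_eq]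
    refine tsum_congr fun y => ?_
    simp only [Equiv.coe_fn_mk]
    rw [ih, reflect_reflect, ← boxKernel_lazy_reflect r x, reflect_reflect]

end

/-! ### A barrier for the simple random walk in a tube -/

/-- The difference `exp x + exp (-x) - 2` is `4 sinh² (x / 2)`. -/
lemma two_add_sq_le_exp_add_exp_neg (x : ℝ) : 2 + x ^ 2 ≤ Real.exp x + Real.exp (-x) := by
  have h1 : |x / 2| ≤ |Real.sinh (x / 2)| := by
    rw [Real.abs_sinh]
    exact Real.self_le_sinh_iff.2 (abs_nonneg _)
  have h2 := sq_le_sq.2 h1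
  have h3 : Real.sinh (x / 2) ^ 2 = (Real.exp x + Real.exp (-x) - 2) / 4 := by
    rw [Real.sinh_eq, div_pow, sub_sq, mul_assoc, ← Real.exp_add, ← Real.exp_nat_mul,
      ← Real.exp_nat_mul]
    have e1 : ((2 : ℕ) : ℝ) * (x / 2) = x := by push_cast; ring
    have e2 : ((2 : ℕ) : ℝ) * -(x / 2) = -x := by push_cast; ring
    rw [e1, e2, add_neg_cancel, Real.exp_zero]
    ring
  rw [h3] at h2
  nlinarith

/-- For the two neighbours in one direction, `D` is the slope of the exponent and `q` its negative
second order term; the square of the slope has to compensate `q`. -/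
lemma exp_pair_lower_bound {D q : ℝ} (hq : -(1 / 2) ≤ q) :
    2 + 2 * q + D ^ 2 / 2 ≤ Real.exp (q + D) + Real.exp (q - D) := by
  have h1 := two_add_sq_le_exp_add_exp_neg D
  have h2 := Real.add_one_le_exp q
  have h3 : Real.exp (q + D) + Real.exp (q - D) = Real.exp q * (Real.exp D + Real.exp (-D)) := by
    rw [Real.exp_add, sub_eq_add_neg, Real.exp_add]; ring
  rw [h3]
  calc 2 + 2 * q + D ^ 2 / 2 ≤ (q + 1) * (2 + D ^ 2) := by nlinarith [sq_nonneg D]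
    _ ≤ _ := mul_le_mul h2 h1 (by positivity) (Real.exp_pos _).le

/-- The exponent of the barrier: a paraboloid with axis from `(a₀, b₀)` in the direction with
slope `k`. -/
noncomputable def tubeExp (σ a₀ b₀ : ℤ) (L k ω : ℝ) (a b : ℤ) : ℝ :=
  (σ * (a - a₀) : ℤ) / L - ((b : ℝ) - b₀ - k * (a - a₀)) ^ 2 / ω ^ 2

/-- Along the axis `(1, k)` of the tube the exponent has slope `κ σ / L` whatever the transverse
position. By Cauchy–Schwarz its squared gradient is at least `κ² / (L² (1 + k²))`, which is
quadratic in `κ` and beats the concavity `4 κ (1 + k²) / ω²` once `κ` is large. -/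
lemma exp_tubeExp_strict_subharmonic {σ a₀ b₀ : ℤ} (hσ : σ ^ 2 = 1) {L k ω κ : ℝ} (hL : 0 < L)
    (hω : 0 < ω) (hκ : 0 < κ) (h1 : 4 * L ^ 2 * (1 + k ^ 2) ^ 2 < κ * ω ^ 2)
    (h2 : 2 * κ * (1 + k ^ 2) ≤ ω ^ 2) (a b : ℤ) :
    4 * Real.exp (κ * tubeExp σ a₀ b₀ L k ω a b) <
      Real.exp (κ * tubeExp σ a₀ b₀ L k ω (a + 1) b) +
      Real.exp (κ * tubeExp σ a₀ b₀ L k ω (a - 1) b) +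
      Real.exp (κ * tubeExp σ a₀ b₀ L k ω a (b + 1)) +
      Real.exp (κ * tubeExp σ a₀ b₀ L k ω a (b - 1)) := by
  set g := tubeExp σ a₀ b₀ L k ω a b with hg
  set Y : ℝ := (b : ℝ) - b₀ - k * (a - a₀) with hY
  set Da := κ * (σ / L + 2 * k * Y / ω ^ 2) with hDa
  set Db := κ * (-(2 * Y / ω ^ 2)) with hDb
  set qa := -(κ * k ^ 2 / ω ^ 2) with hqa
  set qb := -(κ / ω ^ 2) with hqb
  have e1 : κ * tubeExp σ a₀ b₀ L k ω (a + 1) b = κ * g + (qa + Da) := by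
    simp only [hg, tubeExp, hqa, hDa, hY]; push_cast; field_simp; ring
  have e2 : κ * tubeExp σ a₀ b₀ L k ω (a - 1) b = κ * g + (qa - Da) := by
    simp only [hg, tubeExp, hqa, hDa, hY]; push_cast; field_simp; ring
  have e3 : κ * tubeExp σ a₀ b₀ L k ω a (b + 1) = κ * g + (qb + Db) := by
    simp only [hg, tubeExp, hqb, hDb, hY]; push_cast; field_simp; ring
  have e4 : κ * tubeExp σ a₀ b₀ L k ω a (b - 1) = κ * g + (qb - Db) := by
    simp only [hg, tubeExp, hqb, hDb, hY]; push_cast; field_simp; ring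
  have hω2 : 0 < ω ^ 2 := by positivity
  have hsum : κ * (1 + k ^ 2) / ω ^ 2 ≤ 1 / 2 := by
    rw [div_le_iff₀ hω2]; linarith
  have hqab : qa + qb = -(κ * (1 + k ^ 2) / ω ^ 2) := by rw [hqa, hqb]; ring
  have hqa0 : qa ≤ 0 := by rw [hqa]; simp only [neg_nonpos]; positivity
  have hqb0 : qb ≤ 0 := by rw [hqb]; simp only [neg_nonpos]; positivity
  have hA := exp_pair_lower_bound (D := Da) (q := qa) (by linarith)
  have hB := exp_pair_lower_bound (D := Db) (q := qb) (by linarith)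
  have hD : 4 * (κ * (1 + k ^ 2) / ω ^ 2) < Da ^ 2 + Db ^ 2 := by
    have h3 : Da + k * Db = κ * σ / L := by rw [hDa, hDb]; ring
    have h4 : (Da + k * Db) ^ 2 ≤ (1 + k ^ 2) * (Da ^ 2 + Db ^ 2) := by
      nlinarith [sq_nonneg (k * Da - Db)]
    have hσ' : (σ : ℝ) ^ 2 = 1 := by exact_mod_cast hσ
    have h5 : (Da + k * Db) ^ 2 = κ ^ 2 / L ^ 2 := by
      rw [h3, div_pow, mul_pow, hσ', mul_one]
    have h6 : (1 + k ^ 2) * (4 * (κ * (1 + k ^ 2) / ω ^ 2)) < κ ^ 2 / L ^ 2 := by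
      rw [lt_div_iff₀ (by positivity)]
      have : (1 + k ^ 2) * (4 * (κ * (1 + k ^ 2) / ω ^ 2)) * L ^ 2 =
          κ / ω ^ 2 * (4 * L ^ 2 * (1 + k ^ 2) ^ 2) := by ring
      rw [this]
      calc κ / ω ^ 2 * (4 * L ^ 2 * (1 + k ^ 2) ^ 2) < κ / ω ^ 2 * (κ * ω ^ 2) := by gcongr
        _ = κ ^ 2 := by field_simp
    have h7 : (1 + k ^ 2) * (4 * (κ * (1 + k ^ 2) / ω ^ 2)) <
        (1 + k ^ 2) * (Da ^ 2 + Db ^ 2) := by linarith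
    exact lt_of_mul_lt_mul_left h7 (by positivity)
  rw [e1, e2, e3, e4, Real.exp_add (κ * g), Real.exp_add (κ * g), Real.exp_add (κ * g),
    Real.exp_add (κ * g)]
  have hpos := Real.exp_pos (κ * g)
  have h8 : 4 < Real.exp (qa + Da) + Real.exp (qa - Da) + Real.exp (qb + Db) +
      Real.exp (qb - Db) := by linarith
  nlinarith

/-- A nonnegative function on `ℤ²` which is superharmonic in a tube, and at least one on the
segment at its end, is bounded below at the beginning of the tube. -/
theorem tube_lower_bound {φ : ℤ → ℤ → ℝ} (hφ : ∀ a b, 0 ≤ φ a b) {σ a₀ b₀ a₁ b₁ : ℤ}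
    (hσ : σ ^ 2 = 1) {L k ω κ θ : ℝ} (hL : 0 < L) (hLa : L = (σ * (a₁ - a₀) : ℤ))
    (hk : k * (a₁ - a₀) = b₁ - b₀)
    (hω : 0 < ω) (hκ : 0 < κ) (hθ : 0 < θ) (hθ1 : θ ≤ 1)
    (h1 : 4 * L ^ 2 * (1 + k ^ 2) ^ 2 < κ * ω ^ 2) (h2 : 2 * κ * (1 + k ^ 2) ≤ ω ^ 2)
    (hsup : ∀ a b : ℤ, ((σ * (a - a₀) : ℤ) : ℝ) < L → -θ < tubeExp σ a₀ b₀ L k ω a b →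
      φ (a + 1) b + φ (a - 1) b + φ a (b + 1) + φ a (b - 1) ≤ 4 * φ a b)
    (hS : ∀ b : ℤ, |(b : ℝ) - b₁| ≤ 2 * ω → 1 ≤ φ a₁ b) :
    Real.exp (-κ) * (1 - Real.exp (-(κ * θ))) ≤ φ a₀ b₀ := by
  set g := tubeExp σ a₀ b₀ L k ω with hg
  set U : Set (ℤ × ℤ) := {p | ((σ * (p.1 - a₀) : ℤ) : ℝ) < L ∧ -θ < g p.1 p.2} with hU
  have hσ2 : σ = 1 ∨ σ = -1 := mul_self_eq_one_iff.1 (by rw [← sq]; exact hσ)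
  have hω2 : 0 < ω ^ 2 := by positivity
  -- On the tube the exponent exceeds `-θ ≥ -1` while its linear part is below `1`, so `Y ^ 2 < 2 ω
  -- ^ 2` and both coordinates are bounded.
  have hfin : U.Finite := by
    set N : ℤ := ⌈L⌉ with hN
    have hNL : L ≤ N := Int.le_ceil L
    set M : ℤ := ⌈|k| * N + 2 * ω⌉ with hM
    have hMk : |k| * N + 2 * ω ≤ M := Int.le_ceil _
    refine ((Set.finite_Icc (a₀ - N) (a₀ + N)).prod
      (Set.finite_Icc (b₀ - M) (b₀ + M))).subset fun p hp => ?_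
    obtain ⟨hp1, hp2⟩ := hp
    simp only [hg, tubeExp] at hp2
    set Y : ℝ := (p.2 : ℝ) - b₀ - k * (p.1 - a₀) with hY
    have hY0 : 0 ≤ Y ^ 2 / ω ^ 2 := by positivity
    have ht : -θ * L < ((σ * (p.1 - a₀) : ℤ) : ℝ) := by
      rw [← lt_div_iff₀ hL]; linarith
    have ht1 : ((σ * (p.1 - a₀) : ℤ) : ℝ) / L < 1 := by rwa [div_lt_one hL]
    have hY1 : Y ^ 2 < (2 * ω) ^ 2 := by
      have : Y ^ 2 / ω ^ 2 < 2 := by linarith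
      rw [div_lt_iff₀ hω2] at this
      nlinarith
    have hY2 := abs_lt_of_sq_lt_sq hY1 (by positivity)
    have ha : |(p.1 : ℝ) - a₀| ≤ N := by
      have h3 : |((σ * (p.1 - a₀) : ℤ) : ℝ)| ≤ N := by
        rw [abs_le]
        constructor <;> nlinarith
      rcases hσ2 with h | h <;> rw [h] at h3 <;> push_cast at h3
      · rwa [one_mul] at h3
      · rwa [neg_one_mul, abs_neg] at h3
    have hb : |(p.2 : ℝ) - b₀| ≤ M := by
      have : (p.2 : ℝ) - b₀ = Y + k * (p.1 - a₀) := by rw [hY]; ring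
      rw [this]
      refine (abs_add_le _ _).trans ?_
      rw [abs_mul]
      have : |k| * |(p.1 : ℝ) - a₀| ≤ |k| * N := by gcongr
      linarith
    have ha' : |p.1 - a₀| ≤ N := by exact_mod_cast ha
    have hb' : |p.2 - b₀| ≤ M := by exact_mod_cast hb
    rw [abs_le] at ha' hb'
    exact ⟨⟨by linarith, by linarith⟩, ⟨by linarith, by linarith⟩⟩
  set h : ℤ → ℤ → ℝ := fun a b => Real.exp (κ * g a b) - Real.exp (-(κ * θ)) with hh
  -- The barrier `h` is nonpositive on the lateral sides and at most `exp κ` at the end, so `ψ` is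
  -- nonnegative on the boundary of the tube; a negative minimum inside would contradict strict
  -- subharmonicity of `h`.
  set ψ : ℤ × ℤ → ℝ := fun p => φ p.1 p.2 - Real.exp (-κ) * h p.1 p.2 with hψ
  have hg0 : g a₀ b₀ = 0 := by simp [hg, tubeExp]
  have hmem : (a₀, b₀) ∈ U := by
    simp only [hU, Set.mem_ofPred_eq, hg0]
    simp [hL, hθ]
  have hsmall : ∀ a b, g a b ≤ -θ → 0 ≤ ψ (a, b) := fun a b hab => by
    have h3 : h a b ≤ 0 := by
      simp only [hh, sub_nonpos]
      exact Real.exp_le_exp.2 (by nlinarith)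
    have h4 := mul_nonpos_of_nonneg_of_nonpos (Real.exp_pos (-κ)).le h3
    simp only [hψ]
    linarith [hφ a b]
  have hend : ∀ b, 0 ≤ ψ (a₁, b) := fun b => by
    by_cases hb : |(b : ℝ) - b₁| ≤ 2 * ω
    · have h3 : g a₁ b ≤ 1 := by
        simp only [hg, tubeExp, ← hLa, div_self hL.ne']
        have : 0 ≤ ((b : ℝ) - b₀ - k * (a₁ - a₀)) ^ 2 / ω ^ 2 := by positivity
        linarith
      have h4 : h a₁ b ≤ Real.exp κ := by
        simp only [hh]
        have : Real.exp (κ * g a₁ b) ≤ Real.exp κ := Real.exp_le_exp.2 (by nlinarith)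
        linarith [Real.exp_pos (-(κ * θ))]
      have h5 : Real.exp (-κ) * h a₁ b ≤ Real.exp (-κ) * Real.exp κ := by gcongr
      rw [← Real.exp_add, neg_add_cancel, Real.exp_zero] at h5
      simp only [hψ]
      linarith [hS b hb]
    · refine hsmall _ _ ?_
      simp only [hg, tubeExp, ← hLa, div_self hL.ne', hk]
      have h3 : (2 * ω) ^ 2 ≤ ((b : ℝ) - b₀ - (b₁ - b₀)) ^ 2 := by
        rw [sq_le_sq, abs_of_pos (by positivity : 0 < 2 * ω)]
        have : (b : ℝ) - b₀ - (b₁ - b₀) = b - b₁ := by ring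
        rw [this]
        linarith
      have h4 : 4 ≤ ((b : ℝ) - b₀ - (b₁ - b₀)) ^ 2 / ω ^ 2 := by
        rw [le_div_iff₀ hω2]; linarith
      linarith
  by_contra! hcon
  have hψ0 : ψ (a₀, b₀) < 0 := by
    simp only [hψ, hh, hg0, mul_zero, Real.exp_zero]
    linarith
  obtain ⟨p, hpU, hpmin⟩ := hfin.toFinset.exists_min_image ψ ⟨_, hfin.mem_toFinset.2 hmem⟩
  rw [hfin.mem_toFinset] at hpU
  have hp0 : ψ p < 0 := (hpmin _ (hfin.mem_toFinset.2 hmem)).trans_lt hψ0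
  -- A neighbour advances by at most one unit, so if it leaves the tube through the end it lies
  -- exactly on the column `a₁`.
  have hnbr : ∀ a b : ℤ, σ * (a - a₀) ≤ σ * (p.1 - a₀) + 1 → ψ p ≤ ψ (a, b) := by
    intro a b hab
    by_cases hq : (a, b) ∈ U
    · exact hpmin _ (hfin.mem_toFinset.2 hq)
    · refine hp0.le.trans ?_
      by_cases ht : ((σ * (a - a₀) : ℤ) : ℝ) < L
      · exact hsmall _ _ (not_lt.1 fun h => hq ⟨ht, h⟩)
      · have h3 := hpU.1
        rw [hLa] at h3 ht
        have h4 : σ * (p.1 - a₀) < σ * (a₁ - a₀) := by exact_mod_cast h3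
        have h5 : σ * (a₁ - a₀) ≤ σ * (a - a₀) := by exact_mod_cast not_lt.1 ht
        have h6 : σ * (a - a₀) = σ * (a₁ - a₀) := by omega
        have h7 : a = a₁ := by
          rcases hσ2 with h | h <;> rw [h] at h6 <;> omega
        rw [h7]
        exact hend b
  have n1 := hnbr (p.1 + 1) p.2 (by rcases hσ2 with h | h <;> rw [h] <;> omega)
  have n2 := hnbr (p.1 - 1) p.2 (by rcases hσ2 with h | h <;> rw [h] <;> omega)
  have n3 := hnbr p.1 (p.2 + 1) (by omega)
  have n4 := hnbr p.1 (p.2 - 1) (by omega)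
  have hs := hsup p.1 p.2 hpU.1 hpU.2
  have hstrict := exp_tubeExp_strict_subharmonic (a₀ := a₀) (b₀ := b₀) hσ hL hω hκ h1 h2 p.1 p.2
  rw [← hg] at hstrict
  have hstrict2 : 4 * h p.1 p.2 < h (p.1 + 1) p.2 + h (p.1 - 1) p.2 + h p.1 (p.2 + 1) +
      h p.1 (p.2 - 1) := by
    simp only [hh]
    linarith
  have hstrict3 := mul_lt_mul_of_pos_left hstrict2 (Real.exp_pos (-κ))
  simp only [hψ] at n1 n2 n3 n4
  nlinarith

/-! ### Hitting the Dirichlet boundary -/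

/-- A lattice frame: the vertex of the class of `(p, 0)` with coordinate `a` across and coordinate
`b` along the direction of a segment, which is vertical if `t` holds; `ε` is the sign of the
half-plane. -/
def frame (t : Bool) (ε p a b : ℤ) : Vertex :=
  if t then (p + 2 * a, ε * b) else (p + 2 * b, ε * a)

/-- The point of the plane with given real coordinates in a lattice frame. -/
def framePos (t : Bool) (ε p : ℤ) (a b : ℝ) : ℝ × ℝ :=
  if t then (p + 2 * a, 2 * (ε * b)) else (p + 2 * b, 2 * (ε * a))

lemma pos_frame (t : Bool) (ε p a b : ℤ) : pos (frame t ε p a b) = framePos t ε p a b := by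
  cases t <;> simp [pos, frame, framePos]

lemma sameClass_frame (t : Bool) (ε p a b : ℤ) : SameClass (frame t ε p a b) (p, 0) := by
  cases t <;> simp [SameClass, frame]

lemma framePos_combo (t : Bool) (ε p : ℤ) (s a a' b b' : ℝ) :
    framePos t ε p ((1 - s) * a + s * a') ((1 - s) * b + s * b') =
      (1 - s) • framePos t ε p a b + s • framePos t ε p a' b' := by
  cases t <;> simp only [framePos, if_true, if_false, Prod.smul_mk, Prod.mk_add_mk, smul_eq_mul,
    Bool.false_eq_true] <;> ext <;> ring

lemma framePos_norm_le (t : Bool) {ε p : ℤ} (hε : |ε| = 1) (hp : |p| ≤ 1) (a b : ℝ) :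
    |(framePos t ε p a b).1| + |(framePos t ε p a b).2| ≤ 1 + 2 * |a| + 2 * |b| := by
  have h1 : |(ε : ℝ)| = 1 := by exact_mod_cast hε
  have h2 : |(p : ℝ)| ≤ 1 := by exact_mod_cast hp
  cases t <;> simp only [framePos, if_true, if_false, Bool.false_eq_true, abs_mul, h1, abs_two,
    one_mul]
  · have := abs_add_le (p : ℝ) (2 * b)
    rw [abs_mul, abs_two] at this
    linarith
  · have := abs_add_le (p : ℝ) (2 * a)
    rw [abs_mul, abs_two] at this
    linarith

lemma latticeNbr_frame {t : Bool} {ε p a b : ℤ} (hε : |ε| = 1) {x : Vertex}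
    (h : LatticeNbr (frame t ε p a b) x) :
    x = frame t ε p (a + 1) b ∨ x = frame t ε p (a - 1) b ∨ x = frame t ε p a (b + 1) ∨
      x = frame t ε p a (b - 1) := by
  rw [latticeNbr_iff] at h
  rcases abs_eq (zero_le_one' ℤ) |>.1 hε with rfl | rfl <;> cases t <;>
    simp only [frame, if_true, if_false, Bool.false_eq_true, Prod.ext_iff] at h ⊢ <;> omega

lemma frame_nbr_sum {t : Bool} {ε p a b : ℤ} (hε : |ε| = 1) (f : Vertex → ℝ) {x : Vertex}
    (hx : x = frame t ε p a b) :
    f (frame t ε p (a + 1) b) + f (frame t ε p (a - 1) b) + f (frame t ε p a (b + 1)) +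
      f (frame t ε p a (b - 1)) =
    f (x.1 + 2, x.2) + f (x.1 - 2, x.2) + f (x.1, x.2 + 1) + f (x.1, x.2 - 1) := by
  subst hx
  have e1 : p + 2 * (a + 1) = p + 2 * a + 2 := by ring
  have e2 : p + 2 * (a - 1) = p + 2 * a - 2 := by ring
  have e3 : p + 2 * (b + 1) = p + 2 * b + 2 := by ring
  have e4 : p + 2 * (b - 1) = p + 2 * b - 2 := by ring
  have e5 : ∀ c : ℤ, -(c + 1) = -c - 1 := fun c => by ring
  have e6 : ∀ c : ℤ, -(c - 1) = -c + 1 := fun c => by ring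
  rcases abs_eq (zero_le_one' ℤ) |>.1 hε with rfl | rfl <;> cases t <;>
    simp only [frame, if_true, if_false, Bool.false_eq_true, e1, e2, e3, e4, one_mul,
      neg_one_mul, e5, e6] <;> ring

/-! ### The tube estimate in a domain. -/

/-- The constants of the tube estimate, at scale `R`. -/
structure TubeScale (α η ζ A K θ κ R : ℝ) : Prop where
  α_pos : 0 < α
  α_le : α ≤ 1
  η_pos : 0 < η
  ζ_pos : 0 < ζ
  ζ_le_α : 64 * ζ ≤ α
  ζ_le_η : 64 * ζ ≤ η
  one_le_A : 1 ≤ A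
  K_eq : (K - 1) * η = 2 * A
  θ_eq : θ * (A * K) = ζ
  κ_eq : κ * ζ ^ 2 = 5 * A ^ 2 * K ^ 4
  R_pos : 0 < R
  R_large₁ : 2 * κ * K ^ 2 ≤ (ζ * R) ^ 2
  R_large₂ : 2 * K ≤ ζ * R
  R_large₃ : 32 ≤ α * R

lemma TubeScale.one_lt_K {α η ζ A K θ κ R : ℝ} (h : TubeScale α η ζ A K θ κ R) : 1 < K := by
  have h1 := h.K_eq
  have h2 := h.one_le_A
  have h3 := h.η_pos
  by_contra hcon
  nlinarith

lemma TubeScale.θ_pos {α η ζ A K θ κ R : ℝ} (h : TubeScale α η ζ A K θ κ R) : 0 < θ := by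
  have h1 := h.one_lt_K
  have h2 := h.one_le_A
  have h3 : 0 < A * K := by positivity
  exact pos_of_mul_pos_left (h.θ_eq ▸ h.ζ_pos) h3.le

lemma TubeScale.κ_pos {α η ζ A K θ κ R : ℝ} (h : TubeScale α η ζ A K θ κ R) : 0 < κ := by
  have h1 := h.one_lt_K
  have h2 := h.one_le_A
  have h3 := h.ζ_pos
  have h4 : 0 < κ * ζ ^ 2 := by rw [h.κ_eq]; positivity
  exact pos_of_mul_pos_left h4 (by positivity)

set_option maxHeartbeats 1000000 in
/-- A nonnegative function which is superharmonic off the real line in the interior of the domain is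
bounded below at the start of a tube that leads to a segment of the Dirichlet boundary. -/
theorem frame_lower_bound {α η ζ A K θ κ R : ℝ} (h : TubeScale α η ζ A K θ κ R)
    {t : Bool} {ε p : ℤ} (hε : |ε| = 1) (hp : |p| ≤ 1) {Λ D : Set Vertex} {f : Vertex → ℝ}
    (hf : ∀ x, 0 ≤ f x)
    (hsup : ∀ x ∈ Λ, x ∉ innerBoundary Λ → x.2 ≠ 0 →
      f (x.1 + 2, x.2) + f (x.1 - 2, x.2) + f (x.1, x.2 + 1) + f (x.1, x.2 - 1) ≤ 4 * f x)
    (hD : ∀ x ∈ D, 1 ≤ f x) {C : Set (ℝ × ℝ)} (hC : Convex ℝ C)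
    (hball : ∀ q : ℝ × ℝ, |q.1| + |q.2| ≤ α * R / 2 - 2 → q ∈ C)
    (hCΛ : ∀ w, SameClass w (p, 0) → pos w ∈ C → w ∈ Λ)
    {a₀ b₀ a₁ b₁ : ℤ} (ha₀ : |(a₀ : ℝ)| ≤ α * R / 32 + 1) (hb₀ : |(b₀ : ℝ)| ≤ α * R / 32 + 1)
    (hL₁ : η * R / 2 ≤ |(a₁ : ℝ) - a₀|) (hL₂ : |(a₁ : ℝ) - a₀| ≤ A * R)
    (hb : |(b₁ : ℝ) - b₀| ≤ A * R)
    (hendC : ∀ b : ℝ, |b - b₁| ≤ 2 * (ζ * R) → framePos t ε p a₁ b ∈ C)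
    (hendD : ∀ b : ℤ, |(b : ℝ) - b₁| ≤ 2 * (ζ * R) → frame t ε p a₁ b ∈ D)
    (hheight : if t then η * R ≤ b₀ ∧ 3 * (ζ * R) ≤ b₁ else η * R ≤ a₀ ∧ (0 : ℝ) ≤ a₁) :
    Real.exp (-κ) * (1 - Real.exp (-(κ * θ))) ≤ f (frame t ε p a₀ b₀) := by
  have hα := h.α_pos
  have hη := h.η_pos
  have hζ := h.ζ_pos
  have hA := h.one_le_A
  have hK := h.one_lt_K
  have hθ := h.θ_pos
  have hκ := h.κ_pos
  have hR := h.R_pos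
  have hR2 := h.R_large₂
  have hR3 := h.R_large₃
  have hζη : 64 * (ζ * R) ≤ η * R := by have := mul_le_mul_of_nonneg_right h.ζ_le_η hR.le; linarith
  have hζα : 64 * (ζ * R) ≤ α * R := by have := mul_le_mul_of_nonneg_right h.ζ_le_α hR.le; linarith
  set ω := ζ * R with hω
  have hω0 : 0 < ω := mul_pos hζ hR
  set L := |(a₁ : ℝ) - a₀| with hL
  have hL0 : 0 < L := lt_of_lt_of_le (by positivity) hL₁
  have hne : (a₁ : ℝ) - a₀ ≠ 0 := abs_pos.1 hL0
  obtain ⟨σ, hσ, hLσ⟩ : ∃ σ : ℤ, σ ^ 2 = 1 ∧ L = (σ * (a₁ - a₀) : ℤ) := by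
    rcases abs_cases ((a₁ : ℝ) - a₀) with ⟨h, _⟩ | ⟨h, _⟩
    · exact ⟨1, by norm_num, by rw [hL, h]; push_cast; ring⟩
    · exact ⟨-1, by norm_num, by rw [hL, h]; push_cast; ring⟩
  have hσ' : (σ : ℝ) ^ 2 = 1 := by exact_mod_cast hσ
  have hσabs : |(σ : ℝ)| = 1 := by
    rw [← sq_eq_sq₀ (abs_nonneg _) zero_le_one, sq_abs, hσ', one_pow]
  set k : ℝ := (b₁ - b₀) / (a₁ - a₀) with hk
  have hkmul : k * (a₁ - a₀) = b₁ - b₀ := div_mul_cancel₀ _ hne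
  have hkabs : |k| ≤ K - 1 := by
    rw [hk, abs_div, div_le_iff₀ hL0]
    refine hb.trans ?_
    have : (K - 1) * (η * R / 2) = A * R := by linear_combination (R / 2) * h.K_eq
    rw [← this]
    exact mul_le_mul_of_nonneg_left hL₁ (by linarith)
  have hk2 : 1 + k ^ 2 ≤ K ^ 2 := by
    have : k ^ 2 ≤ (K - 1) ^ 2 := sq_le_sq' (by linarith [(abs_le.1 hkabs).1])
      (by linarith [(abs_le.1 hkabs).2])
    nlinarith
  have hθL : θ * L * K ≤ ω := by
    calc θ * L * K ≤ θ * (A * R) * K := by gcongr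
      _ = ω := by rw [hω, ← h.θ_eq]; ring
  have hθ1 : θ ≤ 1 := by
    have h1 : θ * 1 ≤ θ * (A * K) := by
      refine mul_le_mul_of_nonneg_left ?_ hθ.le
      nlinarith
    have h2 := h.θ_eq
    have h3 := h.ζ_le_α
    have h4 := h.α_le
    linarith
  -- coordinates of the points of the tube
  have hcoord : ∀ a b : ℤ, -(θ * L) - 1 ≤ ((σ * (a - a₀) : ℤ) : ℝ) →
      ((σ * (a - a₀) : ℤ) : ℝ) ≤ L → ∀ Y : ℝ, Y = (b : ℝ) - b₀ - k * (a - a₀) →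
      (∃ u : ℝ, u = ((σ * (a - a₀) : ℤ) : ℝ) / L ∧ 0 ≤ u ∧ u ≤ 1 ∧
        (a : ℝ) = (1 - u) * a₀ + u * a₁ ∧ (b : ℝ) = (1 - u) * (b₀ + Y) + u * (b₁ + Y)) ∨
      (|(a : ℝ) - a₀| ≤ θ * L + 1 ∧ |(b : ℝ) - b₀| ≤ (K - 1) * (θ * L + 1) + |Y|) := by
    intro a b hT1 hT2 Y hY
    rcases le_or_gt 0 ((σ * (a - a₀) : ℤ) : ℝ) with h0 | h0
    · left
      set u := ((σ * (a - a₀) : ℤ) : ℝ) / L with hu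
      have h1 : u * (a₁ - a₀) = a - a₀ := by
        have h3 : (a₁ : ℝ) - a₀ = σ * L := by
          rw [hLσ]; push_cast; linear_combination (-((a₁ : ℝ) - a₀)) * hσ'
        rw [h3, hu]
        push_cast
        field_simp
        linear_combination ((a : ℝ) - a₀) * hσ'
      refine ⟨u, rfl, by positivity, (div_le_one hL0).2 hT2, by linarith, ?_⟩
      have h2 : u * (b₁ - b₀) = k * (a - a₀) := by rw [← hkmul, ← h1]; ring
      rw [hY]
      linarith
    · right
      have h1 : |(a : ℝ) - a₀| ≤ θ * L + 1 := by
        have h2 : |((σ * (a - a₀) : ℤ) : ℝ)| = |(a : ℝ) - a₀| := by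
          push_cast
          rw [abs_mul, hσabs, one_mul]
        rw [← h2, abs_of_neg h0]
        linarith
      refine ⟨h1, ?_⟩
      have h2 : (b : ℝ) - b₀ = k * (a - a₀) + Y := by rw [hY]; ring
      rw [h2]
      refine (abs_add_le _ _).trans ?_
      rw [abs_mul]
      gcongr
  -- the enlarged tube is contained in the domain
  have hmem : ∀ a b : ℤ, -(θ * L) - 1 ≤ ((σ * (a - a₀) : ℤ) : ℝ) →
      ((σ * (a - a₀) : ℤ) : ℝ) ≤ L → |(b : ℝ) - b₀ - k * (a - a₀)| ≤ 2 * ω →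
      frame t ε p a b ∈ Λ := by
    intro a b hT1 hT2 hY
    refine hCΛ _ (sameClass_frame t ε p a b) ?_
    rw [pos_frame]
    set Y : ℝ := (b : ℝ) - b₀ - k * (a - a₀) with hYdef
    rcases hcoord a b hT1 hT2 Y hYdef with ⟨u, _, hu0, hu1, ha, hb'⟩ | ⟨ha, hb'⟩
    · rw [ha, hb', framePos_combo]
      refine hC (hball _ ?_) (hendC _ (by simpa using hY)) (by linarith) hu0 (by ring)
      refine (framePos_norm_le t hε hp _ _).trans ?_
      have := abs_add_le (b₀ : ℝ) Y
      linarith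
    · refine hball _ ((framePos_norm_le t hε hp _ _).trans ?_)
      have h1 : |(a : ℝ)| ≤ |(a₀ : ℝ)| + |(a : ℝ) - a₀| := by
        have := abs_add_le (a₀ : ℝ) (a - a₀)
        rwa [add_sub_cancel] at this
      have h2 : |(b : ℝ)| ≤ |(b₀ : ℝ)| + |(b : ℝ) - b₀| := by
        have := abs_add_le (b₀ : ℝ) (b - b₀)
        rwa [add_sub_cancel] at this
      have h3 : θ * L + 1 + ((K - 1) * (θ * L + 1)) = θ * L * K + K := by ring
      linarith
  refine tube_lower_bound (φ := fun a b => f (frame t ε p a b)) (fun a b => hf _) hσ hL0 hLσ hkmul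
    hω0 hκ hθ hθ1 ?_ ?_ (fun a b hT hg => ?_) fun b hb' => hD _ (hendD b hb')
  · calc 4 * L ^ 2 * (1 + k ^ 2) ^ 2 ≤ 4 * (A * R) ^ 2 * (K ^ 2) ^ 2 := by gcongr
      _ < 5 * (A * R) ^ 2 * (K ^ 2) ^ 2 := by gcongr; norm_num
      _ = (5 * A ^ 2 * K ^ 4) * R ^ 2 := by ring
      _ = κ * ω ^ 2 := by rw [← h.κ_eq, hω]; ring
  · calc 2 * κ * (1 + k ^ 2) ≤ 2 * κ * K ^ 2 := by gcongr
      _ ≤ ω ^ 2 := h.R_large₁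
  · simp only [tubeExp] at hg
    set Y : ℝ := (b : ℝ) - b₀ - k * (a - a₀) with hYdef
    have hY0 : 0 ≤ Y ^ 2 / ω ^ 2 := by positivity
    have hT0 : -(θ * L) < ((σ * (a - a₀) : ℤ) : ℝ) := by
      rw [← neg_mul, ← lt_div_iff₀ hL0]; linarith
    have hT1 : ((σ * (a - a₀) : ℤ) : ℝ) / L < 1 := by rwa [div_lt_one hL0]
    -- The constant `3 / 2` exceeds `√2`. The remaining `ω / 2` up to the width `2 ω` of `hmem`
    -- exceeds the shift of the transverse coordinate in one step, since `K ≤ ω / 2`; so all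
    -- neighbours stay in the domain.
    have hY1 : |Y| < 3 / 2 * ω := by
      refine abs_lt_of_sq_lt_sq ?_ (by positivity)
      have : Y ^ 2 / ω ^ 2 < 2 := by linarith
      rw [div_lt_iff₀ (by positivity)] at this
      nlinarith
    -- `L` is an integer, so lying strictly before the end leaves room for a full step.
    have hT2 : ((σ * (a - a₀) : ℤ) : ℝ) + 1 ≤ L := by
      rw [hLσ] at hT ⊢
      have : σ * (a - a₀) < σ * (a₁ - a₀) := by exact_mod_cast hT
      exact_mod_cast this
    have hσle := abs_le.1 hσabs.le
    have hkle := abs_le.1 hkabs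
    have hYle := abs_lt.1 hY1
    have c1 : ((σ * (a + 1 - a₀) : ℤ) : ℝ) = ((σ * (a - a₀) : ℤ) : ℝ) + σ := by push_cast; ring
    have c2 : ((σ * (a - 1 - a₀) : ℤ) : ℝ) = ((σ * (a - a₀) : ℤ) : ℝ) - σ := by push_cast; ring
    have y1 : (b : ℝ) - b₀ - k * (((a + 1 : ℤ) : ℝ) - a₀) = Y - k := by
      rw [hYdef]; push_cast; ring
    have y2 : (b : ℝ) - b₀ - k * (((a - 1 : ℤ) : ℝ) - a₀) = Y + k := by
      rw [hYdef]; push_cast; ring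
    have m1 := hmem (a + 1) b (by rw [c1]; linarith only [hT0, hσle.1])
      (by rw [c1]; linarith only [hT2, hσle.2])
      (by rw [y1, abs_le]; constructor <;> linarith only [hYle.1, hYle.2, hkle.1, hkle.2, hR2])
    have m2 := hmem (a - 1) b (by rw [c2]; linarith only [hT0, hσle.2])
      (by rw [c2]; linarith only [hT2, hσle.1])
      (by rw [y2, abs_le]; constructor <;> linarith only [hYle.1, hYle.2, hkle.1, hkle.2, hR2])
    have m3 := hmem a (b + 1) (by linarith) (by linarith)
      (by rw [abs_le]; push_cast; constructor <;> linarith)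
    have m4 := hmem a (b - 1) (by linarith) (by linarith)
      (by rw [abs_le]; push_cast; constructor <;> linarith)
    have m0 := hmem a b (by linarith) (by linarith) (by linarith)
    rw [frame_nbr_sum hε f rfl]
    refine hsup _ m0 ?_ ?_
    · rintro ⟨_, y, hy1, hy2⟩
      rcases latticeNbr_frame hε hy1 with h | h | h | h <;> rw [h] at hy2 <;> contradiction
    -- The tube stays off the real line. For a vertical segment the axis is at height at least `3 ω`
    -- and the half-width is below `3 ω / 2`. For a horizontal one the height interpolates between
    -- `η R` and `a₁ ≥ 0`, and the end is excluded. Behind the start it changes by at most `ω + K`,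
    -- much less than `η R`.
    · have hheight' : (0 : ℝ) < if t then (b : ℝ) else a := by
        have hθLK : θ * L + (K - 1) * (θ * L + 1) ≤ ω + K := by nlinarith
        have hθL0 : 0 ≤ θ * L := by positivity
        rcases hcoord a b (by linarith) hT.le Y hYdef with ⟨u, hu, hu0, hu1, ha, hb'⟩ | ⟨ha, hb'⟩
        · cases t
          · simp only [Bool.false_eq_true, if_false] at hheight ⊢
            have h3 : u < 1 := hu ▸ hT1
            have h4 : 0 < (1 - u) * (a₀ : ℝ) :=
              mul_pos (by linarith) (by have := mul_pos hη hR; linarith [hheight.1])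
            have h5 := mul_nonneg hu0 hheight.2
            linarith
          · simp only [if_true] at hheight ⊢
            have h3 : (1 - u) * (3 * ω) ≤ (1 - u) * b₀ :=
              mul_le_mul_of_nonneg_left (by linarith [hheight.1]) (by linarith)
            have h4 : u * (3 * ω) ≤ u * b₁ := mul_le_mul_of_nonneg_left hheight.2 hu0
            linarith
        · cases t
          · simp only [Bool.false_eq_true, if_false] at hheight ⊢
            have := (abs_le.1 ha).1
            have h3 : 0 ≤ (K - 1) * (θ * L + 1) := mul_nonneg (by linarith) (by linarith)
            linarith [hheight.1]
          · simp only [if_true] at hheight ⊢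
            have := (abs_le.1 hb').1
            linarith [hheight.1]
      intro h0
      have hε0 : ε ≠ 0 := by rintro rfl; simp at hε
      cases t
      · simp only [frame, Bool.false_eq_true, if_false] at h0 hheight'
        rcases mul_eq_zero.1 h0 with h | h
        · exact hε0 h
        · rw [h] at hheight'; simp at hheight'
      · simp only [frame, if_true] at h0 hheight'
        rcases mul_eq_zero.1 h0 with h | h
        · exact hε0 h
        · rw [h] at hheight'; simp at hheight'

/-- `A R` bounds both coordinate differences of the tube and `K - 1` its slope, as the tube is at
least `η R / 2` long across the segment. The choice of `θ` keeps the part behind the start within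
distance `ω = ζ R`. The factor `5` in `κ` exceeds the `4` required for strict subharmonicity. -/
lemma exists_tubeScale {α η : ℝ} (hα : 0 < α) (hα1 : α ≤ 1) (hη : 0 < η) :
    ∃ ζ K θ κ R₀ : ℝ, 0 < κ ∧ 0 < θ ∧ ∀ R ≥ R₀, TubeScale α η ζ (4 / α) K θ κ R := by
  set ζ := min α η / 64 with hζ
  have hζ0 : 0 < ζ := by positivity
  have hA : 1 ≤ 4 / α := by rw [le_div_iff₀ hα]; linarith
  have hA0 : 0 < 4 / α := by positivity
  generalize 4 / α = A at *
  set K := 1 + 2 * A / η with hK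
  have hK0 : 0 < K := by positivity
  set θ := ζ / (A * K) with hθ
  set κ := 5 * A ^ 2 * K ^ 4 / ζ ^ 2 with hκ
  have hκ0 : 0 < κ := by positivity
  refine ⟨ζ, K, θ, κ, max ((2 * κ * K ^ 2 + 1) / ζ) (max (2 * K / ζ) (32 / α)), hκ0, by positivity,
    fun R hR => ?_⟩
  have h1 := (le_max_left _ _).trans hR
  have h2 := ((le_max_left _ _).trans (le_max_right _ _)).trans hR
  have h3 := ((le_max_right _ _).trans (le_max_right _ _)).trans hR
  rw [div_le_iff₀' hζ0] at h1 h2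
  have h3' := h3
  rw [div_le_iff₀' hα] at h3
  have h4 := min_le_left α η
  have h5 := min_le_right α η
  have h6 : 0 ≤ 2 * κ * K ^ 2 := by positivity
  refine ⟨hα, hα1, hη, hζ0, by rw [hζ]; linarith, by rw [hζ]; linarith, hA, ?_, ?_, ?_,
    lt_of_lt_of_le (by positivity) h3', ?_, h2, h3⟩
  · rw [hK]; field_simp; ring
  · rw [hθ]; field_simp
  · rw [hκ]; field_simp
  · nlinarith

/-- The hull of the vertices `(± 2 M, 0)` and `(0, ± M)`, with `M = ⌊r / 4⌋`, is a full `ℓ¹` ball of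
radius `2 M` in the plane. The vertical coordinate is doubled by `pos`. -/
lemma mem_of_l1_le_of_convex {C : Set (ℝ × ℝ)} (hC : Convex ℝ C) {r : ℝ} (hr : 2 < r)
    (hball : ∀ v : Vertex, l1dist v 0 < r → pos v ∈ C) (q : ℝ × ℝ)
    (hq : |q.1| + |q.2| ≤ r / 2 - 2) : q ∈ C := by
  set M : ℤ := ⌊r / 4⌋ with hM
  have hM1 : (M : ℝ) ≤ r / 4 := Int.floor_le _
  have hM2 : r / 4 < M + 1 := Int.lt_floor_add_one _
  have hM0 : (0 : ℝ) ≤ M := by exact_mod_cast Int.floor_nonneg.2 (by linarith)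
  have hc : |q.1| + |q.2| ≤ 2 * M := by linarith
  have hz : ((0 : ℝ), (0 : ℝ)) ∈ C := by
    simpa [pos] using hball 0 (by simp [l1dist, pos]; linarith)
  have hx : ∀ e : ℤ, |(e : ℝ)| = 1 → ((e : ℝ) * (2 * M), (0 : ℝ)) ∈ C := fun e he => by
    have := hball (e * (2 * M), 0) (by
      simp only [l1dist, pos]; push_cast
      simp [abs_mul, he, abs_of_nonneg hM0]; linarith)
    simpa [pos] using this
  have hy : ∀ e : ℤ, |(e : ℝ)| = 1 → ((0 : ℝ), (e : ℝ) * (2 * M)) ∈ C := fun e he => by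
    have := hball (0, e * M) (by
      simp only [l1dist, pos]; push_cast
      simp [abs_mul, he, abs_of_nonneg hM0]; linarith)
    simp only [pos] at this
    convert this using 2
    · simp
    · push_cast; ring
  have hsgn : ∀ u : ℝ, ∃ e : ℤ, |(e : ℝ)| = 1 ∧ |u| * e = u := fun u => by
    rcases abs_cases u with ⟨h, _⟩ | ⟨h, _⟩
    · exact ⟨1, by simp, by simp [h]⟩
    · exact ⟨-1, by simp, by simp [h]⟩
  obtain ⟨e, he, he'⟩ := hsgn q.1
  obtain ⟨e', hee, hee'⟩ := hsgn q.2
  rcases eq_or_lt_of_le (add_nonneg (abs_nonneg q.1) (abs_nonneg q.2)) with h0 | h0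
  · have h1 : q.1 = 0 := abs_eq_zero.1 (by linarith [abs_nonneg q.1, abs_nonneg q.2])
    have h2 : q.2 = 0 := abs_eq_zero.1 (by linarith [abs_nonneg q.1, abs_nonneg q.2])
    rwa [show q = (0, 0) from Prod.ext h1 h2]
  · set s := |q.1| + |q.2| with hs
    have hM' : (0 : ℝ) < M := by linarith
    have h1 := hC (hx e he) (hy e' hee) (a := |q.1| / s) (b := |q.2| / s) (by positivity)
      (by positivity) (by rw [← add_div, ← hs, div_self h0.ne'])
    have h2 := hC hz h1 (a := 1 - s / (2 * M)) (b := s / (2 * M))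
      (by rw [sub_nonneg, div_le_one (by positivity)]; exact hc) (by positivity) (by ring)
    convert h2 using 1
    ext
    · simp only [Prod.smul_mk, Prod.mk_add_mk, smul_eq_mul]
      field_simp
      linear_combination -(2 * (M : ℝ)) * he'
    · simp only [Prod.smul_mk, Prod.mk_add_mk, smul_eq_mul]
      field_simp
      linear_combination -(2 * (M : ℝ)) * hee'

lemma framePos_mem_of_endpoints {C : Set (ℝ × ℝ)} (hC : Convex ℝ C) {t : Bool} {ε p a bl : ℤ} {N : ℕ}
    (h : ∀ b : ℤ, bl ≤ b → b ≤ bl + N → framePos t ε p a b ∈ C) {b : ℝ} (h1 : bl ≤ b)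
    (h2 : b ≤ bl + N) : framePos t ε p a b ∈ C := by
  rcases Nat.eq_zero_or_pos N with rfl | hN
  · have : b = bl := le_antisymm (by simpa using h2) h1
    rw [this]
    exact h bl le_rfl (by simp)
  · have hN' : (0 : ℝ) < N := by exact_mod_cast hN
    have e1 := h bl le_rfl (by simp)
    have e2 := h (bl + N) (by simp) le_rfl
    have e3 := hC e1 e2 (a := 1 - (b - bl) / N) (b := (b - bl) / N)
      (by rw [sub_nonneg, div_le_one hN']; linarith) (div_nonneg (by linarith) hN'.le) (by ring)
    rw [← framePos_combo] at e3
    convert e3 using 1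
    congr 1
    · ring
    · push_cast; field_simp; ring

/-- The given segment may be much longer than `α R`, so only `N + 1` of its vertices are kept, among
them one at distance at most `R / α`. The sign `ε` selects the half-plane that contains a horizontal
segment, or the midpoint of a vertical one. -/
lemma IsDirichletDomain.exists_frame_segment {α R : ℝ} {Λ D : Set Vertex}
    (h : IsDirichletDomain α R Λ D) (hR : 1 < R) {p : ℤ} (hp : |p| ≤ 1) {N : ℕ}
    (hN : ∀ n : ℕ, α * R ≤ 2 * (n : ℝ) → N ≤ n) :
    ∃ (t : Bool) (ε a₁ bl : ℤ) (C : Set (ℝ × ℝ)), |ε| = 1 ∧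
      (∀ b : ℤ, bl ≤ b → b ≤ bl + N → frame t ε p a₁ b ∈ D) ∧
      (if t then 0 ≤ 2 * bl + N else 0 ≤ a₁) ∧ 2 * |(a₁ : ℝ)| ≤ R / α ∧
      (∃ b : ℤ, bl ≤ b ∧ b ≤ bl + N ∧ 2 * |(b : ℝ)| ≤ R / α) ∧
      Convex ℝ C ∧ (∀ v : Vertex, l1dist v 0 < α * R → pos v ∈ C) ∧
      (∀ w, SameClass w (p, 0) → pos w ∈ C → w ∈ Λ) ∧
      ∀ b : ℤ, bl ≤ b → b ≤ bl + N → framePos t ε p a₁ b ∈ C := by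
  have hp' : |(p : ℝ)| ≤ 1 := by exact_mod_cast hp
  obtain ⟨d, y, n, hy, hD, hn, ⟨v, ⟨i₀, hi₀, hv⟩, hvR⟩, hhull⟩ :=
    h.macroscopic (p, 0) (h.ball_subset (by simp [l1dist, pos]; linarith))
  have hNn := hN n hn
  obtain ⟨c, hc⟩ : ∃ c : ℤ, y.1 = p + 2 * c := by
    obtain ⟨c, hc⟩ := hy
    exact ⟨c, by simp only at hc; omega⟩
  -- A window of length `N` inside the segment that contains the nearby vertex.
  obtain ⟨i₁, hi₁, hi₁', hi₁n⟩ : ∃ i₁ : ℕ, i₁ ≤ i₀ ∧ i₀ ≤ i₁ + N ∧ i₁ + N ≤ n :=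
    ⟨min i₀ (n - N), by omega, by omega, by omega⟩
  suffices hmain : ∃ (t : Bool) (ε a₁ bl : ℤ), |ε| = 1 ∧
      (∀ b : ℤ, bl ≤ b → b ≤ bl + N → frame t ε p a₁ b ∈ latticeSegment d y n) ∧
      (if t then 0 ≤ 2 * bl + N else 0 ≤ a₁) ∧ 2 * |(a₁ : ℝ)| ≤ R / α ∧
      (∃ b : ℤ, bl ≤ b ∧ b ≤ bl + N ∧ 2 * |(b : ℝ)| ≤ R / α) by
    obtain ⟨t, ε, a₁, bl, h1, h2, h3, h4, h5⟩ := hmain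
    refine ⟨t, ε, a₁, bl, _, h1, fun b hb hb' => hD (h2 b hb hb'), h3, h4, h5,
      convex_convexHull ℝ (pos '' (latticeSegment d y n ∪ {v | l1dist v 0 < α * R})),
      fun v hv => subset_convexHull _ _ ⟨v, Or.inr hv, rfl⟩, fun w hw hwC => hhull w ?_ hwC,
      fun b hb hb' => ?_⟩
    · simp only [SameClass] at hw hy ⊢
      have := hw.sub hy
      simp only [sub_sub_sub_cancel_right] at this
      exact this
    · rw [← pos_frame]
      exact subset_convexHull _ _ ⟨_, Or.inl (h2 b hb hb'), rfl⟩
  have hsgn : ∀ u : ℤ, ∃ e : ℤ, |e| = 1 ∧ 0 ≤ e * u ∧ e * e = 1 := fun u => by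
    rcases le_total 0 u with h | h
    · exact ⟨1, by simp, by simpa, by simp⟩
    · exact ⟨-1, by simp, by simpa, by simp⟩
  have habs : ∀ e : ℤ, |e| = 1 → |(e : ℝ)| = 1 := fun e he => by exact_mod_cast he
  rw [hv] at hvR
  cases d
  · simp only [l1dist, pos, Bool.false_eq_true, if_false, hc] at hvR
    push_cast at hvR
    rw [show (p : ℝ) - (p + 2 * c) = -(2 * c) by ring, show 2 * (0 : ℝ) - 2 * (y.2 + i₀) =
      -(2 * (y.2 + i₀)) by ring, abs_neg, abs_neg, abs_mul, abs_mul, abs_two] at hvR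
    obtain ⟨ε, hε, hε0, hεε⟩ := hsgn (2 * (y.2 + i₁) + N)
    have hb1 := abs_nonneg (c : ℝ)
    have hb2 := abs_nonneg ((y.2 : ℝ) + i₀)
    refine ⟨true, ε, c, if ε = 1 then y.2 + i₁ else -(y.2 + i₁ + N), hε, fun b hb hb' => ?_, ?_,
      by linarith, ε * (y.2 + i₀), ?_, ?_, ?_⟩
    · rcases abs_eq (zero_le_one' ℤ) |>.1 hε with rfl | rfl
      · simp only [if_true] at hb hb'
        refine ⟨(b - y.2).toNat, by omega, ?_⟩
        simp only [frame, if_true, Bool.false_eq_true, if_false, hc, Prod.mk.injEq, true_and]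
        omega
      · rw [if_neg (by norm_num)] at hb hb'
        refine ⟨(-b - y.2).toNat, by omega, ?_⟩
        simp only [frame, if_true, Bool.false_eq_true, if_false, hc, Prod.mk.injEq, true_and]
        omega
    · simp only [if_true]
      rcases abs_eq (zero_le_one' ℤ) |>.1 hε with rfl | rfl
      · simp only [if_true]; omega
      · rw [if_neg (by norm_num)]; omega
    · rcases abs_eq (zero_le_one' ℤ) |>.1 hε with rfl | rfl
      · simp only [if_true]; omega
      · rw [if_neg (by norm_num)]; omega
    · rcases abs_eq (zero_le_one' ℤ) |>.1 hε with rfl | rfl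
      · simp only [if_true]; omega
      · rw [if_neg (by norm_num)]; omega
    · push_cast
      rw [abs_mul, habs ε hε]
      linarith
  · simp only [l1dist, pos, if_true, hc] at hvR
    push_cast at hvR
    rw [show (p : ℝ) - (p + 2 * c + 2 * i₀) = -(2 * (c + i₀)) by ring, show 2 * (0 : ℝ) - 2 * y.2 =
      -(2 * y.2) by ring, abs_neg, abs_neg, abs_mul, abs_mul, abs_two] at hvR
    obtain ⟨ε, hε, hε0, hεε⟩ := hsgn y.2
    have hb1 := abs_nonneg (y.2 : ℝ)
    have hb2 := abs_nonneg ((c : ℝ) + i₀)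
    refine ⟨false, ε, ε * y.2, c + i₁, hε, fun b hb hb' => ?_, by simpa, ?_, c + i₀, by omega,
      by omega, by push_cast; linarith⟩
    · refine ⟨(b - c).toNat, by omega, ?_⟩
      simp only [frame, if_true, Bool.false_eq_true, if_false, hc, Prod.mk.injEq]
      refine ⟨by omega, by rw [← mul_assoc, hεε, one_mul]⟩
    · push_cast
      rw [abs_mul, habs ε hε]
      linarith

/-- A nonnegative function which is superharmonic off the real line in the interior of the domain, and
at least one on the Dirichlet boundary, is bounded below, after symmetrisation and outside thin
strips, on a box of radius comparable to `R`. -/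
theorem exists_dirichlet_lower_bound {α η : ℝ} (hα : 0 < α) (hα1 : α ≤ 1) (hη : 0 < η) :
    ∃ δ > 0, ∃ R₀ : ℝ, ∀ R ≥ R₀, ∀ Λ D : Set Vertex, IsDirichletDomain α R Λ D →
      ∀ p : ℤ, |p| ≤ 1 → ∃ (t : Bool) (m : ℤ), ∀ f : Vertex → ℝ, (∀ x, 0 ≤ f x) →
        (∀ x ∈ Λ, x ∉ innerBoundary Λ → x.2 ≠ 0 →
          f (x.1 + 2, x.2) + f (x.1 - 2, x.2) + f (x.1, x.2 + 1) + f (x.1, x.2 - 1) ≤ 4 * f x) →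
        (∀ x ∈ D, 1 ≤ f x) →
        ∀ w : Vertex, SameClass w (p, 0) → |(w.1 : ℝ)| ≤ α * R / 32 → |(w.2 : ℝ)| ≤ α * R / 32 →
          η * R ≤ |(w.2 : ℝ)| →
          (if t then 2 * (η * R) ≤ |(w.1 : ℝ) - m| else η * R ≤ abs (|(w.2 : ℝ)| - m)) →
          δ ≤ f w + f (reflect w) := by
  obtain ⟨ζ, K, θ, κ, R₀, hκ, hθ, hscale⟩ := exists_tubeScale hα hα1 hη
  refine ⟨Real.exp (-κ) * (1 - Real.exp (-(κ * θ))), mul_pos (Real.exp_pos _) ?_, R₀, ?_⟩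
  · rw [sub_pos, Real.exp_lt_one_iff]
    have := mul_pos hκ hθ
    linarith
  intro R hR Λ D hdom p hp
  have hs := hscale R hR
  have hR0 := hs.R_pos
  have hαR := hs.R_large₃
  have hαR1 : α * R ≤ R := mul_le_of_le_one_left hR0.le hα1
  have hRα : R ≤ R / α := by rw [le_div_iff₀ hα]; linarith
  have hp' : |(p : ℝ)| ≤ 1 := by exact_mod_cast hp
  set N := ⌈α * R / 2⌉₊ with hN
  have hN1 : α * R / 2 ≤ N := Nat.le_ceil _
  have hN2 : (N : ℝ) < α * R / 2 + 1 := Nat.ceil_lt_add_one (by linarith)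
  obtain ⟨t, ε, a₁, bl, C, hε, hsegD, hhalf, ha₁, ⟨bs, hbs1, hbs2, hbs3⟩, hC, hball, hCΛ, hsegC⟩ :=
    hdom.exists_frame_segment (by linarith) hp (N := N)
      fun n hn => Nat.ceil_le.2 (by linarith)
  refine ⟨t, if t then p + 2 * a₁ else a₁, fun f hf hsup hD w hw hw1 hw2 hw3 hw4 => ?_⟩
  obtain ⟨c, hc⟩ : ∃ c : ℤ, w.1 = p + 2 * c := by
    obtain ⟨c, hc⟩ := hw
    exact ⟨c, by simp only at hc; omega⟩
  -- Aim at the three-quarter point: it is about `N / 4` from the far end, and also above the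
  -- midpoint, so in the vertical case its height is of order `α R`, at least `3 ζ R`.
  set b₁ : ℤ := bl + N / 2 + N / 4 with hb₁
  have hq1 : (N : ℤ) ≤ 2 * (N / 2 : ℤ) + 1 := by omega
  have hq2 : (N : ℤ) ≤ 4 * (N / 4 : ℤ) + 3 := by omega
  have hq3 : 2 * (N / 2 : ℤ) ≤ N := by omega
  have hq4 : 4 * (N / 4 : ℤ) ≤ N := by omega
  have hb₁' : (b₁ : ℝ) = bl + ((N / 2 : ℤ) : ℝ) + ((N / 4 : ℤ) : ℝ) := by
    rw [hb₁, Int.cast_add, Int.cast_add]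
  have hr1 : (N : ℝ) ≤ 2 * ((N / 2 : ℤ) : ℝ) + 1 := by exact_mod_cast hq1
  have hr2 : (N : ℝ) ≤ 4 * ((N / 4 : ℤ) : ℝ) + 3 := by exact_mod_cast hq2
  have hr3 : 2 * ((N / 2 : ℤ) : ℝ) ≤ N := by exact_mod_cast hq3
  have hr4 : 4 * ((N / 4 : ℤ) : ℝ) ≤ N := by exact_mod_cast hq4
  have hζα : 64 * (ζ * R) ≤ α * R := by
    have := mul_le_mul_of_nonneg_right hs.ζ_le_α hR0.le; linarith
  have hbs1' : (bl : ℝ) ≤ bs := by exact_mod_cast hbs1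
  have hbs2' : (bs : ℝ) ≤ bl + N := by exact_mod_cast hbs2
  have hb₁abs : |(b₁ : ℝ)| ≤ R / α / 2 + N := by
    have h1 := abs_le.1 (show |(bs : ℝ)| ≤ R / α / 2 by linarith)
    rw [abs_le]
    constructor <;> linarith
  have hA : 4 / α * R = 4 * (R / α) := by ring
  have hrange : ∀ b : ℝ, |b - b₁| ≤ 2 * (ζ * R) → (bl : ℝ) ≤ b ∧ b ≤ bl + N := fun b hb => by
    have := abs_le.1 hb
    constructor <;> linarith
  have hcabs : |(c : ℝ)| ≤ α * R / 32 + 1 := by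
    have h1 := abs_le.1 hw1
    have h2 := abs_le.1 hp'
    rw [hc] at h1
    push_cast at h1
    rw [abs_le]
    constructor <;> linarith [h1.1, h1.2]
  have hw2' : |(((|w.2| : ℤ)) : ℝ)| ≤ α * R / 32 + 1 := by
    push_cast
    rw [abs_abs]
    linarith
  set a₀ := if t then c else |w.2| with ha₀
  set b₀ := if t then |w.2| else c with hb₀
  have hframe : frame t ε p a₀ b₀ = (w.1, ε * |w.2|) := by
    cases t <;> simp [frame, ha₀, hb₀, hc]
  have ha₀' : |(a₀ : ℝ)| ≤ α * R / 32 + 1 := by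
    rw [ha₀]; split_ifs <;> assumption
  have hb₀' : |(b₀ : ℝ)| ≤ α * R / 32 + 1 := by
    rw [hb₀]; split_ifs <;> assumption
  have key := frame_lower_bound hs (t := t) hε hp hf hsup hD hC
    (mem_of_l1_le_of_convex hC (by linarith) hball) hCΛ ha₀' hb₀' (a₁ := a₁) (b₁ := b₁)
    (by
      have hηR : 0 < η * R := mul_pos hη hR0
      cases t
      · simp only [Bool.false_eq_true, if_false] at hw4 ha₀
        rw [ha₀, abs_sub_comm]
        push_cast
        linarith
      · simp only [if_true] at hw4 ha₀
        rw [hc] at hw4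
        push_cast at hw4
        rw [show (p : ℝ) + 2 * c - (p + 2 * a₁) = 2 * (c - a₁) by ring, abs_mul, abs_two,
          abs_sub_comm] at hw4
        rw [ha₀]
        linarith)
    (by
      have := abs_sub (a₁ : ℝ) a₀
      linarith)
    (by
      have := abs_sub (b₁ : ℝ) b₀
      linarith)
    (fun b hb => framePos_mem_of_endpoints hC hsegC (hrange b hb).1 (hrange b hb).2)
    (fun b hb => hsegD b (by exact_mod_cast (hrange b hb).1) (by exact_mod_cast (hrange b hb).2))
    (by
      cases t
      · simp only [Bool.false_eq_true, if_false] at hhalf ha₀ ⊢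
        rw [ha₀]
        push_cast
        exact ⟨hw3, by exact_mod_cast hhalf⟩
      · simp only [if_true] at hhalf hb₀ ⊢
        rw [hb₀]
        push_cast
        have : (0 : ℝ) ≤ 2 * bl + N := by exact_mod_cast hhalf
        exact ⟨hw3, by linarith⟩)
  rw [hframe] at key
  -- The tube starts in the half-plane of the segment, hence at `w` or at its mirror image.
  have hcases : ((w.1, ε * |w.2|) : Vertex) = w ∨ ((w.1, ε * |w.2|) : Vertex) = reflect w := by
    simp only [reflect, Prod.ext_iff]
    rcases abs_eq (zero_le_one' ℤ) |>.1 hε with rfl | rfl <;> rcases abs_cases w.2 with ⟨h, _⟩ | ⟨h, _⟩ <;>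
      rw [h] <;> simp
  rcases hcases with h | h <;> rw [h] at key
  · linarith [hf (reflect w)]
  · linarith [hf w]

/-! ### Logarithmic bound for the Green's function of the domain -/

lemma IsDirichletDomain.mono {α α' R : ℝ} {Λ D : Set Vertex} (h : IsDirichletDomain α R Λ D)
    (hα' : 0 < α') (hle : α' ≤ α) (hR : 0 ≤ R) : IsDirichletDomain α' R Λ D where
  ball_subset := h.ball_subset
  dirichlet_subset := h.dirichlet_subset
  macroscopic x hx := by
    obtain ⟨b, y, n, h1, h2, h3, ⟨w, hw, hwR⟩, h5⟩ := h.macroscopic x hx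
    have hαR : α' * R ≤ α * R := mul_le_mul_of_nonneg_right hle hR
    refine ⟨b, y, n, h1, h2, hαR.trans h3,
      ⟨w, hw, hwR.trans (div_le_div_of_nonneg_left hR hα' hle)⟩, fun v hv hvC => h5 v hv ?_⟩
    refine convexHull_mono (Set.image_mono (Set.union_subset_union_right _ ?_)) hvC
    exact fun v hv => lt_of_lt_of_le hv hαR

/-- The vertical coordinate counts double, so the box lies in the `ℓ¹` ball of radius `3 r`;
neighbours add at most `2`. -/
lemma IsDirichletDomain.mem_of_mem_box {α R : ℝ} {Λ D : Set Vertex}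
    (h : IsDirichletDomain α R Λ D) {r : ℕ} (hr : 3 * (r : ℝ) + 2 < R) {x : Vertex}
    (hx : x ∈ box r) : x ∈ Λ ∧ x ∉ innerBoundary Λ := by
  have hx' := mem_box.1 hx
  have h1 : |(x.1 : ℝ)| ≤ r := by exact_mod_cast hx'.1
  have h2 : |(x.2 : ℝ)| ≤ r := by exact_mod_cast hx'.2
  have hball : ∀ y : Vertex, |(y.1 : ℝ)| + 2 * |(y.2 : ℝ)| ≤ 3 * r + 2 → y ∈ Λ := fun y hy => by
    refine h.ball_subset ?_
    simp only [Set.mem_ofPred_eq, l1dist, pos, Prod.fst_zero, Prod.snd_zero, Int.cast_zero, sub_zero,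
      mul_zero, abs_mul, abs_two]
    linarith
  refine ⟨hball x (by linarith), ?_⟩
  rintro ⟨-, y, hy, hyΛ⟩
  refine hyΛ (hball y ?_)
  rcases hy with ⟨e2, e1⟩ | ⟨e1, e2⟩
  · have : |(y.1 : ℝ)| ≤ |(x.1 : ℝ)| + 2 := by
      rcases e1 with e | e <;> rw [e] <;> push_cast
      · simpa using abs_add_le (x.1 : ℝ) 2
      · simpa using abs_sub (x.1 : ℝ) 2
    rw [e2]
    linarith
  · have : |(y.2 : ℝ)| ≤ |(x.2 : ℝ)| + 1 := by
      rcases e2 with e | e <;> rw [e] <;> push_cast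
      · simpa using abs_add_le (x.2 : ℝ) 1
      · simpa using abs_sub (x.2 : ℝ) 1
    rw [e1]
    linarith

lemma IsWalkIn.isSubstochastic {P K : Vertex → Vertex → ℝ} {Λ D : Set Vertex}
    (h : IsWalkIn P Λ D K) : IsSubstochastic K := ⟨h.nonneg, h.summable, h.sum_le_one⟩

lemma IsWalkIn.boxKernel_le {P K : Vertex → Vertex → ℝ} {Λ D : Set Vertex}
    (h : IsWalkIn P Λ D K) {r : ℕ} (hbox : ∀ x ∈ box r, x ∈ Λ ∧ x ∉ innerBoundary Λ)
    (x y : Vertex) : boxKernel r P x y ≤ K x y := by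
  unfold boxKernel
  split_ifs with hxy
  · rw [h.interior x (hbox x hxy.1).1 (hbox x hxy.1).2 y (hbox y hxy.2).1]
  · exact h.nonneg x y

/-- Values outside the box are lost as soon as the kernel acts once, hence the condition `n ≠ 0`. -/
lemma iterate_boxKernel_mono {K : Vertex → Vertex → ℝ} (hK : IsSubstochastic K) (r : ℕ)
    {f g : Vertex → ℝ} (hf : IsBddFun f) (hg : IsBddFun g) (hfg : ∀ y ∈ box r, f y ≤ g y) {n : ℕ}
    (hn : n ≠ 0) (x : Vertex) :
    (kerApply (boxKernel r K))^[n] f x ≤ (kerApply (boxKernel r K))^[n] g x := by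
  have hB := hK.boxKernel r
  obtain ⟨m, rfl⟩ := Nat.exists_eq_succ_of_ne_zero hn
  rw [Nat.succ_eq_add_one, Function.iterate_succ_apply, Function.iterate_succ_apply]
  refine hB.iterate_mono (hB.isBddFun_kerApply hf) (hB.isBddFun_kerApply hg) (fun y => ?_) m x
  refine hB.kerApply_mono_of_le hB hf hg fun w => ?_
  by_cases hw : w ∈ box r
  · exact mul_le_mul_of_nonneg_left (hfg w hw) (hB.nonneg y w)
  · simp [boxKernel, hw]

/-! #### The escape function -/

open Classical in
/-- Given the truncated Green's function `g` with value `a` at its pole, the function `1 - g / a` in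
the domain, extended by `1`. -/
noncomputable def escapeFun (Λ : Set Vertex) (g : Vertex → ℝ) (a : ℝ) (x : Vertex) : ℝ :=
  if x ∈ Λ then 1 - g x / a else 1

section

variable {P K : Vertex → Vertex → ℝ} {Λ D : Set Vertex} {N : ℕ} {o : Vertex}

lemma escapeFun_nonneg (hK : IsSubstochastic K) (h0 : 0 < truncGreen K N o o) (x : Vertex) :
    0 ≤ escapeFun Λ (truncGreen K N o) (truncGreen K N o o) x := by
  unfold escapeFun
  split_ifs
  · rw [sub_nonneg, div_le_one h0]
    exact hK.truncGreen_le_self N o x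
  · exact zero_le_one

lemma escapeFun_le_one (hK : IsSubstochastic K) (x : Vertex) :
    escapeFun Λ (truncGreen K N o) (truncGreen K N o o) x ≤ 1 := by
  unfold escapeFun
  split_ifs
  · have := div_nonneg (hK.truncGreen_nonneg N o x) (hK.truncGreen_nonneg N o o)
    linarith
  · exact le_rfl

lemma isBddFun_escapeFun (hK : IsSubstochastic K) (h0 : 0 < truncGreen K N o o) :
    IsBddFun (escapeFun Λ (truncGreen K N o) (truncGreen K N o o)) :=
  IsBddFun.of_nonneg_of_le (escapeFun_nonneg hK h0) (escapeFun_le_one hK)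

lemma truncGreen_eq_zero_of_killed (h : IsWalkIn P Λ D K) (N : ℕ) {x : Vertex} (hx : x ∈ D)
    (hxo : x ≠ o) : truncGreen K N o x = 0 := by
  cases N with
  | zero => simp [truncGreen]
  | succ N =>
    rw [h.isSubstochastic.truncGreen_succ, indic, if_neg hxo, kerApply]
    simp [h.killed x hx]

lemma one_le_escapeFun (h : IsWalkIn P Λ D K) {x : Vertex} (hx : x ∈ D) (hxo : x ≠ o) :
    1 ≤ escapeFun Λ (truncGreen K N o) (truncGreen K N o o) x := by
  unfold escapeFun
  rw [truncGreen_eq_zero_of_killed h N hx hxo]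
  simp

/-- As `1 - f` is `g / a` in `Λ` and zero outside, `P (1 - f)` and `K g / a` agree at interior
points, jumps out of `Λ` included. The claim follows from the first step decomposition and the
monotonicity of the truncated Green's function in time. -/
lemma kerApply_escapeFun_le (hP : IsSubstochastic P) (h : IsWalkIn P Λ D K)
    (h0 : 0 < truncGreen K N o o) {x : Vertex} (hx : x ∈ Λ) (hx' : x ∉ innerBoundary Λ) :
    kerApply P (escapeFun Λ (truncGreen K N o) (truncGreen K N o o)) x ≤
      escapeFun Λ (truncGreen K N o) (truncGreen K N o o) x +
        (truncGreen K N o o)⁻¹ * indic o x := by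
  have hK := h.isSubstochastic
  set a := truncGreen K N o o with ha
  set f := escapeFun Λ (truncGreen K N o) a with hf
  have hfb : IsBddFun f := isBddFun_escapeFun hK h0
  have h1 : kerApply P (fun y => 1 - f y) x = a⁻¹ * kerApply K (truncGreen K N o) x := by
    rw [kerApply, kerApply, ← tsum_mul_left]
    refine tsum_congr fun y => ?_
    by_cases hy : y ∈ Λ
    · rw [h.interior x hx hx' y hy, hf, escapeFun, if_pos hy]
      ring
    · rw [h.eq_zero_of_notMem x y hy, hf, escapeFun, if_neg hy]
      ring
  have h2 : kerApply P (fun y => 1 - f y) x = kerApply P (fun _ => 1) x - kerApply P f x :=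
    hP.kerApply_sub (IsBddFun.const 1) hfb x
  have h3 : kerApply P (fun _ => 1) x ≤ 1 := hP.iterate_one_le 1 x
  have h4 := hK.truncGreen_succ N o x
  have h5 : truncGreen K N o x ≤ truncGreen K (N + 1) o x :=
    hK.truncGreen_mono o x (Nat.le_succ N)
  have h6 : f x = 1 - a⁻¹ * truncGreen K N o x := by
    rw [hf, escapeFun, if_pos hx]; ring
  have h7 : a⁻¹ * truncGreen K N o x ≤ a⁻¹ * (indic o x + kerApply K (truncGreen K N o) x) :=
    mul_le_mul_of_nonneg_left (by linarith) (inv_pos.2 h0).le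
  rw [h6]
  linarith

/-- The excess `c` over superharmonicity is paid once per visit to `o`. -/
lemma iterate_boxKernel_le_of_kerApply_le (hP : IsSubstochastic P) {r : ℕ} {f : Vertex → ℝ}
    (hfb : IsBddFun f) (hf : ∀ x, 0 ≤ f x) {c : ℝ} (hc : 0 ≤ c)
    (hsup : ∀ x ∈ box r, kerApply P f x ≤ f x + c * indic o x) (n : ℕ) (x : Vertex) :
    (kerApply (boxKernel r P))^[n] f x ≤ f x + c * truncGreen (boxKernel r P) n o x := by
  have hB := hP.boxKernel r
  have h1 : ∀ y, kerApply (boxKernel r P) f y ≤ f y + c * indic o y := fun y => by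
    by_cases hy : y ∈ box r
    · refine le_trans ?_ (hsup y hy)
      exact hB.kerApply_mono_of_le hP hfb hfb fun w =>
        mul_le_mul_of_nonneg_right (boxKernel_le hP.nonneg y w) (hf w)
    · have : kerApply (boxKernel r P) f y = 0 := by simp [kerApply, boxKernel, hy]
      rw [this]
      exact add_nonneg (hf y) (mul_nonneg hc (indic_nonneg o y))
  have hgb : ∀ m, IsBddFun fun y => c * truncGreen (boxKernel r P) m o y := fun m =>
    (hB.isBddFun_truncGreen m o).const_mul c
  induction n generalizing x with
  | zero => simp [truncGreen]
  | succ n ih =>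
    rw [Function.iterate_succ_apply']
    refine (hB.kerApply_mono (hB.isBddFun_iterate hfb n) (hfb.add (hgb n)) ih x).trans ?_
    rw [hB.kerApply_add hfb (hgb n), IsSubstochastic.kerApply_const_mul, hB.truncGreen_succ]
    linarith [h1 x]

end

/-! #### Thin strips -/

lemma card_filter_abs_sub_lt (r : ℕ) (m : ℤ) {d : ℝ} (hd : 0 ≤ d) :
    ((((Finset.Icc (-(r : ℤ)) r).filter fun k : ℤ => |(k : ℝ) - m| < d).card : ℕ) : ℝ) ≤
      2 * d + 1 := by
  have hsub : ((Finset.Icc (-(r : ℤ)) r).filter fun k : ℤ => |(k : ℝ) - m| < d) ⊆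
      Finset.Icc (m - ⌊d⌋₊) (m + ⌊d⌋₊) := fun k hk => by
    have h1 := (Finset.mem_filter.1 hk).2
    have h2 : (k - m).natAbs ≤ ⌊d⌋₊ := by
      refine Nat.le_floor ?_
      rw [Nat.cast_natAbs]
      push_cast
      exact h1.le
    rw [Finset.mem_Icc]
    omega
  have h1 := Finset.card_le_card hsub
  rw [Int.card_Icc] at h1
  have h2 : (m + ⌊d⌋₊ + 1 - (m - ⌊d⌋₊)).toNat = 2 * ⌊d⌋₊ + 1 := by omega
  rw [h2] at h1
  have h3 : ((((Finset.Icc (-(r : ℤ)) r).filter fun k : ℤ => |(k : ℝ) - m| < d).card : ℕ) : ℝ) ≤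
      2 * (⌊d⌋₊ : ℝ) + 1 := by exact_mod_cast h1
  linarith [Nat.floor_le hd]

/-- The starting points to be avoided are those almost in line with the target segment, for which
the tube would be too short: a strip around one column, or around the rows at heights `± m`. -/
lemma exists_strip (r : ℕ) (t : Bool) (m : ℤ) {d : ℝ} (hd : 0 ≤ d) :
    ∃ S : Finset Vertex, (S.card : ℝ) ≤ (2 * r + 1) * (4 * d + 2) ∧
      ∀ w ∈ box r, w ∉ S → if t then 2 * d ≤ |(w.1 : ℝ) - m| else d ≤ abs (|(w.2 : ℝ)| - m) := by
  have hI : ((Finset.Icc (-(r : ℤ)) r).card : ℝ) = 2 * r + 1 := by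
    rw [Int.card_Icc]
    have : ((r : ℤ) + 1 - -(r : ℤ)).toNat = 2 * r + 1 := by omega
    rw [this]
    push_cast
    ring
  have hr : (0 : ℝ) ≤ 2 * r + 1 := by positivity
  cases t
  · set F := fun m : ℤ => (Finset.Icc (-(r : ℤ)) r).filter fun k : ℤ => |(k : ℝ) - m| < d
    refine ⟨Finset.Icc (-(r : ℤ)) r ×ˢ (F m ∪ F (-m)), ?_, fun w hw hwS => ?_⟩
    · rw [Finset.card_product]
      push_cast
      rw [hI]
      refine mul_le_mul_of_nonneg_left ?_ hr
      have h1 : (((F m ∪ F (-m)).card : ℕ) : ℝ) ≤ (F m).card + (F (-m)).card := by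
        exact_mod_cast Finset.card_union_le _ _
      linarith [card_filter_abs_sub_lt r m hd, card_filter_abs_sub_lt r (-m) hd]
    · simp only [Bool.false_eq_true, if_false]
      by_contra hcon
      push Not at hcon
      obtain ⟨hw1, hw2⟩ := Finset.mem_product.1 hw
      refine hwS (Finset.mem_product.2 ⟨hw1, Finset.mem_union.2 ?_⟩)
      rcases abs_cases (w.2 : ℝ) with ⟨h, _⟩ | ⟨h, _⟩ <;> rw [h] at hcon
      · exact Or.inl (Finset.mem_filter.2 ⟨hw2, hcon⟩)
      · refine Or.inr (Finset.mem_filter.2 ⟨hw2, ?_⟩)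
        rw [abs_sub_comm] at hcon
        push_cast
        rwa [show (w.2 : ℝ) - -m = m - -w.2 by ring]
  · refine ⟨((Finset.Icc (-(r : ℤ)) r).filter fun k : ℤ => |(k : ℝ) - m| < 2 * d) ×ˢ
      Finset.Icc (-(r : ℤ)) r, ?_, fun w hw hwS => ?_⟩
    · rw [Finset.card_product]
      push_cast
      rw [hI, mul_comm]
      refine mul_le_mul_of_nonneg_left ?_ hr
      linarith [card_filter_abs_sub_lt r m (show 0 ≤ 2 * d by linarith)]
    · simp only [if_true]
      by_contra hcon
      push Not at hcon
      obtain ⟨hw1, hw2⟩ := Finset.mem_product.1 hw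
      exact hwS (Finset.mem_product.2 ⟨Finset.mem_filter.2 ⟨hw1, hcon⟩, hw2⟩)

section

variable {s : ℝ} {ν : ℤ → ℝ}

/-- The walk in a box, started on the real line, is often at vertices where `f` is bounded below. -/
lemma escape_lower_bound {δ d : ℝ} {r : ℕ} {f : Vertex → ℝ}
    (hs0 : 0 < s) (hs1 : s < 1) (hν : IsStepLaw ν) (hδ : 0 ≤ δ) (hd : 0 ≤ d)
    (hfb : IsBddFun f) (hf : ∀ x, 0 ≤ f x)
    (hgeo : ∀ p : ℤ, |p| ≤ 1 → ∃ (t : Bool) (m : ℤ), ∀ w ∈ box r, SameClass w (p, 0) →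
      d ≤ |(w.2 : ℝ)| →
      (if t then 2 * d ≤ |(w.1 : ℝ) - m| else d ≤ abs (|(w.2 : ℝ)| - m)) →
      δ ≤ f w + f (reflect w)) {C : ℝ} (hC0 : 0 ≤ C)
    (hC : ∀ (n : ℕ) (t : Finset Vertex) (x : Vertex),
      (kerApply (lazyKernel (stepKernel s ν)))^[n] (fun y => ∑ w ∈ t, indic w y) x ≤
        t.card * (C / (n + 1))) {T : ℕ} (hT : T ≠ 0)
    (hcard : 3 * ((2 * (r : ℝ) + 1) * (4 * d + 2)) * (C / (T + 1)) ≤ 1 / 4) {u : ℤ}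
    (hmass : 1 - (kerApply (boxKernel r (lazyKernel (stepKernel s ν))))^[T] (fun _ => 1) (u, 0) ≤
      1 / 4) :
    δ / 4 ≤ (kerApply (boxKernel r (lazyKernel (stepKernel s ν))))^[T] f (u, 0) := by
  classical
  have hP := isSubstochastic_lazy hs0 hs1 hν
  set P := lazyKernel (stepKernel s ν) with hPdef
  have hB := hP.boxKernel r
  -- Three exceptional strips: around the real line, and one for the segment of each class.
  obtain ⟨S₀, hS₀, hS₀'⟩ := exists_strip r false 0 hd
  obtain ⟨t₁, m₁, h₁⟩ := hgeo 0 (by norm_num)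
  obtain ⟨t₂, m₂, h₂⟩ := hgeo 1 (by norm_num)
  obtain ⟨S₁, hS₁, hS₁'⟩ := exists_strip r t₁ m₁ hd
  obtain ⟨S₂, hS₂, hS₂'⟩ := exists_strip r t₂ m₂ hd
  set S := S₀ ∪ S₁ ∪ S₂ with hS
  have hScard : (S.card : ℝ) ≤ 3 * ((2 * (r : ℝ) + 1) * (4 * d + 2)) := by
    have h1 : (S.card : ℝ) ≤ S₀.card + S₁.card + S₂.card := by
      exact_mod_cast (Finset.card_union_le _ _).trans
        (Nat.add_le_add_right (Finset.card_union_le _ _) _)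
    linarith
  have hgood : ∀ w ∈ box r, w ∉ S → δ ≤ f w + f (reflect w) := fun w hw hwS => by
    simp only [hS, Finset.mem_union, not_or] at hwS
    have h0 : d ≤ |(w.2 : ℝ)| := by simpa using hS₀' w hw hwS.1.1
    rcases Int.emod_two_eq_zero_or_one w.1 with h | h
    · exact h₁ w hw (by simp only [SameClass, sub_zero]; exact Int.even_iff.2 h) h0
        (hS₁' w hw hwS.1.2)
    · exact h₂ w hw (by simp only [SameClass]; exact Int.even_iff.2 (by omega)) h0
        (hS₂' w hw hwS.2)
  have hSb : IsBddFun fun y => ∑ w ∈ S, indic w y := IsBddFun.sum S fun w _ => isBddFun_indic w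
  have hS0 : ∀ y, 0 ≤ ∑ w ∈ S, indic w y := fun y => Finset.sum_nonneg fun w _ => indic_nonneg w y
  have hfr : IsBddFun fun y => f (reflect y) := by
    obtain ⟨M, hM⟩ := hfb
    exact ⟨M, fun y => hM _⟩
  -- By symmetry the mean of `f w + f (reflect w)` is twice that of `f`. The walk survives with
  -- probability at least `3 / 4` and is in the strips with probability at most `1 / 4`, which
  -- leaves `δ / 2`.
  have h3 := iterate_boxKernel_mono hP r (f := fun _ => δ * 1)
    (g := fun w => (f w + f (reflect w)) + δ * ∑ v ∈ S, indic v w) (IsBddFun.const _)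
    ((hfb.add hfr).add (hSb.const_mul δ)) (fun w hw => by
      by_cases hwS : w ∈ S
      · have h4 : 1 ≤ ∑ v ∈ S, indic v w := by
          refine le_trans ?_ (Finset.single_le_sum (f := fun v => indic v w)
            (fun v _ => indic_nonneg v w) hwS)
          simp [indic]
        have h5 := mul_le_mul_of_nonneg_left h4 hδ
        linarith [hf w, hf (reflect w)]
      · have := hgood w hw hwS
        have := mul_nonneg hδ (hS0 w)
        linarith) hT (u, 0)
  rw [IsSubstochastic.iterate_const_mul, hB.iterate_add (hfb.add hfr) (hSb.const_mul δ),
    hB.iterate_add hfb hfr, IsSubstochastic.iterate_const_mul, hPdef, iterate_boxKernel_reflect,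
    ← hPdef] at h3
  have hrefl : reflect (u, 0) = (u, 0) := by simp [reflect]
  rw [hrefl] at h3
  have h6 : (kerApply (boxKernel r P))^[T] (fun y => ∑ w ∈ S, indic w y) (u, 0) ≤ 1 / 4 := by
    refine (IsSubstochastic.iterate_le_of_kernel_le hP hB (boxKernel_le hP.nonneg) hSb hS0 T
      (u, 0)).trans ((hC T S (u, 0)).trans (le_trans ?_ hcard))
    exact mul_le_mul_of_nonneg_right hScard (by positivity)
  have h7 := mul_le_mul_of_nonneg_left h6 hδ
  have h8 := mul_le_mul_of_nonneg_left hmass hδ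
  linarith

/-- The scales in the proof of the logarithmic bound. -/
lemma exists_scales {α c η C u : ℝ} (hα : 0 < α) (hα1 : α ≤ 1) (hc : 0 < c) (hη : 0 < η)
    (hη1 : η * (13824 * C) ≤ α * c) (hC : 0 < C) :
    ∃ R₀ : ℝ, 1 ≤ R₀ ∧ ∀ R ≥ R₀, ∃ r : ℕ, 3 * (r : ℝ) + 2 < R ∧ (r : ℝ) ≤ α * R / 32 ∧
      4 * |u| ≤ r ∧ 1 ≤ c * (r : ℝ) ^ 2 ∧
      3 * ((2 * (r : ℝ) + 1) * (4 * (η * R) + 2)) * C ≤ 1 / 4 * (c * (r : ℝ) ^ 2) := by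
  refine ⟨64 / α + 1 / η + 256 * |u| / α + 64 / (α * c), ?_, fun R hR => ?_⟩
  · have h1 : 1 ≤ 64 / α := by rw [le_div_iff₀ hα]; linarith
    have h2 : 0 ≤ 1 / η + 256 * |u| / α + 64 / (α * c) := by positivity
    linarith
  have e1 : 0 < 64 / α := by positivity
  have e2 : 0 < 1 / η := by positivity
  have e3 : 0 ≤ 256 * |u| / α := by positivity
  have e4 : 0 < 64 / (α * c) := by positivity
  have h1 : 64 ≤ α * R := (div_le_iff₀' hα).1 (by linarith)
  have h2 : 1 ≤ η * R := (div_le_iff₀' hη).1 (by linarith)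
  have h3 : 256 * |u| ≤ α * R := (div_le_iff₀' hα).1 (by linarith)
  have h4 : 64 ≤ α * c * R := (div_le_iff₀' (by positivity)).1 (by linarith)
  have hR0 : 0 < R := by linarith
  have h5 : α * R ≤ R := mul_le_of_le_one_left hR0.le hα1
  set r := ⌊α * R / 32⌋₊ with hr
  have hr1 : (r : ℝ) ≤ α * R / 32 := Nat.floor_le (by positivity)
  have hr2 : α * R / 32 < r + 1 := Nat.lt_floor_add_one _
  have hr3 : α * R / 64 ≤ r := by linarith
  have hr4 : (1 : ℝ) ≤ r := by linarith
  refine ⟨r, by linarith, hr1, by linarith, ?_, ?_⟩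
  · have h6 : 1 ≤ c * r := by
      have := mul_le_mul_of_nonneg_left hr3 hc.le
      linarith
    nlinarith
  · have h6 : (2 * (r : ℝ) + 1) * (4 * (η * R) + 2) ≤ (3 * r) * (6 * (η * R)) := by
      gcongr <;> linarith
    have h7 : η * R * (α * (13824 * C)) ≤ η * (64 * r) * (13824 * C) := by
      have : α * R ≤ 64 * r := by linarith
      calc η * R * (α * (13824 * C)) = η * (α * R) * (13824 * C) := by ring
        _ ≤ _ := by gcongr
    have h8 : η * (64 * r) * (13824 * C) ≤ α * c * (64 * r) := by
      calc η * (64 * r) * (13824 * C) = η * (13824 * C) * (64 * r) := by ring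
        _ ≤ _ := by gcongr
    have h9 : η * R * (13824 * C) ≤ c * (64 * r) := by
      refine le_of_mul_le_mul_left ?_ hα
      linarith
    -- The constant `13824` is `4 * 54 * 64`: `54 = 3 * 3 * 6` from the strips, `4` from the target
    -- `1 / 4`, and `64` from `α R ≤ 64 r`.
    calc 3 * ((2 * (r : ℝ) + 1) * (4 * (η * R) + 2)) * C ≤ 3 * ((3 * r) * (6 * (η * R))) * C := by
          gcongr
      _ = r / 256 * (η * R * (13824 * C)) := by ring
      _ ≤ r / 256 * (c * (64 * r)) := by gcongr
      _ = 1 / 4 * (c * (r : ℝ) ^ 2) := by ring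

/-- The logarithmic bound for a pole on the real line. -/
theorem exists_truncGreen_line_le (hs0 : 0 < s) (hs1 : s < 1) (hν : IsStepLaw ν) {α : ℝ}
    (hα : 0 < α) (hα1 : α ≤ 1) (u : ℤ) :
    ∃ C > 0, ∃ R₀ : ℝ, ∀ R ≥ R₀, ∀ (Λ D : Set Vertex) (K : Vertex → Vertex → ℝ),
      IsDirichletDomain α R Λ D → IsWalkIn (lazyKernel (stepKernel s ν)) Λ D K →
      ∀ N : ℕ, truncGreen K N (u, 0) (u, 0) ≤ C * (1 + Real.log R) := by
  have hP := isSubstochastic_lazy hs0 hs1 hν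
  obtain ⟨C₁, hC₁, hlost⟩ := exists_lost_mass_le hs0 hs1 hν
  obtain ⟨C₂, hC₂, hgreen⟩ := exists_truncGreen_lazy_le hs0 hs1 hν
  obtain ⟨C₃, hC₃, hind⟩ := exists_iterate_indicator_le hs0 hs1 hν
  -- In time `c r ^ 2` the walk leaves the box with probability at most about `1 / 8`; the starting
  -- point accounts for another `1 / 8`.
  set c := min 1 (1 / (8 * C₁)) with hc
  have hc0 : 0 < c := by positivity
  have hc1 : c ≤ 1 := min_le_left _ _
  have hcC : C₁ * c ≤ 1 / 8 := by
    have h := mul_le_mul_of_nonneg_left (min_le_right 1 (1 / (8 * C₁))) hC₁.le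
    refine h.trans (le_of_eq ?_)
    field_simp
  set η := α * c / (13824 * C₃) with hη
  have hη0 : 0 < η := by positivity
  have hη1 : η * (13824 * C₃) ≤ α * c := by rw [hη]; exact (div_mul_cancel₀ _ (by positivity)).le
  obtain ⟨δ, hδ, R₁, hgeo⟩ := exists_dirichlet_lower_bound hα hα1 hη0
  obtain ⟨R₂, hR₂, hscale⟩ := exists_scales (u := u) hα hα1 hc0 hη0 hη1 hC₃
  refine ⟨4 / δ * (2 * C₂), by positivity, max R₁ R₂, fun R hR Λ D K hdom hK N => ?_⟩
  have hR1 := (le_max_left _ _).trans hR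
  have hR2 := (le_max_right _ _).trans hR
  have hR0 : 1 ≤ R := hR₂.trans hR2
  obtain ⟨r, hr1, hr2, hr3, hr4, hr5⟩ := hscale R hR2
  have hlogR : 0 ≤ Real.log R := Real.log_nonneg hR0
  have hu : |u| ≤ r := by
    have h : |((u : ℤ) : ℝ)| ≤ r := by linarith [abs_nonneg (u : ℝ)]
    exact_mod_cast h
  have hubox : ((u, 0) : Vertex) ∈ box r := by
    rw [mem_box]
    exact ⟨hu, by simp⟩
  have hbox : ∀ x ∈ box r, x ∈ Λ ∧ x ∉ innerBoundary Λ := fun x hx => hdom.mem_of_mem_box hr1 hx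
  rcases le_or_gt (truncGreen K N (u, 0) (u, 0)) 0 with h0 | h0
  · exact h0.trans (by positivity)
  set a := truncGreen K N (u, 0) (u, 0) with ha
  have hKs := hK.isSubstochastic
  set f := escapeFun Λ (truncGreen K N (u, 0)) a with hf
  have hfb : IsBddFun f := isBddFun_escapeFun hKs h0
  have hf0 : ∀ x, 0 ≤ f x := escapeFun_nonneg hKs h0
  have hsup : ∀ x ∈ Λ, x ∉ innerBoundary Λ → kerApply (lazyKernel (stepKernel s ν)) f x ≤
      f x + a⁻¹ * indic (u, 0) x := fun x hx hx' => kerApply_escapeFun_le hP hK h0 hx hx'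
  set T := ⌊c * (r : ℝ) ^ 2⌋₊ with hT
  have hT1 : (T : ℝ) ≤ c * (r : ℝ) ^ 2 := Nat.floor_le (by positivity)
  have hT2 : c * (r : ℝ) ^ 2 < T + 1 := Nat.lt_floor_add_one _
  have hT3 : 1 ≤ T := Nat.le_floor (by simpa using hr4)
  have hlow : δ / 4 ≤ (kerApply (boxKernel r (lazyKernel (stepKernel s ν))))^[T] f (u, 0) := by
    refine escape_lower_bound (d := η * R) hs0 hs1 hν hδ.le (by positivity) hfb hf0 (fun p hp => ?_)
      hC₃.le hind (by omega) ?_ ?_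
    · obtain ⟨t, m, h⟩ := hgeo R hR1 Λ D hdom p hp
      refine ⟨t, m, fun w hw hwc hw2 hwt => ?_⟩
      have hw' := mem_box.1 hw
      have hw1 : |(w.1 : ℝ)| ≤ r := by exact_mod_cast hw'.1
      have hw2' : |(w.2 : ℝ)| ≤ r := by exact_mod_cast hw'.2
      refine h f hf0 (fun x hx hx' hx2 => ?_) (fun x hx => one_le_escapeFun hK hx ?_) w hwc
        (hw1.trans hr2) (hw2'.trans hr2) hw2 hwt
      · have h1 := hsup x hx hx'
        have h2 := (hasSum_lazyKernel (hasSum_stepKernel_off s ν hx2 f)).tsum_eq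
        have h3 : indic (u, 0) x = 0 := if_neg (by rintro rfl; exact hx2 rfl)
        rw [kerApply, h2, h3] at h1
        linarith
      · rintro rfl
        exact (hbox _ hubox).2 (hdom.dirichlet_subset hx)
    · rw [← mul_div_assoc, div_le_iff₀ (by positivity)]
      exact hr5.trans (by gcongr)
    · refine (hlost r T (u, 0)).trans ?_
      rw [div_le_iff₀ (by positivity)]
      have h1 : sqNorm (u, 0) ≤ ((r : ℝ)) ^ 2 / 8 := by
        have h2 : (4 * |(u : ℝ)|) ^ 2 ≤ (r : ℝ) ^ 2 := by gcongr
        rw [mul_pow, sq_abs] at h2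
        simp only [sqNorm, Int.cast_zero]
        nlinarith [sq_nonneg (u : ℝ)]
      have h2 : C₁ * T ≤ (r : ℝ) ^ 2 / 8 := by
        calc C₁ * T ≤ C₁ * (c * (r : ℝ) ^ 2) := by gcongr
          _ = C₁ * c * (r : ℝ) ^ 2 := by ring
          _ ≤ 1 / 8 * (r : ℝ) ^ 2 := by gcongr
          _ = _ := by ring
      have h3 : (0 : ℝ) ≤ r := by positivity
      nlinarith
  -- The escape function vanishes at the pole, so its mean at time `T` is at most `1 / a` times a
  -- Green's function of the free walk; with `hlow` this bounds `a`.
  have hupp := iterate_boxKernel_le_of_kerApply_le (o := (u, 0)) hP hfb hf0 (inv_pos.2 h0).le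
    (fun x hx => hsup x (hbox x hx).1 (hbox x hx).2) T (u, 0)
  have hfo : f (u, 0) = 0 := by
    rw [hf, escapeFun, if_pos (hbox _ hubox).1, ← ha, div_self h0.ne', sub_self]
  have hgr : truncGreen (boxKernel r (lazyKernel (stepKernel s ν))) T (u, 0) (u, 0) ≤
      2 * C₂ * (1 + Real.log R) := by
    refine (hP.truncGreen_le_of_kernel_le (hP.boxKernel r) (boxKernel_le hP.nonneg) T _ _).trans
      ((hgreen T _ _).trans ?_)
    have h1 : Real.log T ≤ 2 * Real.log R := by
      have h2 : (T : ℝ) ≤ R ^ 2 := by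
        refine hT1.trans ((mul_le_of_le_one_left (by positivity) hc1).trans ?_)
        gcongr
        linarith
      have h3 := Real.log_le_log (by exact_mod_cast hT3) h2
      rwa [Real.log_pow] at h3
    have h4 : 1 + Real.log T ≤ 2 * (1 + Real.log R) := by linarith
    have := mul_le_mul_of_nonneg_left h4 hC₂.le
    linarith
  rw [hfo, zero_add] at hupp
  have h1 : δ / 4 ≤ a⁻¹ * (2 * C₂ * (1 + Real.log R)) :=
    hlow.trans (hupp.trans (mul_le_mul_of_nonneg_left hgr (inv_pos.2 h0).le))
  rw [inv_mul_eq_div, le_div_iff₀ h0] at h1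
  rw [show 4 / δ * (2 * C₂) * (1 + Real.log R) = 4 / δ * (2 * C₂ * (1 + Real.log R)) by ring]
  calc a = 4 / δ * (δ / 4 * a) := by field_simp
    _ ≤ _ := by gcongr

end

/-! ### Poles off the real line. -/

namespace IsSubstochastic

variable {K : Vertex → Vertex → ℝ}

lemma mul_nStep_le (hK : IsSubstochastic K) (n : ℕ) (x y z : Vertex) :
    K x y * nStep K n y z ≤ nStep K (n + 1) x z :=
  (hK.summable_mul (hK.isBddFun_nStep n z) x).le_tsum y
    fun w _ => mul_nonneg (hK.nonneg x w) (hK.nStep_nonneg n w z)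

lemma nStep_mul_le (hK : IsSubstochastic K) (n : ℕ) (x y z : Vertex) :
    nStep K n x y * K y z ≤ nStep K (n + 1) x z := by
  induction n generalizing x with
  | zero =>
    by_cases h : x = y
    · simp [nStep, h]
    · simp [nStep, h, hK.nonneg]
  | succ n ih =>
    rw [nStep, ← tsum_mul_right]
    refine Summable.tsum_le_tsum (fun w => ?_)
      ((hK.summable_mul (hK.isBddFun_nStep n y) x).mul_right _)
      (hK.summable_mul (hK.isBddFun_nStep (n + 1) z) x)
    rw [mul_assoc]
    exact mul_le_mul_of_nonneg_left (ih w) (hK.nonneg x w)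

/-- A loop at `y`, with a step from `x` before it and a step back after it, is a loop at `x` two
units longer. -/
lemma truncGreen_mul_le (hK : IsSubstochastic K) (N : ℕ) (x y : Vertex) :
    truncGreen K N y y * (K x y * K y x) ≤ truncGreen K (N + 2) x x := by
  rw [truncGreen, truncGreen, Finset.sum_range_succ', Finset.sum_range_succ', Finset.sum_mul]
  have h0 := hK.nStep_nonneg 0 x x
  have h1 := hK.nStep_nonneg (0 + 1) x x
  have h2 : ∑ i ∈ Finset.range N, nStep K i y y * (K x y * K y x) ≤
      ∑ i ∈ Finset.range N, nStep K (i + 1 + 1) x x := by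
    refine Finset.sum_le_sum fun i _ => ?_
    have h3 := mul_le_mul_of_nonneg_left (hK.nStep_mul_le i y y x) (hK.nonneg x y)
    have h4 := hK.mul_nStep_le (i + 1) x y x
    linarith
  linarith

end IsSubstochastic

section

variable {s : ℝ} {ν : ℤ → ℝ}

lemma lazyKernel_vertical_pos (hs0 : 0 < s) (u j j' : ℤ) (h : j' = j + 1 ∨ j' = j - 1) :
    0 < lazyKernel (stepKernel s ν) (u, j) (u, j') := by
  have hne : ((u, j) : Vertex) ≠ (u, j') := by
    simp only [ne_eq, Prod.mk.injEq, true_and]; omega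
  have hn : LatticeNbr (u, j) (u, j') := Or.inr ⟨rfl, h⟩
  rw [lazyKernel, if_neg hne, stepKernel, if_pos hn]
  dsimp only
  split_ifs with h1 h2
  · omega
  · positivity
  · positivity

/-- The truncated Green's functions of the walks in `Λ`, for all domains at scale `R`, are at most
logarithmic in `R`. -/
theorem exists_truncGreen_le (hs0 : 0 < s) (hs1 : s < 1) (hν : IsStepLaw ν) {α : ℝ}
    (hα : 0 < α) (hα1 : α ≤ 1) (o : Vertex) :
    ∃ C > 0, ∃ R₀ : ℝ, ∀ R ≥ R₀, ∀ (Λ D : Set Vertex) (K : Vertex → Vertex → ℝ),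
      IsDirichletDomain α R Λ D → IsWalkIn (lazyKernel (stepKernel s ν)) Λ D K →
      ∀ N : ℕ, truncGreen K N o o ≤ C * (1 + Real.log R) := by
  set Q : Vertex → Prop := fun o => ∃ C > 0, ∃ R₀ : ℝ, ∀ R ≥ R₀, ∀ (Λ D : Set Vertex)
    (K : Vertex → Vertex → ℝ), IsDirichletDomain α R Λ D →
      IsWalkIn (lazyKernel (stepKernel s ν)) Λ D K →
      ∀ N : ℕ, truncGreen K N o o ≤ C * (1 + Real.log R) with hQ
  have hstep : ∀ u j j' : ℤ, (j' = j + 1 ∨ j' = j - 1) → Q (u, j) → Q (u, j') := by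
    rintro u j j' hj ⟨C, hC, R₀, h⟩
    have hj' : j = j' + 1 ∨ j = j' - 1 := by omega
    have h1 := lazyKernel_vertical_pos (ν := ν) hs0 u j j' hj
    have h2 := lazyKernel_vertical_pos (ν := ν) hs0 u j' j hj'
    set a := lazyKernel (stepKernel s ν) (u, j) (u, j')
    set b := lazyKernel (stepKernel s ν) (u, j') (u, j)
    set r : ℕ := u.natAbs + j.natAbs + 1 with hr
    refine ⟨C / (a * b), by positivity, max R₀ (3 * (r : ℝ) + 3), fun R hR Λ D K hdom hK N => ?_⟩
    have hR1 := (le_max_left _ _).trans hR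
    have hR2 := (le_max_right _ _).trans hR
    have hbox : ∀ x ∈ box r, x ∈ Λ ∧ x ∉ innerBoundary Λ := fun x hx =>
      hdom.mem_of_mem_box (by linarith) hx
    have hx := hbox (u, j) (by simp only [mem_box, abs_le]; omega)
    have hy := hbox (u, j') (by simp only [mem_box, abs_le]; omega)
    have h3 := hK.isSubstochastic.truncGreen_mul_le N (u, j) (u, j')
    rw [hK.interior _ hx.1 hx.2 _ hy.1, hK.interior _ hy.1 hy.2 _ hx.1] at h3
    rw [div_mul_eq_mul_div, le_div_iff₀ (by positivity)]
    exact h3.trans (h R hR1 Λ D K hdom hK (N + 2))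
  obtain ⟨u, j⟩ := o
  change Q (u, j)
  induction j using Int.induction_on with
  | zero => exact exists_truncGreen_line_le hs0 hs1 hν hα hα1 u
  | succ n ih => exact hstep u _ _ (Or.inl rfl) ih
  | pred n ih => exact hstep u _ _ (Or.inr rfl) ih

/-! ### Comparison of the Green's function with the potential kernel -/

lemma abs_sub_le_of_common_lower {a b c e f : ℝ} (h1 : c ≤ a) (h2 : a ≤ c + e) (h3 : c ≤ b)
    (h4 : b ≤ c + f) : |a - b| ≤ e + f := by
  rw [abs_le]; constructor <;> linarith

/-- The gradient bound involves the squared norm of `g`, which is at most a constant times `M ^ 2`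
times the number of vertices of the box. -/
lemma exists_iterate_box_sub_le (hs0 : 0 < s) (hs1 : s < 1) (hν : IsStepLaw ν) (x x' : Vertex) :
    ∃ C : ℝ, 0 ≤ C ∧ ∀ (n r : ℕ) (g : Vertex → ℝ) (M : ℝ), (∀ y, 0 ≤ g y) → (∀ y, g y ≤ M) →
      (∀ y ∉ box r, g y = 0) →
      ((kerApply (lazyKernel (stepKernel s ν)))^[n] g x -
        (kerApply (lazyKernel (stepKernel s ν)))^[n] g x') ^ 2 ≤
        C / ((n + 1) * √(n + 1)) * (M * (2 * r + 1)) ^ 2 := by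
  have h := isReversible_stepKernel hs0 hs1 hν
  obtain ⟨C, hC0, hC⟩ := exists_iterate_sub_sq_le hs0 hs1 hν h x x'
  obtain ⟨m, hm⟩ := h.bdd
  have hm0 : 0 < m := (h.pi_pos 0).trans_le (hm 0)
  refine ⟨C * m, by positivity, fun n r g M hg0 hgM hgbox => ?_⟩
  have hsum : Summable g := summable_of_hasFiniteSupport
    ((box r).finite_toSet.subset fun y hy => by
      by_contra hcon
      exact hy (hgbox y hcon))
  have hkey := hC n ⟨g, hsum⟩
  rw [lazyOp_pow_apply] at hkey
  refine hkey.trans ?_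
  have hform : h.form ⟨g, hsum⟩ ⟨g, hsum⟩ ≤ m * (M * (2 * r + 1)) ^ 2 := by
    rw [h.form_apply, tsum_eq_sum (s := box r) fun y hy => by simp [hgbox y hy]]
    have hcard : ((box r).card : ℝ) = (2 * r + 1) ^ 2 := by
      rw [box, Finset.card_product, Int.card_Icc]
      have : ((r : ℤ) + 1 - -(r : ℤ)).toNat = 2 * r + 1 := by omega
      rw [this]
      push_cast
      ring
    refine (Finset.sum_le_card_nsmul _ _ (m * M * M) fun y _ => ?_).trans (le_of_eq ?_)
    · have hM0 : 0 ≤ M := (hg0 y).trans (hgM y)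
      have := hg0 y
      have := hgM y
      have := hm y
      have := (h.pi_pos y).le
      gcongr
    · rw [nsmul_eq_mul, hcard]; ring
  calc C / ((n + 1) * √(n + 1)) * h.form ⟨g, hsum⟩ ⟨g, hsum⟩ ≤
        C / ((n + 1) * √(n + 1)) * (m * (M * (2 * r + 1)) ^ 2) := by gcongr
    _ = _ := by ring

end

section

variable {s : ℝ} {ν : ℤ → ℝ}

/-- The box kernel lies below both `K` and `P`, so passing between these costs only lost mass. At
each point there are four replacements, one for each of `K` and `P` in each Markov term: three cost
`M * e` and one `M' * e`. -/
lemma abs_truncGreen_sub_le {P K : Vertex → Vertex → ℝ} {Λ D : Set Vertex}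
    (hP : IsSubstochastic P) (hK : IsWalkIn P Λ D K) {r : ℕ}
    (hbox : ∀ x ∈ box r, x ∈ Λ ∧ x ∉ innerBoundary Λ) {o : Vertex} {M M' : ℝ}
    (hM : ∀ N, truncGreen K N o o ≤ M) {T : ℕ} (hM' : truncGreen P T o o ≤ M') (hT : T ≠ 0)
    {x x' : Vertex} {a : ℝ}
    (hreg : ∀ g : Vertex → ℝ, (∀ y, 0 ≤ g y) → (∀ y, g y ≤ M) → (∀ y ∉ box r, g y = 0) →
      |(kerApply P)^[T] g x - (kerApply P)^[T] g x'| ≤ a) {e : ℝ}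
    (he : 1 - (kerApply (boxKernel r P))^[T] (fun _ => 1) x ≤ e)
    (he' : 1 - (kerApply (boxKernel r P))^[T] (fun _ => 1) x' ≤ e) (N : ℕ) :
    |truncGreen K (T + N) o x - truncGreen K (T + N) o x' -
      (truncGreen P T o x - truncGreen P T o x')| ≤ a + 2 * (3 * M + M') * e := by
  classical
  have hKs := hK.isSubstochastic
  have hB := hP.boxKernel r
  have hBP := boxKernel_le (r := r) hP.nonneg
  have hBK := hK.boxKernel_le hbox
  have hM0 : 0 ≤ M := (hKs.truncGreen_nonneg 0 o o).trans (hM 0)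
  have hM0' : 0 ≤ M' := (hP.truncGreen_nonneg T o o).trans hM'
  have hMx : ∀ n y, truncGreen K n o y ≤ M := fun n y => (hKs.truncGreen_le_self n o y).trans (hM n)
  have hMx' : ∀ y, truncGreen P T o y ≤ M' := fun y => (hP.truncGreen_le_self T o y).trans hM'
  set G := truncGreen K N o with hG
  have hGb : IsBddFun G := hKs.isBddFun_truncGreen N o
  have hG0 : ∀ y, 0 ≤ G y := hKs.truncGreen_nonneg N o
  set g : Vertex → ℝ := fun y => if y ∈ box r then G y else 0 with hg
  have hg0 : ∀ y, 0 ≤ g y := fun y => by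
    simp only [hg]; split_ifs
    · exact hG0 y
    · exact le_rfl
  have hgM : ∀ y, g y ≤ M := fun y => by
    simp only [hg]; split_ifs
    · exact hMx N y
    · exact hM0
  have hgb : IsBddFun g := IsBddFun.of_nonneg_of_le hg0 hgM
  have hgG : ∀ y ∈ box r, g y = G y := fun y hy => if_pos hy
  have hBg : ∀ y, (kerApply (boxKernel r P))^[T] G y = (kerApply (boxKernel r P))^[T] g y :=
    fun y => le_antisymm
      (iterate_boxKernel_mono hP r hGb hgb (fun w hw => (hgG w hw).ge) hT y)
      (iterate_boxKernel_mono hP r hgb hGb (fun w hw => (hgG w hw).le) hT y)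
  have hpoint : ∀ y, 1 - (kerApply (boxKernel r P))^[T] (fun _ => 1) y ≤ e →
      |truncGreen K (T + N) o y - (truncGreen P T o y + (kerApply P)^[T] g y)| ≤
        (3 * M + M') * e := by
    intro y hy
    rw [hKs.truncGreen_add, ← hG]
    have h1 := abs_sub_le_of_common_lower
      (hKs.truncGreen_le_of_kernel_le hB hBK T o y)
      (hKs.truncGreen_le_add_lost_mass hB hBK T o y hM0 (hMx T))
      (hP.truncGreen_le_of_kernel_le hB hBP T o y)
      ((hP.truncGreen_le_add_lost_mass hB hBP T o y hM0' hMx'))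
    have h2 := abs_sub_le_of_common_lower
      (IsSubstochastic.iterate_le_of_kernel_le hKs hB hBK hGb hG0 T y)
      (IsSubstochastic.iterate_le_add_lost_mass hKs hB hBK hGb hM0 (hMx N) T y)
      ((hBg y).le.trans (IsSubstochastic.iterate_le_of_kernel_le hP hB hBP hgb hg0 T y))
      ((IsSubstochastic.iterate_le_add_lost_mass hP hB hBP hgb hM0 hgM T y).trans_eq
        (by rw [hBg y]))
    have h3 := mul_le_mul_of_nonneg_left hy (show 0 ≤ 3 * M + M' by positivity)
    have h4 := abs_le.1 h1
    have h5 := abs_le.1 h2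
    rw [abs_le]
    constructor <;> linarith
  have h1 := abs_le.1 (hpoint x he)
  have h2 := abs_le.1 (hpoint x' he')
  have h3 := abs_le.1 (hreg g hg0 hgM fun y hy => if_neg hy)
  rw [abs_le]
  constructor <;> linarith

/-- The rate of convergence of the differences of the Green's function. -/
theorem exists_green_sub_le (hs0 : 0 < s) (hs1 : s < 1) (hν : IsStepLaw ν) {α : ℝ}
    (hα : 0 < α) (hα1 : α ≤ 1) (x x' o : Vertex) :
    ∃ C R₀ : ℝ, ∀ R ≥ R₀, ∀ (Λ D : Set Vertex) (K : Vertex → Vertex → ℝ),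
      IsDirichletDomain α R Λ D → IsWalkIn (lazyKernel (stepKernel s ν)) Λ D K →
      (Summable fun n : ℕ => nStep K n x o) ∧ (Summable fun n : ℕ => nStep K n x' o) ∧
      |green K x o - green K x' o -
        (truncGreen (lazyKernel (stepKernel s ν)) ⌊√√R ^ 7⌋₊ o x -
          truncGreen (lazyKernel (stepKernel s ν)) ⌊√√R ^ 7⌋₊ o x')| ≤
        C * ((1 + Real.log R) / √√R) := by
  have hP := isSubstochastic_lazy hs0 hs1 hν
  obtain ⟨C₁, hC₁, hlost⟩ := exists_lost_mass_le hs0 hs1 hν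
  obtain ⟨C₂, hC₂, hgreen⟩ := exists_truncGreen_lazy_le hs0 hs1 hν
  obtain ⟨C₃, hC₃, R₁, hlog⟩ := exists_truncGreen_le hs0 hs1 hν hα hα1 o
  obtain ⟨C₄, hC₄, hreg⟩ := exists_iterate_box_sub_le hs0 hs1 hν x x'
  set S := sqNorm x + sqNorm x' with hS
  have hSx := sqNorm_nonneg x
  have hSx' := sqNorm_nonneg x'
  refine ⟨√C₄ * C₃ + 2 * (3 * C₃ + 2 * C₂) * (64 * (S + C₁)), max R₁ 4,
    fun R hR Λ D K hdom hK => ?_⟩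
  have hR1 := (le_max_left _ _).trans hR
  have hR4 : 4 ≤ R := (le_max_right _ _).trans hR
  have hKs := hK.isSubstochastic
  set L := 1 + Real.log R with hL
  have hL0 : 0 ≤ L := by have := Real.log_nonneg (show (1 : ℝ) ≤ R by linarith); linarith
  set q := √√R with hq
  have hq1 : 1 ≤ q := Real.one_le_sqrt.2 (Real.one_le_sqrt.2 (by linarith))
  have hq0 : 0 < q := by linarith
  have hqR : q ^ 4 = R := by
    rw [show 4 = 2 * 2 by norm_num, pow_mul, hq, Real.sq_sqrt (Real.sqrt_nonneg _),
      Real.sq_sqrt (by linarith)]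
  -- With `q = R ^ (1 / 4)` this is `T ≈ R ^ (7 / 4)`. The lost mass `T / R ^ 2` requires `T` below
  -- `R ^ 2`, and the squared gradient `R ^ 2 / T ^ (3 / 2)` requires `T` above `R ^ (4 / 3)`.
  set T := ⌊q ^ 7⌋₊ with hT
  have hT1 : (T : ℝ) ≤ q ^ 7 := Nat.floor_le (by positivity)
  have hT2 : q ^ 7 < T + 1 := Nat.lt_floor_add_one _
  have hT3 : 1 ≤ T := Nat.le_floor (by simpa using one_le_pow₀ hq1)
  set r := ⌊R / 8⌋₊ with hr
  have hr1 : (r : ℝ) ≤ R / 8 := Nat.floor_le (by linarith)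
  have hr2 : R / 8 < r + 1 := Nat.lt_floor_add_one _
  have hbox : ∀ x ∈ box r, x ∈ Λ ∧ x ∉ innerBoundary Λ := fun x hx =>
    hdom.mem_of_mem_box (by linarith) hx
  have hM : ∀ N, truncGreen K N o o ≤ C₃ * L := hlog R hR1 Λ D K hdom hK
  have hsum : ∀ y, Summable fun n : ℕ => nStep K n y o := fun y =>
    summable_of_sum_range_le (fun n => hKs.nStep_nonneg n y o)
      fun n => (hKs.truncGreen_le_self n o y).trans (hM n)
  refine ⟨hsum x, hsum x', ?_⟩
  have hM' : truncGreen (lazyKernel (stepKernel s ν)) T o o ≤ 2 * C₂ * L := by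
    refine (hgreen T o o).trans ?_
    have h1 : Real.log T ≤ 2 * Real.log R := by
      have h2 : (T : ℝ) ≤ R ^ 2 := by
        rw [← hqR, ← pow_mul]
        exact hT1.trans (pow_le_pow_right₀ hq1 (by norm_num))
      have h3 := Real.log_le_log (by exact_mod_cast hT3) h2
      rwa [Real.log_pow] at h3
    have h4 : 1 + Real.log T ≤ 2 * L := by linarith
    have := mul_le_mul_of_nonneg_left h4 hC₂.le
    linarith
  have hmass : ∀ y, sqNorm y ≤ S →
      1 - (kerApply (boxKernel r (lazyKernel (stepKernel s ν))))^[T] (fun _ => 1) y ≤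
        64 * (S + C₁) / q := by
    intro y hy
    refine (hlost r T y).trans ?_
    have h1 : sqNorm y + C₁ * T ≤ (S + C₁) * q ^ 7 := by
      have h2 : S * 1 ≤ S * q ^ 7 := mul_le_mul_of_nonneg_left (one_le_pow₀ hq1) (by positivity)
      have h3 := mul_le_mul_of_nonneg_left hT1 hC₁.le
      linarith
    have h2 : (R / 8) ^ 2 ≤ ((r : ℝ) + 1) ^ 2 := by gcongr
    calc (sqNorm y + C₁ * T) / ((r : ℝ) + 1) ^ 2 ≤ (S + C₁) * q ^ 7 / (R / 8) ^ 2 := by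
          gcongr
      _ = _ := by rw [← hqR]; field_simp; norm_num
  have hreg' : ∀ g : Vertex → ℝ, (∀ y, 0 ≤ g y) → (∀ y, g y ≤ C₃ * L) → (∀ y ∉ box r, g y = 0) →
      |(kerApply (lazyKernel (stepKernel s ν)))^[T] g x -
        (kerApply (lazyKernel (stepKernel s ν)))^[T] g x'| ≤ √C₄ * (C₃ * L) / q := by
    intro g hg0 hgM hgb
    refine abs_le_of_sq_le_sq ((hreg T r g _ hg0 hgM hgb).trans ?_) (by positivity)
    have h1 : q ^ 3 ≤ √((T : ℝ) + 1) := by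
      refine Real.le_sqrt_of_sq_le ?_
      rw [← pow_mul]
      exact (pow_le_pow_right₀ hq1 (by norm_num)).trans hT2.le
    have h2 : q ^ 7 * q ^ 3 ≤ ((T : ℝ) + 1) * √((T : ℝ) + 1) := by gcongr
    have h3 : 2 * (r : ℝ) + 1 ≤ q ^ 4 := by rw [hqR]; linarith
    calc C₄ / (((T : ℝ) + 1) * √((T : ℝ) + 1)) * (C₃ * L * (2 * r + 1)) ^ 2 ≤
          C₄ / (q ^ 7 * q ^ 3) * (C₃ * L * q ^ 4) ^ 2 := by gcongr
      _ = (√C₄ * (C₃ * L) / q) ^ 2 := by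
          rw [div_pow, mul_pow √C₄, Real.sq_sqrt hC₄]
          field_simp
  have hmain := abs_truncGreen_sub_le hP hK hbox hM hM' (by omega) hreg'
    (hmass x (by linarith)) (hmass x' (by linarith))
  have hlim : ∀ y, Tendsto (fun N => truncGreen K (T + N) o y) atTop (𝓝 (green K y o)) := fun y =>
    (hsum y).hasSum.tendsto_sum_nat.comp (tendsto_add_atTop_nat T |>.congr fun n => add_comm _ _)
  refine le_of_tendsto
    ((((hlim x).sub (hlim x')).sub_const _).abs) (Eventually.of_forall fun N => ?_)
  refine (hmain N).trans (le_of_eq ?_)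
  field_simp

lemma tendsto_one_add_log_div_sqrt_sqrt :
    Tendsto (fun R : ℝ => (1 + Real.log R) / √√R) atTop (𝓝 0) := by
  have h1 : Tendsto (fun R : ℝ => √√R) atTop atTop :=
    Real.tendsto_sqrt_atTop.comp Real.tendsto_sqrt_atTop
  have h2 : Tendsto (fun q : ℝ => Real.log q / q) atTop (𝓝 0) :=
    Real.isLittleO_log_id_atTop.tendsto_div_nhds_zero
  have h3 : Tendsto (fun q : ℝ => q⁻¹ + 4 * (Real.log q / q)) atTop (𝓝 0) := by
    simpa using tendsto_inv_atTop_zero.add (h2.const_mul 4)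
  refine (h3.comp h1).congr' ?_
  filter_upwards [eventually_gt_atTop 0] with R hR
  have h4 : Real.log √√R = Real.log R / 4 := by
    rw [Real.log_sqrt (Real.sqrt_nonneg R), Real.log_sqrt hR.le]; ring
  simp only [Function.comp_apply, h4]
  ring

theorem tendsto_truncGreen_sub (hs0 : 0 < s) (hs1 : s < 1) (hν : IsStepLaw ν)
    (x x' o : Vertex) :
    Tendsto (fun n => truncGreen (lazyKernel (stepKernel s ν)) n o x -
      truncGreen (lazyKernel (stepKernel s ν)) n o x') atTop
      (𝓝 (-(lazyPotential (stepKernel s ν) x o - lazyPotential (stepKernel s ν) x' o))) := by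
  have h1 := (summable_lazyPotential hs0 hs1 hν x o).hasSum.tendsto_sum_nat
  have h2 := (summable_lazyPotential hs0 hs1 hν x' o).hasSum.tendsto_sum_nat
  have h3 := (h1.sub h2).neg
  refine h3.congr fun n => ?_
  simp only [truncGreen, Finset.sum_sub_distrib]
  ring

theorem tendsto_green_sub_lazy (hs0 : 0 < s) (hs1 : s < 1) (hν : IsStepLaw ν) {α : ℝ}
    (hα : 0 < α) {Λ D : ℝ → Set Vertex} (hdom : ∀ᶠ R in atTop, IsDirichletDomain α R (Λ R) (D R))
    (x x' o : Vertex) {K : ℝ → Vertex → Vertex → ℝ}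
    (hK : ∀ᶠ R in atTop, IsWalkIn (lazyKernel (stepKernel s ν)) (Λ R) (D R) (K R)) :
    (∀ᶠ R in atTop, Summable (fun n : ℕ => nStep (K R) n x o) ∧
      Summable (fun n : ℕ => nStep (K R) n x' o)) ∧
    Tendsto (fun R : ℝ => green (K R) x o - green (K R) x' o) atTop
      (𝓝 (-(lazyPotential (stepKernel s ν) x o - lazyPotential (stepKernel s ν) x' o))) := by
  -- The domain conditions weaken as the parameter decreases, so it may be taken to be at most one.
  obtain ⟨C, R₀, h⟩ := exists_green_sub_le hs0 hs1 hν (lt_min hα one_pos) (min_le_right α 1) x x' o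
  have hev := (((hdom.and hK).and (eventually_ge_atTop R₀)).and (eventually_ge_atTop 0)).mono
    fun R hR => h R hR.1.2 _ _ _ (hR.1.1.1.mono (lt_min hα one_pos) (min_le_left α 1) hR.2)
      hR.1.1.2
  refine ⟨hev.mono fun R hR => ⟨hR.1, hR.2.1⟩, ?_⟩
  have h1 : Tendsto (fun R : ℝ => ⌊√√R ^ 7⌋₊) atTop atTop :=
    tendsto_nat_floor_atTop.comp ((tendsto_pow_atTop (by norm_num)).comp
      (Real.tendsto_sqrt_atTop.comp Real.tendsto_sqrt_atTop))
  have h2 := (tendsto_truncGreen_sub hs0 hs1 hν x x' o).comp h1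
  have h3 : Tendsto (fun R : ℝ => C * ((1 + Real.log R) / √√R)) atTop (𝓝 0) := by
    simpa using tendsto_one_add_log_div_sqrt_sqrt.const_mul C
  have h4 := squeeze_zero_norm' (hev.mono fun R hR => (Real.norm_eq_abs _).trans_le hR.2.2) h3
  simpa using h4.add h2

end

/-! ### The nonlazy walk -/

open Classical in
/-- The lazy version of the walk `K` in `Λ`, killed on `D`. -/
noncomputable def lazyWalk (Λ D : Set Vertex) (K : Vertex → Vertex → ℝ) (x y : Vertex) : ℝ :=
  if x ∈ Λ ∧ x ∉ D then lazyKernel K x y else 0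

section

variable {P K : Vertex → Vertex → ℝ} {Λ D : Set Vertex} {o : Vertex}

/-- Holding is suppressed on `D`, where the walk must be killed, and outside `Λ`, which must not be
charged. -/
lemma isWalkIn_lazyWalk (hD : D ⊆ innerBoundary Λ) (h : IsWalkIn P Λ D K) :
    IsWalkIn (lazyKernel P) Λ D (lazyWalk Λ D K) := by
  have hrow : ∀ x, HasSum (lazyKernel K x) ((1 + ∑' y, K x y) / 2) := fun x => by
    have h1 := hasSum_lazyKernel (P := K) (x := x) (f := fun _ => 1) (a := ∑' y, K x y)
      (by simpa using (h.summable x).hasSum)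
    simpa using h1
  have hcases : ∀ x, lazyWalk Λ D K x = lazyKernel K x ∨ lazyWalk Λ D K x = 0 := fun x => by
    by_cases hx : x ∈ Λ ∧ x ∉ D
    · exact Or.inl (funext fun y => if_pos hx)
    · exact Or.inr (funext fun y => if_neg hx)
  refine ⟨fun x y => ?_, fun x => ?_, fun x => ?_, fun x y hy => ?_, fun x hx y => ?_,
    fun x hx hx' y hy => ?_⟩
  · rcases hcases x with e | e <;> rw [e]
    · exact lazyKernel_nonneg h.nonneg x y
    · exact le_rfl
  · rcases hcases x with e | e <;> rw [e]
    · exact (hrow x).summable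
    · exact summable_zero
  · rcases hcases x with e | e <;> rw [e]
    · rw [(hrow x).tsum_eq]
      linarith [h.sum_le_one x]
    · simp
  · unfold lazyWalk
    split_ifs with hx
    · have hxy : x ≠ y := by rintro rfl; exact hy hx.1
      simp [lazyKernel, hxy, h.eq_zero_of_notMem x y hy]
    · rfl
  · exact if_neg fun hc => hc.2 hx
  · rw [lazyWalk, if_pos ⟨hx, fun hc => hx' (hD hc)⟩, lazyKernel, lazyKernel,
      h.interior x hx hx' y hy]

lemma kerApply_lazyWalk (h : IsWalkIn P Λ D K) {f : Vertex → ℝ} (hf : IsBddFun f) {x : Vertex}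
    (hx : x ∈ Λ) (hxD : x ∉ D) : kerApply (lazyWalk Λ D K) f x = (f x + kerApply K f x) / 2 := by
  have h1 := hasSum_lazyKernel (h.isSubstochastic.summable_mul hf x).hasSum
  rw [← kerApply] at h1
  rw [← h1.tsum_eq, kerApply]
  exact tsum_congr fun y => by rw [lazyWalk, if_pos ⟨hx, hxD⟩]

lemma truncGreen_lazyWalk_le (hD : D ⊆ innerBoundary Λ) (h : IsWalkIn P Λ D K) (ho : o ∈ Λ)
    (hoD : o ∉ D) (N : ℕ) (x : Vertex) :
    truncGreen (lazyWalk Λ D K) N o x ≤ 2 * truncGreen K N o x := by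
  have hK := h.isSubstochastic
  have hL := (isWalkIn_lazyWalk hD h).isSubstochastic
  induction N generalizing x with
  | zero => simp [truncGreen]
  | succ N ih =>
    by_cases hx : x ∈ Λ ∧ x ∉ D
    · have hb := hL.isBddFun_truncGreen N o
      rw [hL.truncGreen_succ, kerApply_lazyWalk h hb hx.1 hx.2]
      have h1 := hK.kerApply_mono hb ((hK.isBddFun_truncGreen N o).const_mul 2) ih x
      rw [IsSubstochastic.kerApply_const_mul] at h1
      have h2 : truncGreen K N o x ≤ truncGreen K (N + 1) o x :=
        hK.truncGreen_mono o x (Nat.le_succ N)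
      have h3 := hK.truncGreen_succ N o x
      linarith [ih x]
    · have hxo : x ≠ o := by rintro rfl; exact hx ⟨ho, hoD⟩
      have h1 : truncGreen (lazyWalk Λ D K) (N + 1) o x = 0 := by
        rw [hL.truncGreen_succ, indic, if_neg hxo, kerApply]
        simp [lazyWalk, hx]
      rw [h1]
      have := hK.truncGreen_nonneg (N + 1) o x
      linarith

/-- Finiteness at the pole suffices, because every truncated Green's function is maximal there;
dominated convergence then passes the first step decomposition to the limit. -/
lemma IsSubstochastic.green_eq (hK : IsSubstochastic K) (hs : Summable fun n => nStep K n o o) :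
    (∀ x, Summable fun n => nStep K n x o) ∧ (∀ x, 0 ≤ green K x o) ∧
      (∀ x, green K x o ≤ green K o o) ∧
      ∀ x, green K x o = indic o x + kerApply K (fun y => green K y o) x := by
  have hle : ∀ n x, truncGreen K n o x ≤ green K o o := fun n x =>
    (hK.truncGreen_le_self n o x).trans
      (hs.sum_le_tsum _ fun i _ => hK.nStep_nonneg i o o)
  have hsum : ∀ x, Summable fun n => nStep K n x o := fun x =>
    summable_of_sum_range_le (fun n => hK.nStep_nonneg n x o) fun n => hle n x
  have hlim : ∀ x, Tendsto (fun n => truncGreen K n o x) atTop (𝓝 (green K x o)) := fun x =>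
    (hsum x).hasSum.tendsto_sum_nat
  refine ⟨hsum, fun x => tsum_nonneg fun n => hK.nStep_nonneg n x o,
    fun x => le_of_tendsto' (hlim x) fun n => hle n x, fun x => ?_⟩
  have h1 : Tendsto (fun n => kerApply K (truncGreen K n o) x) atTop
      (𝓝 (kerApply K (fun y => green K y o) x)) := by
    refine tendsto_tsum_of_dominated_convergence ((hK.summable x).mul_right (green K o o))
      (fun y => (hlim y).const_mul (K x y)) (Eventually.of_forall fun n y => ?_)
    rw [Real.norm_eq_abs, abs_of_nonneg (mul_nonneg (hK.nonneg x y) (hK.truncGreen_nonneg n o y))]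
    exact mul_le_mul_of_nonneg_left (hle n y) (hK.nonneg x y)
  refine tendsto_nhds_unique ((hlim x).comp (tendsto_add_atTop_nat 1)) ?_
  refine (h1.const_add (indic o x)).congr fun n => ?_
  exact (hK.truncGreen_succ n o x).symm

/-- Half the lazy Green's function solves the first step equation of the nonlazy walk off `D`, so by
induction it dominates every truncated Green's function of that walk. This gives finiteness and one
inequality; `truncGreen_lazyWalk_le` gives the other. -/
lemma green_lazyWalk (hD : D ⊆ innerBoundary Λ) (h : IsWalkIn P Λ D K) (ho : o ∈ Λ)
    (hoD : o ∉ D) (hs : Summable fun n => nStep (lazyWalk Λ D K) n o o) {x : Vertex} (hx : x ∈ Λ) :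
    (Summable fun n => nStep K n x o) ∧ green (lazyWalk Λ D K) x o = 2 * green K x o := by
  have hK := h.isSubstochastic
  have hL := (isWalkIn_lazyWalk hD h).isSubstochastic
  obtain ⟨hsum, hg0, hg1, hg⟩ := hL.green_eq hs
  have hgb : IsBddFun fun y => green (lazyWalk Λ D K) y o := IsBddFun.of_nonneg_of_le hg0 hg1
  have hle : ∀ N, ∀ y ∈ Λ, truncGreen K N o y ≤ 1 / 2 * green (lazyWalk Λ D K) y o := by
    intro N
    induction N with
    | zero => exact fun y _ => by simpa [truncGreen] using hg0 y
    | succ N ih =>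
      intro y hy
      by_cases hyD : y ∈ D
      · rw [truncGreen_eq_zero_of_killed h (N + 1) hyD (by rintro rfl; exact hoD hyD)]
        linarith [hg0 y]
      · have h1 := hg y
        rw [kerApply_lazyWalk h hgb hy hyD] at h1
        have h2 : kerApply K (truncGreen K N o) y ≤
            kerApply K (fun w => 1 / 2 * green (lazyWalk Λ D K) w o) y := by
          refine hK.kerApply_mono_of_le hK (hK.isBddFun_truncGreen N o) (hgb.const_mul _) fun w => ?_
          by_cases hw : w ∈ Λ
          · exact mul_le_mul_of_nonneg_left (ih w hw) (hK.nonneg y w)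
          · simp [h.eq_zero_of_notMem y w hw]
        rw [IsSubstochastic.kerApply_const_mul] at h2
        rw [hK.truncGreen_succ]
        linarith
  have hsx : Summable fun n => nStep K n x o :=
    summable_of_sum_range_le (fun n => hK.nStep_nonneg n x o) fun n => hle n x hx
  have hlim : Tendsto (fun n => truncGreen K n o x) atTop (𝓝 (green K x o)) :=
    hsx.hasSum.tendsto_sum_nat
  have hlim' : Tendsto (fun n => truncGreen (lazyWalk Λ D K) n o x) atTop
    (𝓝 (green (lazyWalk Λ D K) x o)) := (hsum x).hasSum.tendsto_sum_nat
  have h1 := le_of_tendsto' hlim fun n => hle n x hx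
  have h2 := le_of_tendsto_of_tendsto' hlim' (hlim.const_mul 2)
    fun n => truncGreen_lazyWalk_le hD h ho hoD n x
  exact ⟨hsx, by linarith⟩

end

theorem tendsto_green_sub {s : ℝ} {ν : ℤ → ℝ} (hs0 : 0 < s) (hs1 : s < 1) (hν : IsStepLaw ν)
    {α : ℝ} (hα : 0 < α) {Λ D : ℝ → Set Vertex}
    (hdom : ∀ᶠ R in atTop, IsDirichletDomain α R (Λ R) (D R))
    (x x' o : Vertex) {K : ℝ → Vertex → Vertex → ℝ}
    (hK : ∀ᶠ R in atTop, IsWalkIn (stepKernel s ν) (Λ R) (D R) (K R)) :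
    (∀ᶠ R in atTop, Summable (fun n : ℕ => nStep (K R) n x o) ∧
      Summable (fun n : ℕ => nStep (K R) n x' o)) ∧
    Tendsto (fun R : ℝ => green (K R) x o - green (K R) x' o) atTop
      (𝓝 (-(potential (stepKernel s ν) x o - potential (stepKernel s ν) x' o))) := by
  have hL : ∀ᶠ R in atTop,
      IsWalkIn (lazyKernel (stepKernel s ν)) (Λ R) (D R) (lazyWalk (Λ R) (D R) (K R)) :=
    (hdom.and hK).mono fun R hR => isWalkIn_lazyWalk hR.1.dirichlet_subset hR.2
  have hlazy := (tendsto_green_sub_lazy hs0 hs1 hν hα hdom x x' o hL).2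
  -- With all three vertices equal to `o`, this provides the summability at the pole that
  -- `green_lazyWalk` requires.
  have hsum := (tendsto_green_sub_lazy hs0 hs1 hν hα hdom o o o hL).1
  have hint : ∀ y : Vertex, ∀ᶠ R in atTop, y ∈ Λ R ∧ y ∉ innerBoundary (Λ R) := fun y => by
    filter_upwards [hdom, eventually_gt_atTop (3 * ((y.1.natAbs + y.2.natAbs : ℕ) : ℝ) + 2)]
      with R h1 h2
    exact h1.mem_of_mem_box h2 (by simp only [mem_box, abs_le]; omega)
  have hev : ∀ᶠ R in atTop, ((Summable fun n : ℕ => nStep (K R) n x o) ∧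
      green (lazyWalk (Λ R) (D R) (K R)) x o = 2 * green (K R) x o) ∧
      ((Summable fun n : ℕ => nStep (K R) n x' o) ∧
      green (lazyWalk (Λ R) (D R) (K R)) x' o = 2 * green (K R) x' o) := by
    filter_upwards [hdom, hK, hsum, hint x, hint x', hint o] with R h1 h2 h3 h4 h5 h6
    have hoD : o ∉ D R := fun hc => h6.2 (h1.dirichlet_subset hc)
    exact ⟨green_lazyWalk h1.dirichlet_subset h2 h6.1 hoD h3.1 h4.1,
      green_lazyWalk h1.dirichlet_subset h2 h6.1 hoD h3.1 h5.1⟩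
  refine ⟨hev.mono fun R hR => ⟨hR.1.1, hR.2.1⟩, ?_⟩
  have h1 : -(potential (stepKernel s ν) x o - potential (stepKernel s ν) x' o) =
      1 / 2 * -(lazyPotential (stepKernel s ν) x o - lazyPotential (stepKernel s ν) x' o) := by
    unfold potential
    ring
  rw [h1]
  refine (hlazy.const_mul (1 / 2)).congr' (hev.mono fun R hR => ?_)
  dsimp only
  rw [hR.1.2, hR.2.2]
  ring

theorem proposition3p7 (z : ℝ) (hz : 0 < z) (s : ℝ) (hs0 : 0 < s) (hs1 : s < 1)
    (ν : ℤ → ℝ) (hν : ν = oddLaw z ∨ ν = evenLaw z) :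
    -- the series that defines the potential kernel converges
    (∀ x o : Vertex, Summable fun t : ℕ =>
      nStep (lazyKernel (stepKernel s ν)) t o o - nStep (lazyKernel (stepKernel s ν)) t x o) ∧
    ∀ (α : ℝ), 0 < α → ∀ (Λ D : ℝ → Set Vertex),
      (∀ᶠ R in atTop, IsDirichletDomain α R (Λ R) (D R)) →
      ∀ x x' o : Vertex, SameClass x x' →
        -- the lazy walk
        (∀ K : ℝ → Vertex → Vertex → ℝ,
          (∀ᶠ R in atTop, IsWalkIn (lazyKernel (stepKernel s ν)) (Λ R) (D R) (K R)) →
          (∀ᶠ R in atTop, Summable (fun n : ℕ => nStep (K R) n x o) ∧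
            Summable (fun n : ℕ => nStep (K R) n x' o)) ∧
          Tendsto (fun R : ℝ => green (K R) x o - green (K R) x' o) atTop
            (𝓝 (-(lazyPotential (stepKernel s ν) x o - lazyPotential (stepKernel s ν) x' o)))) ∧
        -- the nonlazy walk
        (∀ K : ℝ → Vertex → Vertex → ℝ,
          (∀ᶠ R in atTop, IsWalkIn (stepKernel s ν) (Λ R) (D R) (K R)) →
          (∀ᶠ R in atTop, Summable (fun n : ℕ => nStep (K R) n x o) ∧
            Summable (fun n : ℕ => nStep (K R) n x' o)) ∧
          Tendsto (fun R : ℝ => green (K R) x o - green (K R) x' o) atTop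
            (𝓝 (-(potential (stepKernel s ν) x o - potential (stepKernel s ν) x' o)))) := by
  have hlaw : IsStepLaw ν := by
    rcases hν with rfl | rfl
    · exact isStepLaw_oddLaw hz
    · exact isStepLaw_evenLaw hz
  exact ⟨summable_lazyPotential hs0 hs1 hlaw, fun α hα Λ D hdom x x' o _ =>
    ⟨fun K hK => tendsto_green_sub_lazy hs0 hs1 hlaw hα hdom x x' o hK,
      fun K hK => tendsto_green_sub hs0 hs1 hlaw hα hdom x x' o hK⟩⟩
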